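/- **Setting.** Let $d\ge 3$, $\alpha\in\mathbb Z$ and $t=-(s+u)$, and let $\mathcal P_j(x)={}_2F_1\big(-j,\,j+d-3;\,\tfrac{d-2}{2};\,\tfrac{1-x}{2}\big)$ be the $d$-dimensional Gegenbauer polynomials. A weakly-coupled spectrum consists of a cut-off $\Lambda\in(0,\infty]$; finitely or infinitely many masses $0=m_0<m_1<\dots<\Lambda$ (if there are infinitely many, then $m_n\to\Lambda$); for each massive level $n\ge1$ a maximum spin $J_n\ge 0$ and real couplings $g_{n,j}$ with $g_{n,J_n}\neq0$ and $g_{n,j}=0$ for $j>J_n$; and real massless couplings $\lambda_j$ with maximum spin $J_0$ ($\lambda_{J_0}\ne0$, $\lambda_j=0$ for $j>J_0$; $J_0=-2$ if there are no massless poles). Only even spins are exchanged: all $J_n$ are even and all couplings of odd spin vanish. Put $$A_{\rm massless}(s,u)=-\sum_{j\le J_0}\frac{\lambda_j^2}{2}\Big(\frac{t^j+u^j}{s}+\frac{u^j+s^j}{t}+\frac{s^j+t^j}{u}\Big).$$ An $stu$-symmetric amplitude $A(s,u)$ satisfies the bootstrap assumptions if: 1. *(Crossing)* $A$ is invariant under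 all permutations of $(s,t,u)$. 2. *(Polynomial boundedness)* For each fixed $u<0$ we have $A(s,u)/s^\alpha\to0$ as $|s|\to\infty$ off the real axis, up to a power of $|s|/|\mathrm{Im}\,s|$, that is, $(|\mathrm{Im}\,s|/|s|)^{M}\,A(s,u)/s^\alpha\to0$ for some $M$ (which may depend on $u$). As $u\to0^-$ the bound $|A(s,u)-A_{\rm massless}(s,u)|\le C\,|s|^{\max(\alpha,J_0+1)}(|s|/|\mathrm{Im}\,s|)^{M}$ holds for all large $|s|$, with constants $C,M$ independent of $u$. 3. *(Partial waves and positivity)* There are positive measures $\rho_j$ on $(0,\infty)$, zero for odd $j$, with $\sum_j\rho_j$ locally finite on $(0,\infty)$, such that for each $u<0$ the discontinuity $\lim_{\varepsilon\to0^+}\frac1{2i}\big(A(s+i\varepsilon,u)-A(s-i\varepsilon,u)\big)$ on $s>-u$ equals $\pi\sum_j s^{\frac{4-d}2}\rho_j(s)\,\mathcal P_j(1+\tfrac{2u}{s})$ as a distribution in $s$ (tested against compactly supported continuous functions). On $0<s<\Lambda^2$, $\rho_j(s)=\sum_{n\ge1}m_n^2g_{n,j}^2\,\delta(s-m_n^2)$.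 4. *(Weak-coupling analyticity, finite spin exchange)* For fixed $u<0$, $A$ is analytic in $s\in\mathbb C$ except possibly at the points $s=m_n^2$ and $s=-u-m_n^2$ ($n\ge 0$) and on the rays $[\Lambda^2,\infty)$ and $(-\infty,-u-\Lambda^2]$. For $n\ge1$ and $-m_n^2<u<0$ the pole at $s=m_n^2$ is simple with residue $-m_n^{6-d}\sum_{j\le J_n}g_{n,j}^2\,\mathcal P_j(1+2u/m_n^2)$. 5. *(Low-energy expansion)* $A(s,u)=A_{\rm massless}(s,u)+\sum_{k\ge0}\sum_{q=0}^k a_{k,q}s^{k-q}u^q$ for $|s|,|t|,|u|<m_1^2$ (away from $stu=0$). **Theorem.** For every such amplitude and every $m_n>0$ in the weakly-coupled spectrum, $$J_n\le\max\big(2\lfloor\tfrac{\alpha-1}{2}\rfloor,J_0,J_1,\dots,J_{n-1}\big)+2 .$$ Equivalently, for every even $j\ge\max(2\lceil\tfrac\alpha2\rceil,J_0+2)$, the lightest spin-$j$ state is strictly lighter than the lightest spin-$(j+2)$ state; that is, if a spin-$(j+2)$ state is exchanged in the weakly-coupled spectrum, then so is a spin-$j$ state, and the lightest of the latter has smaller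 mass than the lightest of the former. -/

import Mathlib

open MeasureTheory Filter Topology
open scoped ENNReal

namespace StuBootstrap

/-- The `d`-dimensional spin-`j` Gegenbauer polynomial
`₂F₁(-j, j + d - 3; (d - 2) / 2; (1 - x) / 2)`, normalized to take the value `1` at `x = 1`. -/
noncomputable def gegenbauer (d j : ℕ) (x : ℝ) : ℝ :=
  ordinaryHypergeometric (-(j : ℝ)) ((j : ℝ) + d - 3) (((d : ℝ) - 2) / 2) ((1 - x) / 2)

/-- The data of a weakly-coupled spectrum: the cut-off, the mass levels below it, and the spins and
three-point couplings of the exchanged states. -/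
structure Spectrum where
  /-- the cut-off `Λ`, possibly infinite -/
  cutoff : ℝ≥0∞
  /-- the number of massive levels, finite or infinite -/
  numLevels : ℕ∞
  /-- `mass n` is the mass `m_n` of level `n`; level `0` is the massless one -/
  mass : ℕ → ℝ
  /-- `maxSpin n` is the maximum spin `J_n` exchanged at level `n` -/
  maxSpin : ℕ → ℤ
  /-- `coupling n j` is the coupling `g_{n,j}` of the spin-`j` state at the massive level `n` -/
  coupling : ℕ → ℕ → ℝ
  /-- `masslessCoupling j` is the coupling `λ_j` of the massless spin-`j` state -/
  masslessCoupling : ℕ → ℝ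

namespace Spectrum

/-- `m_n` is in the weakly-coupled spectrum. -/
def IsLevel (S : Spectrum) (n : ℕ) : Prop := (n : ℕ∞) ≤ S.numLevels

/-- `m_n` is in the weakly-coupled spectrum and `n ≥ 1`. -/
def IsMassiveLevel (S : Spectrum) (n : ℕ) : Prop := 1 ≤ n ∧ S.IsLevel n

/-- A spin-`j` state is exchanged at level `n`. -/
def Exchanges (S : Spectrum) (j n : ℕ) : Prop :=
  (n = 0 ∧ S.masslessCoupling j ≠ 0) ∨ (S.IsMassiveLevel n ∧ S.coupling n j ≠ 0)

/-- `n` is the level of the lightest spin-`j` state. -/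
def IsLightest (S : Spectrum) (j n : ℕ) : Prop := IsLeast {p | S.Exchanges j p} n

/-- The conventions on masses, spins and couplings: `0 = m_0 < m_1 < ⋯ < Λ`, infinitely many levels
can only accumulate at the cut-off, only finitely many and only even spins are exchanged at each
level, and the coupling of the maximum spin does not vanish. If there is no massless pole then
`J_0 = -2`. -/
structure IsAdmissible (S : Spectrum) : Prop where
  mass_zero : S.mass 0 = 0
  mass_lt_mass : ∀ p n, p < n → S.IsLevel n → S.mass p < S.mass n
  mass_lt_cutoff : ∀ n, S.IsLevel n → ENNReal.ofReal (S.mass n) < S.cutoff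
  tendsto_mass : S.numLevels = ⊤ →
    Tendsto (fun n => ENNReal.ofReal (S.mass n)) atTop (𝓝 S.cutoff)
  maxSpin_massive : ∀ n, S.IsMassiveLevel n → 0 ≤ S.maxSpin n ∧ Even (S.maxSpin n)
  coupling_eq_zero : ∀ n, S.IsMassiveLevel n →
    ∀ j : ℕ, Odd j ∨ S.maxSpin n < j → S.coupling n j = 0
  coupling_maxSpin : ∀ n, S.IsMassiveLevel n → S.coupling n (S.maxSpin n).toNat ≠ 0
  maxSpin_massless : S.maxSpin 0 = -2 ∨ (0 ≤ S.maxSpin 0 ∧ Even (S.maxSpin 0) ∧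
    S.masslessCoupling (S.maxSpin 0).toNat ≠ 0)
  masslessCoupling_eq_zero : ∀ j : ℕ, Odd j ∨ S.maxSpin 0 < j → S.masslessCoupling j = 0

/-- The contribution of the exchange of massless states to the amplitude, with `t = -(s + u)`.
Odd `j` do not contribute for an admissible spectrum. -/
noncomputable def masslessAmplitude (S : Spectrum) (s u : ℂ) : ℂ :=
  -∑ j ∈ Finset.range ((S.maxSpin 0).toNat + 1), (S.masslessCoupling j : ℂ) ^ 2 * (1 / 2) *
    (((-(s + u)) ^ j + u ^ j) / s + (u ^ j + s ^ j) / (-(s + u)) + (s ^ j + (-(s + u)) ^ j) / u)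

/-- At fixed `u < 0`, the points of the real `s`-axis at which the amplitude may fail to be
analytic: the `s`- and `t`-channel poles, and everything beyond the cut-off in these channels. -/
def singularSet (S : Spectrum) (u : ℝ) : Set ℂ :=
  {s | ∃ x : ℝ, s = x ∧ ((∃ n, S.IsLevel n ∧ (x = S.mass n ^ 2 ∨ x = -u - S.mass n ^ 2)) ∨
    S.cutoff ^ 2 ≤ ENNReal.ofReal x ∨ S.cutoff ^ 2 ≤ ENNReal.ofReal (-u - x))}

/-- `z` lies strictly below all massive thresholds, i.e. `|z| < m_1 ^ 2`. (If there is no massive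
level, this reads `|z| < Λ ^ 2`.) -/
def BelowThresholds (S : Spectrum) (z : ℂ) : Prop :=
  (∀ n, S.IsMassiveLevel n → ‖z‖ < S.mass n ^ 2) ∧ ENNReal.ofReal ‖z‖ < S.cutoff ^ 2

/-- The (negative of the) residue at `s = m_n ^ 2` as a function of `u`. -/
noncomputable def residue (S : Spectrum) (d n : ℕ) (u : ℝ) : ℝ :=
  S.mass n ^ (6 - d : ℤ) * ∑ j ∈ Finset.range ((S.maxSpin n).toNat + 1),
    S.coupling n j ^ 2 * gegenbauer d j (1 + 2 * u / S.mass n ^ 2)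

end Spectrum

/-- Full crossing symmetry. The function `A` carries arbitrary values outside of the domain of the
amplitude (at its poles, say); as that domain is invariant under the permutations of
`s, t, u`, there is no loss in asking for the symmetry everywhere. -/
def CrossingSymmetric (A : ℂ → ℂ → ℂ) : Prop :=
  ∀ s t u : ℂ, s + t + u = 0 →
    A s u = A u t ∧ A s u = A t s ∧ A s u = A u s ∧ A s u = A t u ∧ A s u = A s t

/-- Polynomial boundedness: at fixed `u < 0` the quotient `A(s, u) / s ^ α` tends to `0` as
`|s| → ∞` off the real axis. The singularities on the real axis force `A` to blow up as it is
approached; this is allowed, at the rate of some power of `|s| / |Im s|`.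
As `u → 0⁻`, once the massless poles are removed, a bound by the power `max(α, J_0 + 1)` holds
uniformly in `u`. -/
structure PolynomiallyBounded (α : ℤ) (S : Spectrum) (A : ℂ → ℂ → ℂ) : Prop where
  tendsto_zero : ∀ u : ℝ, u < 0 → ∃ M : ℕ,
    Tendsto (fun s : ℂ => (|s.im| / ‖s‖) ^ M * (‖A s u‖ / ‖s‖ ^ α))
      (Bornology.cobounded ℂ ⊓ 𝓟 {s | s.im ≠ 0}) (𝓝 0)
  bounded_near_zero : ∃ (M : ℕ) (δ C R : ℝ), 0 < δ ∧
    ∀ u : ℝ, -δ < u → u < 0 → ∀ s : ℂ, R ≤ ‖s‖ → s.im ≠ 0 →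
      (|s.im| / ‖s‖) ^ M * ‖A s u - S.masslessAmplitude s u‖ ≤ C * ‖s‖ ^ max α (S.maxSpin 0 + 1)

/-- Partial wave decomposition of the imaginary part of the amplitude, with positive spectral
densities `ρ_j`. The imaginary part is the discontinuity across the real `s`-axis,
`Im A(s, u) = lim (A(s + iε, u) - A(s - iε, u)) / 2i`, which is a distribution in `s`, and so are the
spectral densities; positive distributions are measures. For physical kinematics `s > -u > 0`,
`Im A(s, u) = π ∑ⱼ s ^ ((4 - d) / 2) ρ_j(s) P_j(1 + 2 u / s)`. -/
structure PartialWaves (d : ℕ) (A : ℂ → ℂ → ℂ) (S : Spectrum) (ρ : ℕ → Measure ℝ) : Prop where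
  /-- the sum over spins converges (up to the forward direction `u = 0`) to a locally finite
  measure -/
  locallyFinite : ∀ a b : ℝ, 0 < a → ∑' j, ρ j (Set.Icc a b) ≠ ∞
  /-- only even spins contribute -/
  odd_eq_zero : ∀ j, Odd j → ρ j = 0
  discontinuity : ∀ u : ℝ, u < 0 → ∀ f : ℝ → ℝ, Continuous f → HasCompactSupport f →
    tsupport f ⊆ Set.Ioi (-u) →
    Tendsto (fun ε : ℝ => ∫ x : ℝ, (f x : ℂ) *
        ((A (x + ε * Complex.I) u - A (x - ε * Complex.I) u) / (2 * Complex.I)))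
      (𝓝[>] 0)
      (𝓝 ((Real.pi * ∑' j, ∫ x, f x * x ^ ((4 - d : ℝ) / 2) * gegenbauer d j (1 + 2 * u / x) ∂(ρ j) :
        ℝ) : ℂ))
  /-- below the cut-off there is nothing but the exchanged states,
  `ρ_j(s) = ∑ₙ m_n ^ 2 g_{n,j} ^ 2 δ(s - m_n ^ 2)` -/
  below_cutoff : ∀ j, (ρ j).restrict {x | 0 < x ∧ ENNReal.ofReal x < S.cutoff ^ 2} =
    Measure.sum fun n : {n // S.IsMassiveLevel n} =>
      ENNReal.ofReal (S.mass n ^ 2 * S.coupling n j ^ 2) • Measure.dirac (S.mass n ^ 2)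

/-- Weak-coupling analyticity with simple poles, and polynomial residues. The residues are
prescribed for physical kinematics `-m_n ^ 2 < u < 0`, where no `t`-channel pole can meet
`s = m_n ^ 2`; those of the `t`-channel poles are determined by crossing symmetry. -/
structure WeakCouplingAnalytic (d : ℕ) (A : ℂ → ℂ → ℂ) (S : Spectrum) : Prop where
  analyticAt : ∀ u : ℝ, u < 0 → ∀ s : ℂ, s ∉ S.singularSet u → AnalyticAt ℂ (fun z => A z u) s
  simplePole : ∀ n, S.IsMassiveLevel n → ∀ u : ℝ, -S.mass n ^ 2 < u → u < 0 →
    Tendsto (fun s : ℂ => (s - (S.mass n : ℂ) ^ 2) * A s u) (𝓝[≠] ((S.mass n : ℂ) ^ 2))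
      (𝓝 ((-S.residue d n u : ℝ) : ℂ))

/-- Low-energy expansion: near `s = u = 0`, for `|s|, |t|, |u| < m_1 ^ 2`, the amplitude is the sum
of the massless exchanges and of a power series, graded by the total degree `k`. -/
def LowEnergyExpansion (A : ℂ → ℂ → ℂ) (S : Spectrum) : Prop :=
  ∃ a : ℕ → ℕ → ℂ, ∀ s u : ℂ, s ≠ 0 → u ≠ 0 → s + u ≠ 0 →
    S.BelowThresholds s → S.BelowThresholds u → S.BelowThresholds (s + u) →
    HasSum (fun k => ∑ q ∈ Finset.range (k + 1), a k q * s ^ (k - q) * u ^ q)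
      (A s u - S.masslessAmplitude s u)

/-- An `stu`-symmetric four-point amplitude of massless scalars in `d` spacetime dimensions which
satisfies the bootstrap assumptions, with Regge exponent `α`, spectrum `S` and spectral
densities `ρ`. -/
structure IsStuAmplitude (d : ℕ) (α : ℤ) (S : Spectrum) (ρ : ℕ → Measure ℝ) (A : ℂ → ℂ → ℂ) :
    Prop where
  admissible : S.IsAdmissible
  crossing : CrossingSymmetric A
  bounded : PolynomiallyBounded α S A
  partialWaves : PartialWaves d A S ρ
  analytic : WeakCouplingAnalytic d A S
  lowEnergy : LowEnergyExpansion A S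

end StuBootstrap

/-!
Write `A = massless poles + B`, and let `c k q` be the coefficient of `s ^ k * u ^ q` in the
expansion of `B` at low energies; crossing symmetry gives `c k q = c q k`. Suppose that the spin
`J_n` exceeds the bound. Then `J_n = K + 2` with `K ≥ 0` even, `K ≥ α`, `K ≥ J_0 + 2`, and all
spins at the massive levels below `m_n` are less than `K`.

*Dispersion relation* (`IsStuAmplitude.exists_sumRules`). For `k ≥ K` and small `u < 0`,
`∑_q c k q * u ^ q` is the integral of
`P_j(1 + 2u/x) * (x ^ (-k-1) + (-1)^k * (x + u) ^ (-k-1))` against one positive measure on pairs of a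
spin `j` and a squared mass `x`. In terms of `w = s + u/2`, which changes sign under `s ↔ t`,
Cauchy's theorem is needed only in a half-annulus of the upper half-plane
(`integral_add_comp_neg_eq_archIntegral_sub`), shifted away from the real axis by `ε`: as `B` is even
in `w` and the kernel is odd, the two real segments of the boundary combine into the discontinuity
of the amplitude, smeared with the kernel. A factor `(1 - w²/X²)^L` makes up for the growth of `A`
near the real axis at the outer radius `X` (`norm_smearedDisc_sub_le`). The bound which is uniform as
`u → 0⁻` shows that `x ^ (-K-1)` is integrable, and `X → ∞` at fixed `u` removes the cut-off.

*Crossing symmetry* (`SumRules.gap_contradiction`). Expanding in `u` expresses `c k q` by moments of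
the measure. All of these are finite, because the Taylor remainders of `P_j` at the forward direction
alternate in sign (`gegenbauerRem_bounds`). For a single state of spin `j < q`, the difference of its
contributions to `c q k` and `c k q` is the Taylor coefficient of order `k` of `P_j` times a
power of the mass (`kernelCoeff_sub_kernelCoeff`); it vanishes if `j < k`. Hence the parts `c> k q` of
the sum rules which come from the states above `m_n` behave as
`c> k q * m_n ^ (2q) → w_k` for `q → ∞`, where `w_k` is a positive combination of the couplings at
`m_n`: `w_(K+2) > 0` as a spin `K + 2` is exchanged there, while `w_(K+4) = 0`. So the functions
`F_k(u) = ∑_q c> k q * u ^ q` are governed, as `u` tends to `m_n²` from below, by a pole with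
coefficient `w_k`. They are also integrals over `x > m_n²` of a positive measure against
positive kernels, whence `2 * F_(K+2) ≤ a * F_K + a⁻¹ * F_(K+4)` for all `a > 0` by the inequality
of the means (`dispersionKernel_convex`). Comparing the poles, `2 * w_(K+2) ≤ a * w_K` for all `a > 0`,
a contradiction.

The statement on the lightest states follows by applying the bound at the first level whose
spin is at least `j`.
-/

namespace StuBootstrap

/-! ### Gegenbauer polynomials -/

/-- The coefficient of `v ^ i` in `gegenbauer d j (1 + 2 * v)`, by its hypergeometric recursion. -/
noncomputable def gegenbauerCoeff (d j : ℕ) : ℕ → ℝ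
  | 0 => 1
  | i + 1 => gegenbauerCoeff d j i * (((j : ℝ) - i) * (j + d - 3 + i)) /
      ((i + 1) * (i + ((d : ℝ) - 2) / 2))

lemma gegenbauerCoeff_zero (d j : ℕ) : gegenbauerCoeff d j 0 = 1 := rfl

lemma gegenbauerCoeff_succ (d j i : ℕ) : gegenbauerCoeff d j (i + 1) =
    gegenbauerCoeff d j i * (((j : ℝ) - i) * (j + d - 3 + i)) /
      ((i + 1) * (i + ((d : ℝ) - 2) / 2)) := rfl

lemma gegenbauerCoeff_eq_zero {d j i : ℕ} (h : j < i) : gegenbauerCoeff d j i = 0 := by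
  induction i with
  | zero => omega
  | succ i ih =>
    rw [gegenbauerCoeff_succ]
    rcases (Nat.lt_succ_iff_lt_or_eq).1 h with h' | h'
    · simp [ih h']
    · simp [h']

lemma half_pos_of_three_le {d : ℕ} (hd : 3 ≤ d) : (1 : ℝ) / 2 ≤ ((d : ℝ) - 2) / 2 := by
  have : (3 : ℝ) ≤ d := by exact_mod_cast hd
  linarith

lemma gegenbauerCoeff_pos {d j i : ℕ} (hd : 3 ≤ d) (h : i ≤ j) : 0 < gegenbauerCoeff d j i := by
  induction i with
  | zero => simp [gegenbauerCoeff_zero]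
  | succ i ih =>
    rw [gegenbauerCoeff_succ]
    have h1 : (i : ℝ) + 1 ≤ j := by exact_mod_cast h
    have h2 : (3 : ℝ) ≤ d := by exact_mod_cast hd
    have h3 := half_pos_of_three_le hd
    have h0 : (0 : ℝ) ≤ i := by positivity
    have := ih (by omega)
    refine div_pos (mul_pos this (mul_pos (by linarith) (by linarith))) (mul_pos (by linarith) (by linarith))

lemma gegenbauerCoeff_nonneg {d : ℕ} (hd : 3 ≤ d) (j i : ℕ) : 0 ≤ gegenbauerCoeff d j i := by
  rcases le_or_gt i j with h | h
  · exact (gegenbauerCoeff_pos hd h).le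
  · exact (gegenbauerCoeff_eq_zero h).ge

/-- The polynomial `gegenbauer d j (1 + 2 * v)` in `v`. -/
noncomputable def gegenbauerPoly (d j : ℕ) : Polynomial ℝ :=
  ∑ i ∈ Finset.range (j + 1), Polynomial.monomial i (gegenbauerCoeff d j i)

lemma coeff_gegenbauerPoly (d j i : ℕ) :
    (gegenbauerPoly d j).coeff i = gegenbauerCoeff d j i := by
  simp only [gegenbauerPoly, Polynomial.finsetSum_coeff, Polynomial.coeff_monomial]
  rw [Finset.sum_ite_eq']
  split_ifs with h
  · rfl
  · rw [gegenbauerCoeff_eq_zero]; simpa using h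

lemma eval_gegenbauerPoly (d j : ℕ) (v : ℝ) :
    (gegenbauerPoly d j).eval v = ∑ i ∈ Finset.range (j + 1), gegenbauerCoeff d j i * v ^ i := by
  simp [gegenbauerPoly, Polynomial.eval_finsetSum]

lemma gegenbauer_eq_eval {d : ℕ} (hd : 3 ≤ d) (j : ℕ) (v : ℝ) :
    gegenbauer d j (1 + 2 * v) = (gegenbauerPoly d j).eval v := by
  have hx : (1 - (1 + 2 * v)) / 2 = -v := by ring
  rw [gegenbauer, hx, ordinaryHypergeometric_eq_tsum, eval_gegenbauerPoly]
  have key : ∀ n : ℕ, (((n.factorial : ℝ))⁻¹ * (ascPochhammer ℝ n).eval (-(j : ℝ)) *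
      (ascPochhammer ℝ n).eval ((j : ℝ) + d - 3) *
      ((ascPochhammer ℝ n).eval (((d : ℝ) - 2) / 2))⁻¹) * (-1) ^ n = gegenbauerCoeff d j n := by
    intro n
    induction n with
    | zero => simp [gegenbauerCoeff_zero]
    | succ n ih =>
      rw [gegenbauerCoeff_succ, ← ih]
      have h3 := half_pos_of_three_le hd
      have h4 : ((d : ℝ) - 2) / 2 + n ≠ 0 := by positivity
      have h5 : (n : ℝ) + 1 ≠ 0 := by positivity
      simp only [ascPochhammer_succ_eval, Nat.factorial_succ, Nat.cast_mul, Nat.cast_succ, mul_inv,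
        pow_succ, div_eq_mul_inv]
      rw [add_comm (n : ℝ) (((d : ℝ) - 2) * 2⁻¹)]
      ring
  beta_reduce
  rw [tsum_eq_sum (s := Finset.range (j + 1))]
  · refine Finset.sum_congr rfl fun i _ => ?_
    rw [← key i, smul_eq_mul, neg_pow v i]
    ring
  · intro i hi
    have : gegenbauerCoeff d j i = 0 := gegenbauerCoeff_eq_zero (by simpa using hi)
    rw [← key i] at this
    have h1 : ((-1 : ℝ)) ^ i ≠ 0 := pow_ne_zero _ (by norm_num)
    rw [(mul_eq_zero.1 this).resolve_right h1, zero_smul]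

lemma gegenbauerCoeff_derivative {d : ℕ} (hd : 3 ≤ d) (j i : ℕ) :
    gegenbauerCoeff d (j + 1) (i + 1) * (i + 1) =
      gegenbauerCoeff d (j + 1) 1 * gegenbauerCoeff (d + 2) j i := by
  induction i with
  | zero => simp [gegenbauerCoeff_zero]
  | succ i ih =>
    rw [gegenbauerCoeff_succ _ _ (i + 1), gegenbauerCoeff_succ (d + 2)]
    have h3 := half_pos_of_three_le hd
    have h4 : (i : ℝ) + 1 + ((d : ℝ) - 2) / 2 ≠ 0 := by positivity
    have h5 : (i : ℝ) + 1 ≠ 0 := by positivity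
    have h6 : (i : ℝ) + 1 + 1 ≠ 0 := by positivity
    have h7 : gegenbauerCoeff d (j + 1) (i + 1) =
      gegenbauerCoeff d (j + 1) 1 * gegenbauerCoeff (d + 2) j i / (i + 1) := by
      rw [← ih]; field_simp
    rw [h7]
    push_cast
    have h8 : (i : ℝ) + ((d : ℝ) + 2 - 2) / 2 = i + 1 + ((d : ℝ) - 2) / 2 := by ring
    rw [h8]
    field_simp
    ring

/-- The derivative of a Gegenbauer polynomial is a Gegenbauer polynomial in two more dimensions. -/
lemma derivative_gegenbauerPoly {d : ℕ} (hd : 3 ≤ d) (j : ℕ) :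
    (gegenbauerPoly d (j + 1)).derivative =
      Polynomial.C (gegenbauerCoeff d (j + 1) 1) * gegenbauerPoly (d + 2) j := by
  ext i
  rw [Polynomial.coeff_derivative, Polynomial.coeff_C_mul, coeff_gegenbauerPoly,
    coeff_gegenbauerPoly, gegenbauerCoeff_derivative hd]

lemma gegenbauerCoeff_recursion {d : ℕ} (hd : 3 ≤ d) (j i : ℕ) :
    gegenbauerCoeff d j (i + 1) * ((i + 1) * (i + ((d : ℝ) - 2) / 2)) =
      gegenbauerCoeff d j i * (((j : ℝ) - i) * (j + d - 3 + i)) := by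
  have h3 := half_pos_of_three_le hd
  have h4 : (i : ℝ) + ((d : ℝ) - 2) / 2 ≠ 0 := by positivity
  have h5 : (i : ℝ) + 1 ≠ 0 := by positivity
  rw [gegenbauerCoeff_succ, div_mul_cancel₀ _ (mul_ne_zero h5 h4)]

open Polynomial in
/-- Gegenbauer's differential equation, in the variable `v`. -/
lemma gegenbauerPoly_ode {d : ℕ} (hd : 3 ≤ d) (j : ℕ) :
    X * (1 + X) * derivative (derivative (gegenbauerPoly d j)) +
      C (((d : ℝ) - 2) / 2) * (1 + 2 * X) * derivative (gegenbauerPoly d j) =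
      C ((j : ℝ) * (j + d - 3)) * gegenbauerPoly d j := by
  have hc := gegenbauerCoeff_recursion hd j
  obtain ⟨c, hcd⟩ : ∃ c : ℝ, (d : ℝ) = 2 * c + 2 := ⟨((d : ℝ) - 2) / 2, by ring⟩
  obtain ⟨N, hN⟩ : ∃ N : ℝ, N = (j : ℝ) * (j + (2 * c + 2) - 3) := ⟨_, rfl⟩
  have hcd' : (2 * c + 2 - 2) / 2 = c := by ring
  rw [hcd, hcd', ← hN]
  simp only [hcd, hcd'] at hc
  ext i
  have h := hc i
  have e1 : X * (1 + X) * derivative (derivative (gegenbauerPoly d j)) +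
      C c * (1 + 2 * X) * derivative (gegenbauerPoly d j) =
      X * derivative (derivative (gegenbauerPoly d j)) +
      X * (X * derivative (derivative (gegenbauerPoly d j))) +
      C c * derivative (gegenbauerPoly d j) +
      C (2 * c) * (X * derivative (gegenbauerPoly d j)) := by
    rw [C_mul, show (C 2 : ℝ[X]) = 2 from map_ofNat C 2]; ring
  rw [e1]
  rcases i with _ | _ | i <;>
  · simp only [coeff_add, coeff_C_mul, coeff_X_mul, coeff_X_mul_zero, coeff_derivative,
      coeff_gegenbauerPoly, hN]
    push_cast at h ⊢
    linarith

/-- On the right half of the physical interval Gegenbauer polynomials are bounded by their value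
in the forward direction. -/
lemma abs_eval_gegenbauerPoly_le_one {d : ℕ} (hd : 3 ≤ d) (j : ℕ) {v : ℝ} (hv : -(1 / 2) ≤ v)
    (hv0 : v ≤ 0) : |(gegenbauerPoly d j).eval v| ≤ 1 := by
  rcases Nat.eq_zero_or_pos j with rfl | hj
  · simp [eval_gegenbauerPoly, gegenbauerCoeff_zero]
  set p := gegenbauerPoly d j with hp
  set N : ℝ := (j : ℝ) * (j + d - 3) with hN
  have hd' : (3 : ℝ) ≤ d := by exact_mod_cast hd
  have hj' : (1 : ℝ) ≤ j := by exact_mod_cast hj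
  have hNpos : 0 < N := mul_pos (by linarith) (by linarith)
  -- the energy of a solution of the differential equation is monotone on `[-1/2, 0]`
  let E : ℝ → ℝ := fun x => p.eval x ^ 2 - x * (1 + x) * (p.derivative.eval x) ^ 2 / N
  have hode : ∀ x : ℝ, x * (1 + x) * p.derivative.derivative.eval x +
      (((d : ℝ) - 2) / 2) * (1 + 2 * x) * p.derivative.eval x = N * p.eval x := by
    intro x
    have := congrArg (Polynomial.eval x) (gegenbauerPoly_ode hd j)
    simpa using this
  have hE : ∀ x : ℝ, HasDerivAt E (2 * p.derivative.eval x ^ 2 / N *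
      ((((d : ℝ) - 2) / 2 - 1 / 2) * (1 + 2 * x))) x := by
    intro x
    have h1 := (p.hasDerivAt x).pow 2
    have h2 := (p.derivative.hasDerivAt x).pow 2
    have h3 : HasDerivAt (fun x : ℝ => x * (1 + x)) (1 * (1 + x) + x * 1) x :=
      (hasDerivAt_id x).mul ((hasDerivAt_id x).const_add 1)
    have h4 := h1.sub ((h3.mul h2).div_const N)
    refine h4.congr_deriv ?_
    simp only [Pi.pow_apply, Nat.cast_ofNat, Nat.add_one_sub_one, pow_one]
    have := hode x
    have h5 : p.eval x = (x * (1 + x) * p.derivative.derivative.eval x +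
      (((d : ℝ) - 2) / 2) * (1 + 2 * x) * p.derivative.eval x) / N := by
      rw [this]; field_simp
    rw [h5]
    field_simp
    ring
  have hmono : MonotoneOn E (Set.Icc (-(1 / 2)) 0) := by
    refine monotoneOn_of_deriv_nonneg (convex_Icc _ _)
      (fun x _ => (hE x).continuousAt.continuousWithinAt)
      (fun x _ => (hE x).differentiableAt.differentiableWithinAt) fun x hx => ?_
    rw [interior_Icc] at hx
    rw [(hE x).deriv]
    have := hx.1
    exact mul_nonneg (by positivity) (mul_nonneg (by linarith) (by linarith))
  have h1 : E v ≤ E 0 := hmono ⟨hv, hv0⟩ ⟨by norm_num, le_rfl⟩ hv0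
  have h2 : E 0 = 1 := by
    simp [E, hp, ← Polynomial.coeff_zero_eq_eval_zero, coeff_gegenbauerPoly, gegenbauerCoeff_zero]
  have h3 : p.eval v ^ 2 ≤ E v := by
    have : v * (1 + v) * (p.derivative.eval v) ^ 2 / N ≤ 0 := by
      refine div_nonpos_of_nonpos_of_nonneg ?_ hNpos.le
      exact mul_nonpos_of_nonpos_of_nonneg
        (mul_nonpos_of_nonpos_of_nonneg hv0 (by linarith)) (sq_nonneg _)
    simp only [E]; linarith
  rw [← sq_le_one_iff_abs_le_one]
  linarith

/-- The remainder of order `q` in the expansion of `gegenbauer d j (1 + 2 * v)` around `v = 0`. -/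
noncomputable def gegenbauerRem (d j q : ℕ) (v : ℝ) : ℝ :=
  (gegenbauerPoly d j).eval v - ∑ i ∈ Finset.range q, gegenbauerCoeff d j i * v ^ i

lemma gegenbauerRem_zero_right (d j q : ℕ) : gegenbauerRem d j (q + 1) 0 = 0 := by
  simp [gegenbauerRem, ← Polynomial.coeff_zero_eq_eval_zero, coeff_gegenbauerPoly,
    Finset.sum_range_succ', gegenbauerCoeff_zero]

lemma gegenbauerRem_spin_zero (d q : ℕ) (v : ℝ) : gegenbauerRem d 0 (q + 1) v = 0 := by
  simp [gegenbauerRem, eval_gegenbauerPoly, Finset.sum_range_succ', gegenbauerCoeff_zero,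
    gegenbauerCoeff_eq_zero]

lemma hasDerivAt_gegenbauerRem {d : ℕ} (hd : 3 ≤ d) (j q : ℕ) (v : ℝ) :
    HasDerivAt (gegenbauerRem d (j + 1) (q + 1))
      (gegenbauerCoeff d (j + 1) 1 * gegenbauerRem (d + 2) j q v) v := by
  have h1 := (gegenbauerPoly d (j + 1)).hasDerivAt v
  have h2 : HasDerivAt (fun v : ℝ => ∑ i ∈ Finset.range (q + 1), gegenbauerCoeff d (j + 1) i * v ^ i)
      (∑ i ∈ Finset.range (q + 1), gegenbauerCoeff d (j + 1) i * (i * v ^ (i - 1))) v :=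
    HasDerivAt.fun_sum fun i _ => (hasDerivAt_pow i v).const_mul _
  refine (h1.sub h2).congr_deriv ?_
  rw [derivative_gegenbauerPoly hd, Finset.sum_range_succ', gegenbauerRem]
  simp only [Polynomial.eval_mul, Polynomial.eval_C, mul_sub, Finset.mul_sum, Nat.cast_zero,
    zero_mul, mul_zero, add_zero]
  congr 1
  refine Finset.sum_congr rfl fun i _ => ?_
  rw [← mul_assoc, ← mul_assoc (gegenbauerCoeff d (j + 1) 1), ← gegenbauerCoeff_derivative hd]
  push_cast
  simp

/-- The remainders of the expansion around the forward direction have alternating signs, and are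
bounded by the first omitted term. -/
lemma gegenbauerRem_bounds {d : ℕ} (hd : 3 ≤ d) (j q : ℕ) {v : ℝ} (hv : -(1 / 2) ≤ v)
    (hv0 : v ≤ 0) :
    0 ≤ (-1) ^ (q + 1) * gegenbauerRem d j (q + 1) v ∧
      |gegenbauerRem d j q v| ≤ gegenbauerCoeff d j q * |v| ^ q := by
  have aux : ∀ q d j, 3 ≤ d → ∀ v : ℝ, -(1 / 2) ≤ v → v ≤ 0 →
      |gegenbauerRem d j q v| ≤ gegenbauerCoeff d j q * |v| ^ q := by
    intro q
    induction q with
    | zero =>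
      intro d j hd v hv hv0
      simpa [gegenbauerRem, gegenbauerCoeff_zero] using abs_eval_gegenbauerPoly_le_one hd j hv hv0
    | succ q ih =>
      intro d j hd v hv hv0
      rcases j with _ | j
      · rw [gegenbauerRem_spin_zero, abs_zero]
        exact mul_nonneg (gegenbauerCoeff_nonneg hd _ _) (by positivity)
      · -- compare derivatives on `[v, 0]`
        have h1 : ∀ x ∈ Set.Icc v 0, |gegenbauerCoeff d (j + 1) 1 * gegenbauerRem (d + 2) j q x| ≤
            gegenbauerCoeff d (j + 1) (q + 1) * (q + 1) * (-x) ^ q := by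
          intro x hx
          rw [abs_mul, abs_of_nonneg (gegenbauerCoeff_nonneg hd _ _), gegenbauerCoeff_derivative hd,
            mul_assoc]
          refine mul_le_mul_of_nonneg_left ?_ (gegenbauerCoeff_nonneg hd _ _)
          have := ih (d + 2) j (by omega) x (hv.trans hx.1) hx.2
          rwa [abs_of_nonpos hx.2] at this
        let T : ℝ → ℝ := fun x => gegenbauerCoeff d (j + 1) (q + 1) * (-x) ^ (q + 1)
        have hT : ∀ x, HasDerivAt T
            (-(gegenbauerCoeff d (j + 1) (q + 1) * (q + 1) * (-x) ^ q)) x := by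
          intro x
          refine (((hasDerivAt_neg x).pow (q + 1)).const_mul _).congr_deriv ?_
          simp
          ring
        have hR := hasDerivAt_gegenbauerRem hd j q
        have hup : AntitoneOn (fun x => T x + gegenbauerRem d (j + 1) (q + 1) x) (Set.Icc v 0) := by
          refine antitoneOn_of_deriv_nonpos (convex_Icc _ _)
            (fun x _ => ((hT x).add (hR x)).continuousAt.continuousWithinAt)
            (fun x _ => ((hT x).add (hR x)).differentiableAt.differentiableWithinAt) fun x hx => ?_
          rw [show deriv (fun x => T x + gegenbauerRem d (j + 1) (q + 1) x) x = _ from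
            ((hT x).add (hR x)).deriv]
          linarith [(abs_le.1 (h1 x (interior_subset hx))).2]
        have hdn : AntitoneOn (fun x => T x - gegenbauerRem d (j + 1) (q + 1) x) (Set.Icc v 0) := by
          refine antitoneOn_of_deriv_nonpos (convex_Icc _ _)
            (fun x _ => ((hT x).sub (hR x)).continuousAt.continuousWithinAt)
            (fun x _ => ((hT x).sub (hR x)).differentiableAt.differentiableWithinAt) fun x hx => ?_
          rw [show deriv (fun x => T x - gegenbauerRem d (j + 1) (q + 1) x) x = _ from
            ((hT x).sub (hR x)).deriv]
          linarith [(abs_le.1 (h1 x (interior_subset hx))).1]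
        have a1 := hup ⟨le_rfl, hv0⟩ ⟨hv0, le_rfl⟩ hv0
        have a2 := hdn ⟨le_rfl, hv0⟩ ⟨hv0, le_rfl⟩ hv0
        simp only [gegenbauerRem_zero_right, T, neg_zero, ne_eq, Nat.add_eq_zero_iff, one_ne_zero,
          and_false, not_false_eq_true, zero_pow, mul_zero, add_zero, sub_zero] at a1 a2
        rw [abs_of_nonpos hv0, abs_le]
        constructor <;> linarith
  refine ⟨?_, aux q d j hd v hv hv0⟩
  induction q generalizing d j v with
  | zero =>
    have := (abs_le.1 (aux 0 d j hd v hv hv0)).2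
    simp [gegenbauerRem, gegenbauerCoeff_zero] at this ⊢
    exact this
  | succ q ih =>
    rcases j with _ | j
    · simp [gegenbauerRem_spin_zero]
    · have hR : ∀ x, HasDerivAt (fun x => (-1) ^ (q + 1 + 1) * gegenbauerRem d (j + 1) (q + 1 + 1) x)
          ((-1) ^ (q + 1 + 1) *
            (gegenbauerCoeff d (j + 1) 1 * gegenbauerRem (d + 2) j (q + 1) x)) x :=
        fun x => (hasDerivAt_gegenbauerRem hd j (q + 1) x).const_mul _
      have hm : AntitoneOn (fun x => (-1) ^ (q + 1 + 1) * gegenbauerRem d (j + 1) (q + 1 + 1) x)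
          (Set.Icc v 0) := by
        refine antitoneOn_of_deriv_nonpos (convex_Icc _ _)
            (fun x _ => (hR x).continuousAt.continuousWithinAt)
            (fun x _ => (hR x).differentiableAt.differentiableWithinAt) fun x hx => ?_
        rw [(hR x).deriv]
        have hx' := interior_subset hx
        have := ih (d := d + 2) (by omega) j (hv.trans hx'.1) hx'.2
        have h0 := mul_nonneg (gegenbauerCoeff_nonneg hd (j + 1) 1) this
        rw [pow_succ]
        linarith
      have := hm ⟨le_rfl, hv0⟩ ⟨hv0, le_rfl⟩ hv0
      simpa [gegenbauerRem_zero_right] using this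

open Polynomial in
/-- Gegenbauer's differential equation determines its polynomial solutions. -/
lemma eq_gegenbauerPoly_of_ode {d : ℕ} (hd : 3 ≤ d) (j : ℕ) {p : ℝ[X]} (h0 : p.coeff 0 = 1)
    (hp : X * (1 + X) * derivative (derivative p) +
      C (((d : ℝ) - 2) / 2) * (1 + 2 * X) * derivative p = C ((j : ℝ) * (j + d - 3)) * p) :
    p = gegenbauerPoly d j := by
  have hd' := half_pos_of_three_le hd
  have hc := gegenbauerCoeff_recursion hd j
  obtain ⟨c, hcd⟩ : ∃ c : ℝ, (d : ℝ) = 2 * c + 2 := ⟨((d : ℝ) - 2) / 2, by ring⟩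
  have hcd' : (2 * c + 2 - 2) / 2 = c := by ring
  obtain ⟨N, hN⟩ : ∃ N : ℝ, N = (j : ℝ) * (j + (2 * c + 2) - 3) := ⟨_, rfl⟩
  rw [hcd, hcd', ← hN] at hp
  simp only [hcd, hcd'] at hc hd'
  have e1 : X * (1 + X) * derivative (derivative p) + C c * (1 + 2 * X) * derivative p =
      X * derivative (derivative p) + X * (X * derivative (derivative p)) +
      C c * derivative p + C (2 * c) * (X * derivative p) := by
    rw [C_mul, show (C 2 : ℝ[X]) = 2 from map_ofNat C 2]; ring
  rw [e1] at hp
  ext i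
  rw [coeff_gegenbauerPoly]
  induction i with
  | zero => rw [h0, gegenbauerCoeff_zero]
  | succ i ih =>
    have h1 : (i : ℝ) + c ≠ 0 := by positivity
    have h2 : (i : ℝ) + 1 ≠ 0 := by positivity
    refine mul_right_cancel₀ (mul_ne_zero h2 h1) ?_
    rw [hc i, ← ih]
    have h3 := congrArg (fun r => coeff r i) hp
    rcases i with _ | _ | i <;>
    · simp only [coeff_add, coeff_C_mul, coeff_X_mul, coeff_X_mul_zero, coeff_derivative, hN] at h3
      push_cast at h3 ⊢
      linarith

/-- The coefficients of the even-spin Gegenbauer polynomials in powers of `v * (1 + v)`. -/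
noncomputable def gegenbauerEvenCoeff (d m : ℕ) : ℕ → ℝ
  | 0 => 1
  | i + 1 => gegenbauerEvenCoeff d m i *
      ((2 * m : ℝ) * (2 * m + d - 3) - 2 * i * (2 * i + d - 3)) / ((i + 1) * (i + ((d : ℝ) - 2) / 2))

lemma gegenbauerEvenCoeff_eq_zero {d m i : ℕ} (h : m < i) : gegenbauerEvenCoeff d m i = 0 := by
  induction i with
  | zero => omega
  | succ i ih =>
    rw [gegenbauerEvenCoeff]
    rcases (Nat.lt_succ_iff_lt_or_eq).1 h with h' | h'
    · simp [ih h']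
    · simp [h']

open Polynomial in
/-- The even-spin Gegenbauer polynomials are symmetric under `v ↦ -1 - v`: they are polynomials
in `v * (1 + v)`. -/
lemma gegenbauerPoly_even {d : ℕ} (hd : 3 ≤ d) (m : ℕ) :
    gegenbauerPoly d (2 * m) =
      ∑ i ∈ Finset.range (m + 1), C (gegenbauerEvenCoeff d m i) * (X * (1 + X)) ^ i := by
  have hd' := half_pos_of_three_le hd
  set f : ℝ[X] := ∑ i ∈ Finset.range (m + 1), monomial i (gegenbauerEvenCoeff d m i) with hf
  have hfc : ∀ i, f.coeff i = gegenbauerEvenCoeff d m i := by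
    intro i
    simp only [hf, Polynomial.finsetSum_coeff, Polynomial.coeff_monomial]
    rw [Finset.sum_ite_eq']
    split_ifs with h
    · rfl
    · rw [gegenbauerEvenCoeff_eq_zero]; simpa using h
  have hfy : ∑ i ∈ Finset.range (m + 1), C (gegenbauerEvenCoeff d m i) * (X * (1 + X)) ^ i =
      f.comp (X * (1 + X)) := by
    simp [hf, Polynomial.sum_comp, Polynomial.monomial_comp]
  rw [hfy]
  have hrec : ∀ i : ℕ, gegenbauerEvenCoeff d m (i + 1) * ((i + 1) * (i + ((d : ℝ) - 2) / 2)) =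
      gegenbauerEvenCoeff d m i *
        ((2 * m : ℝ) * (2 * m + d - 3) - 2 * i * (2 * i + d - 3)) := by
    intro i
    have h4 : (i : ℝ) + ((d : ℝ) - 2) / 2 ≠ 0 := by positivity
    have h5 : (i : ℝ) + 1 ≠ 0 := by positivity
    rw [gegenbauerEvenCoeff, div_mul_cancel₀ _ (mul_ne_zero h5 h4)]
  symm
  apply eq_gegenbauerPoly_of_ode hd
  · rw [coeff_zero_eq_eval_zero, eval_comp]
    simp [← coeff_zero_eq_eval_zero, hfc, gegenbauerEvenCoeff]
  obtain ⟨c, hcd⟩ : ∃ c : ℝ, (d : ℝ) = 2 * c + 2 := ⟨((d : ℝ) - 2) / 2, by ring⟩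
  have hcd' : (2 * c + 2 - 2) / 2 = c := by ring
  obtain ⟨N, hN⟩ : ∃ N : ℝ, N = (2 * m : ℝ) * (2 * m + (2 * c + 2) - 3) := ⟨_, rfl⟩
  simp only [hcd, hcd', ← hN] at hrec
  have hN' : ((2 * m : ℕ) : ℝ) * ((2 * m : ℕ) + (2 * c + 2) - 3) = N := by rw [hN]; push_cast; ring
  rw [hcd, hcd', hN']
  -- the quadratic transformation of the differential equation
  have hode : X * derivative (derivative f) + C 4 * (X * (X * derivative (derivative f))) +
      C (2 + 4 * c) * (X * derivative f) + C c * derivative f = C N * f := by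
    ext i
    have h := hrec i
    rcases i with _ | _ | i <;>
    · simp only [coeff_add, coeff_C_mul, coeff_X_mul, coeff_X_mul_zero, coeff_derivative, hfc]
      push_cast at h ⊢
      linarith
  have hode2 := congrArg (fun r => r.comp (X * (1 + X))) hode
  simp only [add_comp, mul_comp, C_comp, X_comp] at hode2
  have hy2 : derivative (1 + 2 * X : ℝ[X]) = 2 := by
    rw [show (2 : ℝ[X]) = C 2 from (map_ofNat C 2).symm]; simp
  have hy : derivative (X * (1 + X) : ℝ[X]) = 1 + 2 * X := by
    simp; ring
  rw [← hode2]
  simp only [derivative_comp, derivative_mul, hy, hy2]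
  simp only [map_add, map_mul, map_ofNat]
  ring

/-! ### Taylor coefficients of the dispersion kernel -/

section PowerSeries

open PowerSeries

/-- The power series of `1 / (1 + X)`. -/
noncomputable def altGeom : PowerSeries ℝ := rescale (-1) (mk 1)

lemma coeff_altGeom (n : ℕ) : coeff n altGeom = (-1) ^ n := by
  simp [altGeom, coeff_rescale]

lemma one_add_X_mul_altGeom : (1 + X) * altGeom = 1 := by
  have h : (mk 1 : PowerSeries ℝ) * (1 - X) = 1 := mk_one_mul_one_sub_eq_one ℝ
  have := congrArg (rescale (-1 : ℝ)) h
  simp only [map_mul, map_sub, map_one, rescale_X] at this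
  rwa [map_neg, map_one, neg_one_mul, sub_neg_eq_add, mul_comm] at this

lemma coeff_altGeom_pow (k n : ℕ) :
    coeff n (altGeom ^ (k + 1)) = (-1) ^ n * ((k + n).choose k : ℝ) := by
  rw [altGeom, ← map_pow, mk_one_pow_eq_mk_choose_add, coeff_rescale, coeff_mk]

/-- The power series in `v = u / x` of
`gegenbauer d j (1 + 2 * v) * (1 + (-1) ^ k * (1 + v) ^ (-k - 1))`, the contribution of a
spin-`j` state of squared mass `x` to the coefficient of `s ^ k` of the amplitude, up to the
factor `x ^ (-k - 1)`. -/
noncomputable def kernelSeries (d j k : ℕ) : PowerSeries ℝ :=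
  (gegenbauerPoly d j : PowerSeries ℝ) * (1 + (-1) ^ k * altGeom ^ (k + 1))

/-- The Taylor coefficients of the dispersion kernel. -/
noncomputable def kernelCoeff (d j k q : ℕ) : ℝ := coeff q (kernelSeries d j k)

lemma kernelCoeff_eq_add (d j k q : ℕ) : kernelCoeff d j k q = gegenbauerCoeff d j q +
    (-1) ^ k * coeff q ((gegenbauerPoly d j : PowerSeries ℝ) * altGeom ^ (k + 1)) := by
  have : (-1 : PowerSeries ℝ) ^ k = C ((-1) ^ k) := by simp
  rw [kernelCoeff, kernelSeries, mul_add, mul_one, map_add, Polynomial.coeff_coe,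
    coeff_gegenbauerPoly, this, mul_left_comm, coeff_C_mul]

lemma coeff_X_mul_one_add_X_pow_mul_altGeom_pow {i k q : ℕ} (hq : 2 * i < q) :
    coeff k ((((Polynomial.X * (1 + Polynomial.X)) ^ i : Polynomial ℝ) : PowerSeries ℝ) * altGeom ^ (q + 1)) =
      if i ≤ k then (-1) ^ (k - i) * ((q - i + (k - i)).choose (q - i) : ℝ) else 0 := by
  have h : (((Polynomial.X * (1 + Polynomial.X)) ^ i : Polynomial ℝ) : PowerSeries ℝ) *
      altGeom ^ (q + 1) = X ^ i * altGeom ^ (q - i + 1) := by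
    rw [show q + 1 = i + (q - i + 1) by omega, pow_add]
    push_cast
    rw [mul_pow, mul_assoc, ← mul_assoc ((1 + X) ^ i) (altGeom ^ i), ← mul_pow,
      one_add_X_mul_altGeom, one_pow, one_mul]
  rw [h, coeff_X_pow_mul', coeff_altGeom_pow]

lemma coeff_X_mul_one_add_X_pow_mul_altGeom_pow' {i k q : ℕ} (hq : 2 * i < q) :
    coeff q ((((Polynomial.X * (1 + Polynomial.X)) ^ i : Polynomial ℝ) : PowerSeries ℝ) * altGeom ^ (k + 1)) =
      if i ≤ k then (-1) ^ (q - i) * ((k - i + (q - i)).choose (k - i) : ℝ) else 0 := by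
  split_ifs with hik
  · have h : (((Polynomial.X * (1 + Polynomial.X)) ^ i : Polynomial ℝ) : PowerSeries ℝ) *
        altGeom ^ (k + 1) = X ^ i * altGeom ^ (k - i + 1) := by
      rw [show k + 1 = i + (k - i + 1) by omega, pow_add]
      push_cast
      rw [mul_pow, mul_assoc, ← mul_assoc ((1 + X) ^ i) (altGeom ^ i), ← mul_pow,
        one_add_X_mul_altGeom, one_pow, one_mul]
    rw [h, coeff_X_pow_mul', coeff_altGeom_pow, if_pos (by omega)]
  · have h : (((Polynomial.X * (1 + Polynomial.X)) ^ i : Polynomial ℝ) : PowerSeries ℝ) *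
        altGeom ^ (k + 1) =
        ((Polynomial.X ^ i * (1 + Polynomial.X) ^ (i - (k + 1)) : Polynomial ℝ) : PowerSeries ℝ) := by
      push_cast
      rw [mul_pow, show (1 + X : PowerSeries ℝ) ^ i = (1 + X) ^ (i - (k + 1)) * (1 + X) ^ (k + 1) by
        rw [← pow_add]; congr 1; omega, mul_assoc, mul_assoc, ← mul_pow, one_add_X_mul_altGeom,
        one_pow, mul_one]
    rw [h, Polynomial.coeff_coe]
    refine Polynomial.coeff_eq_zero_of_natDegree_lt ?_
    calc _ ≤ i + (i - (k + 1)) := by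
          refine Polynomial.natDegree_mul_le.trans ?_
          refine add_le_add (Polynomial.natDegree_X_pow_le i) ?_
          refine Polynomial.natDegree_pow_le.trans ?_
          refine (Nat.mul_le_mul_left _ ?_).trans_eq (mul_one _)
          refine (Polynomial.natDegree_add_le _ _).trans ?_
          simp
      _ < q := by omega

/-- Crossing symmetry of the exchange of a single even-spin state: the `t`-channel pole contributes
equally to the coefficients of `s ^ q * u ^ k` and of `s ^ k * u ^ q`. What is left is the `s`-channel
pole, as `q` exceeds the spin. -/
lemma kernelCoeff_sub_kernelCoeff {d : ℕ} (hd : 3 ≤ d) {j k q : ℕ} (hj : Even j) (hk : Even k)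
    (hq : j < q) : kernelCoeff d j q k - kernelCoeff d j k q = gegenbauerCoeff d j k := by
  rw [kernelCoeff_eq_add, kernelCoeff_eq_add, gegenbauerCoeff_eq_zero hq, hk.neg_one_pow]
  obtain ⟨m, rfl⟩ := hj
  rw [← two_mul] at hq ⊢
  have key : (-1) ^ q * coeff k ((gegenbauerPoly d (2 * m) : PowerSeries ℝ) * altGeom ^ (q + 1)) =
      coeff q ((gegenbauerPoly d (2 * m) : PowerSeries ℝ) * altGeom ^ (k + 1)) := by
    rw [gegenbauerPoly_even hd, ← Polynomial.coeToPowerSeries.ringHom_apply, map_sum, Finset.sum_mul,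
      Finset.sum_mul, map_sum, map_sum, Finset.mul_sum]
    refine Finset.sum_congr rfl fun i hi => ?_
    have hi' : 2 * i < q := by have := Finset.mem_range.1 hi; omega
    rw [Polynomial.coeToPowerSeries.ringHom_apply, Polynomial.coe_mul, Polynomial.coe_C, mul_assoc, mul_assoc,
      coeff_C_mul, coeff_C_mul, mul_left_comm]
    congr 1
    rw [coeff_X_mul_one_add_X_pow_mul_altGeom_pow hi',
      coeff_X_mul_one_add_X_pow_mul_altGeom_pow' hi']
    split_ifs with h
    · have h1 : (q - i + (k - i)).choose (q - i) = (k - i + (q - i)).choose (k - i) := by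
        rw [add_comm, Nat.choose_symm_add]
      rw [h1, ← mul_assoc, ← pow_add]
      congr 1
      apply neg_one_pow_congr
      grind
    · simp
  rw [key]
  ring

end PowerSeries

/-- `f` converges absolutely at `v`, with sum `y`. -/
def SumsTo (f : PowerSeries ℝ) (v y : ℝ) : Prop :=
  Summable (fun n => ‖PowerSeries.coeff n f * v ^ n‖) ∧
    HasSum (fun n => PowerSeries.coeff n f * v ^ n) y

lemma SumsTo.mul {f g : PowerSeries ℝ} {v y z : ℝ} (hf : SumsTo f v y) (hg : SumsTo g v z) :
    SumsTo (f * g) v (y * z) := by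
  have h : ∀ n, PowerSeries.coeff n (f * g) * v ^ n = ∑ p ∈ Finset.HasAntidiagonal.antidiagonal n,
      (PowerSeries.coeff p.1 f * v ^ p.1) * (PowerSeries.coeff p.2 g * v ^ p.2) := by
    intro n
    rw [PowerSeries.coeff_mul, Finset.sum_mul]
    refine Finset.sum_congr rfl fun p hp => ?_
    rw [← Finset.HasAntidiagonal.mem_antidiagonal.1 hp, pow_add]
    ring
  simp only [SumsTo, h]
  have h1 := summable_norm_sum_mul_antidiagonal_of_summable_norm hf.1 hg.1
  refine ⟨h1, ?_⟩
  have h2 := tsum_mul_tsum_eq_tsum_sum_antidiagonal_of_summable_norm hf.1 hg.1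
  rw [hf.2.tsum_eq, hg.2.tsum_eq] at h2
  rw [h2]
  exact h1.of_norm.hasSum

lemma SumsTo.add {f g : PowerSeries ℝ} {v y z : ℝ} (hf : SumsTo f v y) (hg : SumsTo g v z) :
    SumsTo (f + g) v (y + z) := by
  simp only [SumsTo, map_add, add_mul]
  exact ⟨(hf.1.add hg.1).of_nonneg_of_le (fun _ => norm_nonneg _) fun _ => norm_add_le _ _,
    hf.2.add hg.2⟩

lemma sumsTo_polynomial (p : Polynomial ℝ) (v : ℝ) : SumsTo (p : PowerSeries ℝ) v (p.eval v) := by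
  simp only [SumsTo, Polynomial.coeff_coe]
  have h0 : ∀ n ∉ p.support, p.coeff n * v ^ n = 0 := by
    intro n hn
    rw [Polynomial.notMem_support_iff.1 hn, zero_mul]
  refine ⟨summable_of_ne_finset_zero (s := p.support) fun n hn => by rw [h0 n hn, norm_zero], ?_⟩
  rw [Polynomial.eval_eq_sum, Polynomial.sum]
  exact hasSum_sum_of_ne_finset_zero h0

lemma SumsTo.pow {f : PowerSeries ℝ} {v y : ℝ} (hf : SumsTo f v y) (n : ℕ) :
    SumsTo (f ^ n) v (y ^ n) := by
  induction n with
  | zero =>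
    have := sumsTo_polynomial 1 v
    rw [Polynomial.coe_one, Polynomial.eval_one] at this
    rw [pow_zero, pow_zero]
    exact this
  | succ n ih => rw [pow_succ, pow_succ]; exact ih.mul hf

lemma SumsTo.rescale {f : PowerSeries ℝ} {a v y : ℝ} (hf : SumsTo f (a * v) y) :
    SumsTo (PowerSeries.rescale a f) v y := by
  have : ∀ n, PowerSeries.coeff n (PowerSeries.rescale a f) * v ^ n =
      PowerSeries.coeff n f * (a * v) ^ n := by
    intro n
    rw [PowerSeries.coeff_rescale, mul_pow]; ring
  simpa only [SumsTo, this] using hf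

lemma sumsTo_geom {v : ℝ} (hv : |v| < 1) : SumsTo (PowerSeries.mk 1) v (1 - v)⁻¹ := by
  simp only [SumsTo, PowerSeries.coeff_mk, Pi.one_apply, one_mul, norm_pow, Real.norm_eq_abs]
  exact ⟨summable_geometric_of_lt_one (abs_nonneg v) hv, hasSum_geometric_of_abs_lt_one hv⟩

lemma sumsTo_altGeom {v : ℝ} (hv : |v| < 1) : SumsTo altGeom v (1 + v)⁻¹ := by
  refine SumsTo.rescale ?_
  have := sumsTo_geom (v := -1 * v) (by simpa using hv)
  simpa using this

lemma sumsTo_kernelSeries {d : ℕ} (hd : 3 ≤ d) (j k : ℕ) {v : ℝ} (hv : |v| < 1) :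
    SumsTo (kernelSeries d j k) v
      (gegenbauer d j (1 + 2 * v) * (1 + (-1) ^ k * ((1 + v) ^ (k + 1))⁻¹)) := by
  rw [gegenbauer_eq_eval hd, kernelSeries]
  refine (sumsTo_polynomial _ v).mul ?_
  have h1 := sumsTo_polynomial 1 v
  have h2 := sumsTo_polynomial (Polynomial.C ((-1) ^ k)) v
  have h3 := (sumsTo_altGeom hv).pow (k + 1)
  have := h1.add (h2.mul h3)
  rw [inv_pow] at this
  simpa using this

lemma abs_kernelCoeff_le {d : ℕ} (hd : 3 ≤ d) (j q k : ℕ) :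
    |kernelCoeff d j q k| ≤
      2 * (q + k + 1) ^ k * ∑ i ∈ Finset.range (k + 1), gegenbauerCoeff d j i := by
  have hV := gegenbauerCoeff_nonneg hd j
  set S := ∑ i ∈ Finset.range (k + 1), gegenbauerCoeff d j i
  have hS : gegenbauerCoeff d j k ≤ S :=
    Finset.single_le_sum (fun i _ => hV i) (Finset.self_mem_range_succ k)
  have hS0 : 0 ≤ S := (hV k).trans hS
  have h1 : (1 : ℝ) ≤ ((q : ℝ) + k + 1) ^ k := one_le_pow₀ (by linarith [q.cast_nonneg (α := ℝ), k.cast_nonneg (α := ℝ)])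
  rw [kernelCoeff_eq_add]
  have h2 : |PowerSeries.coeff k ((gegenbauerPoly d j : PowerSeries ℝ) * altGeom ^ (q + 1))| ≤
      ((q : ℝ) + k + 1) ^ k * S := by
    rw [PowerSeries.coeff_mul,
      Finset.Nat.sum_antidiagonal_eq_sum_range_succ (fun a b => PowerSeries.coeff a
        (gegenbauerPoly d j : PowerSeries ℝ) * PowerSeries.coeff b (altGeom ^ (q + 1))), Finset.mul_sum]
    refine (Finset.abs_sum_le_sum_abs _ _).trans (Finset.sum_le_sum fun i hi => ?_)
    rw [Polynomial.coeff_coe, coeff_gegenbauerPoly, coeff_altGeom_pow, abs_mul, abs_mul,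
      abs_of_nonneg (hV i), abs_pow, abs_neg, abs_one, one_pow, one_mul, mul_comm, Nat.abs_cast]
    refine mul_le_mul_of_nonneg_right ?_ (hV i)
    have h3 : (q + (k - i)).choose q ≤ (q + k + 1) ^ k := by
      rw [Nat.choose_symm_add]
      refine (Nat.choose_le_pow _ _).trans ?_
      calc (q + (k - i)) ^ (k - i) ≤ (q + k + 1) ^ (k - i) := Nat.pow_le_pow_left (by omega) _
        _ ≤ (q + k + 1) ^ k := Nat.pow_le_pow_right (by omega) (by omega)
    exact_mod_cast h3
  calc _ ≤ |gegenbauerCoeff d j k| + |(-1) ^ q * PowerSeries.coeff k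
        ((gegenbauerPoly d j : PowerSeries ℝ) * altGeom ^ (q + 1))| := abs_add_le _ _
    _ ≤ ((q : ℝ) + k + 1) ^ k * S + ((q : ℝ) + k + 1) ^ k * S := by
        rw [abs_mul, abs_pow, abs_neg, abs_one, one_pow, one_mul, abs_of_nonneg (hV k)]
        refine add_le_add (hS.trans ?_) h2
        exact le_mul_of_one_le_left hS0 h1
    _ = _ := by ring

/-- The Taylor coefficients in `u / R` of the dispersion kernel at `R / x = y`, after multiplication
by `(1 - u / R) ^ (-k - 1)`. -/
noncomputable def improvedCoeff (d j k : ℕ) (y : ℝ) (n : ℕ) : ℝ :=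
  PowerSeries.coeff n (PowerSeries.rescale y (kernelSeries d j k) * PowerSeries.mk 1 ^ (k + 1))

lemma improvedCoeff_eq_sum (d j k : ℕ) (y : ℝ) (n : ℕ) : improvedCoeff d j k y n =
    ∑ i ∈ Finset.range (n + 1), (k + (n - i)).choose k * (kernelCoeff d j k i * y ^ i) := by
  rw [improvedCoeff, PowerSeries.coeff_mul, Finset.Nat.sum_antidiagonal_eq_sum_range_succ
    (fun a b => PowerSeries.coeff a (PowerSeries.rescale y (kernelSeries d j k)) *
      PowerSeries.coeff b (PowerSeries.mk (1 : ℕ → ℝ) ^ (k + 1)))]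
  refine Finset.sum_congr rfl fun i _ => ?_
  rw [PowerSeries.coeff_rescale, PowerSeries.mk_one_pow_eq_mk_choose_add, PowerSeries.coeff_mk,
    kernelCoeff]
  ring

lemma coeff_mul_nonneg {f g : PowerSeries ℝ} (hf : ∀ n, 0 ≤ PowerSeries.coeff n f)
    (hg : ∀ n, 0 ≤ PowerSeries.coeff n g) (n : ℕ) : 0 ≤ PowerSeries.coeff n (f * g) := by
  rw [PowerSeries.coeff_mul]
  exact Finset.sum_nonneg fun p _ => mul_nonneg (hf _) (hg _)

lemma coeff_pow_nonneg {f : PowerSeries ℝ} (hf : ∀ n, 0 ≤ PowerSeries.coeff n f) (m n : ℕ) :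
    0 ≤ PowerSeries.coeff n (f ^ m) := by
  induction m generalizing n with
  | zero => rw [pow_zero, PowerSeries.coeff_one]; split_ifs <;> norm_num
  | succ m ih => rw [pow_succ]; exact coeff_mul_nonneg ih hf n

/-- For `x ≥ R` the factor `(1 - u / R) ^ (-k - 1)` renders all Taylor coefficients of the dispersion
kernel nonnegative, because `(1 - z)⁻¹ * (1 + y * z)⁻¹` has nonnegative coefficients. -/
lemma improvedCoeff_nonneg {d : ℕ} (hd : 3 ≤ d) (j : ℕ) {k : ℕ} (hk : Even k) {y : ℝ} (hy0 : 0 ≤ y)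
    (hy1 : y ≤ 1) (n : ℕ) : 0 ≤ improvedCoeff d j k y n := by
  have h : PowerSeries.rescale y (kernelSeries d j k) * PowerSeries.mk 1 ^ (k + 1) =
      PowerSeries.rescale y (gegenbauerPoly d j : PowerSeries ℝ) * (PowerSeries.mk 1 ^ (k + 1) +
        (PowerSeries.rescale y altGeom * PowerSeries.mk 1) ^ (k + 1)) := by
    rw [kernelSeries, hk.neg_one_pow, map_mul, map_add, map_one, one_mul, map_pow, mul_pow]
    ring
  rw [improvedCoeff, h]
  refine coeff_mul_nonneg (fun i => ?_) (fun i => ?_) n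
  · rw [PowerSeries.coeff_rescale, Polynomial.coeff_coe, coeff_gegenbauerPoly]
    exact mul_nonneg (pow_nonneg hy0 _) (gegenbauerCoeff_nonneg hd _ _)
  · rw [map_add]
    refine add_nonneg (coeff_pow_nonneg (fun m => by simp) _ _) (coeff_pow_nonneg (fun m => ?_) _ _)
    rw [PowerSeries.coeff_mul, Finset.Nat.sum_antidiagonal_eq_sum_range_succ
      (fun a b => PowerSeries.coeff a (PowerSeries.rescale y altGeom) *
        PowerSeries.coeff b (PowerSeries.mk (1 : ℕ → ℝ)))]
    simp only [PowerSeries.coeff_rescale, coeff_altGeom, PowerSeries.coeff_mk, Pi.one_apply,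
      mul_one]
    have : ∀ a ∈ Finset.range m.succ, y ^ a * (-1) ^ a = (-y) ^ a := fun a _ => by
      rw [← mul_pow]; congr 1; ring
    rw [Finset.sum_congr rfl this, geom_sum_eq (by linarith)]
    refine div_nonneg_of_nonpos ?_ (by linarith)
    have h2 : |(-y) ^ m.succ| ≤ 1 := by
      rw [abs_pow, abs_neg]; exact pow_le_one₀ (abs_nonneg _) (by rwa [abs_of_nonneg hy0])
    linarith [(abs_le.1 h2).2]

lemma hasSum_improvedCoeff {d : ℕ} (hd : 3 ≤ d) (j k : ℕ) {y z : ℝ} (hy0 : 0 ≤ y)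
    (hy1 : y ≤ 1) (hz : |z| < 1) : HasSum (fun n => improvedCoeff d j k y n * z ^ n)
      (gegenbauer d j (1 + 2 * (y * z)) * (1 + (-1) ^ k * ((1 + y * z) ^ (k + 1))⁻¹) *
        ((1 - z)⁻¹) ^ (k + 1)) := by
  have hyz : |y * z| < 1 := by
    rw [abs_mul, abs_of_nonneg hy0]
    exact (mul_le_of_le_one_left (abs_nonneg _) hy1).trans_lt hz
  exact ((sumsTo_kernelSeries hd j k hyz).rescale.mul ((sumsTo_geom hz).pow (k + 1))).2

/-! ### Power series to the left of the origin -/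

/-- A power series is approximated by its partial sums to the expected order. -/
lemma exists_abs_sub_partialSum_le {δ : ℝ} (hδ : 0 < δ) {y : ℕ → ℝ} {Y : ℝ → ℝ}
    (h : ∀ u, -δ < u → u < 0 → HasSum (fun n => y n * u ^ n) (Y u)) (p : ℕ) :
    ∃ C, ∀ u, -(δ / 4) ≤ u → u < 0 →
      |Y u - ∑ n ∈ Finset.range p, y n * u ^ n| ≤ C * |u| ^ p := by
  have h1 := (h (-(δ / 2)) (by linarith) (by linarith)).summable.tendsto_atTop_zero
  obtain ⟨B, hB⟩ := h1.norm.bddAbove_range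
  have hB' : ∀ n, |y n| * (δ / 2) ^ n ≤ B := by
    intro n
    have := hB ⟨n, rfl⟩
    simpa [abs_mul, abs_pow, abs_of_pos hδ] using this
  have hρ : 0 < δ / 2 := by positivity
  refine ⟨B * ((δ / 2) ^ p)⁻¹ * 2, fun u hu hu0 => ?_⟩
  have h2 := h u (by linarith) hu0
  have h3 := (hasSum_nat_add_iff' p).2 h2
  rw [← h3.tsum_eq]
  have hu1 : |u| / (δ / 2) ≤ 1 / 2 := by
    rw [abs_of_neg hu0, div_le_iff₀ hρ]; linarith
  have hg : HasSum (fun n : ℕ => B * (|u| / (δ / 2)) ^ p * (1 / 2 : ℝ) ^ n)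
      (B * (|u| / (δ / 2)) ^ p * 2) := hasSum_geometric_two.mul_left _
  have hB0 : 0 ≤ B := le_trans (by positivity) (hB' 0)
  have hle : ∀ n, ‖y (n + p) * u ^ (n + p)‖ ≤ B * (|u| / (δ / 2)) ^ p * (1 / 2 : ℝ) ^ n := by
    intro n
    rw [norm_mul, norm_pow, Real.norm_eq_abs, Real.norm_eq_abs]
    have : |y (n + p)| ≤ B * ((δ / 2) ^ (n + p))⁻¹ := by
      rw [← div_eq_mul_inv, le_div_iff₀ (by positivity)]; exact hB' _
    have gen : ∀ ρ a : ℝ, B * (ρ ^ (n + p))⁻¹ * a ^ (n + p) = B * (a / ρ) ^ p * (a / ρ) ^ n := by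
      intro ρ a
      rw [div_pow, div_pow]; ring
    calc |y (n + p)| * |u| ^ (n + p) ≤ B * ((δ / 2) ^ (n + p))⁻¹ * |u| ^ (n + p) := by gcongr
      _ = B * (|u| / (δ / 2)) ^ p * (|u| / (δ / 2)) ^ n :=
        gen _ _
      _ ≤ _ := by gcongr
  refine (tsum_of_norm_bounded hg hle).trans_eq ?_
  rw [div_pow]; ring

/-- A power series that vanishes to order higher than `p` at the origin, approached from the left,
has vanishing coefficients up to order `p`. -/
lemma coeff_eq_zero_of_tendsto {δ : ℝ} (hδ : 0 < δ) {y : ℕ → ℝ} {Y : ℝ → ℝ}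
    (h : ∀ u, -δ < u → u < 0 → HasSum (fun n => y n * u ^ n) (Y u)) {p : ℕ}
    (hp : Tendsto (fun u => Y u / u ^ p) (𝓝[<] 0) (𝓝 0)) : ∀ n ≤ p, y n = 0 := by
  intro n
  induction n using Nat.strong_induction_on with
  | _ n ih =>
    intro hn
    obtain ⟨C, hC⟩ := exists_abs_sub_partialSum_le hδ h (n + 1)
    have hev : ∀ᶠ u in 𝓝[<] (0 : ℝ), -(δ / 4) ≤ u ∧ u < 0 := by
      have h1 : ∀ᶠ u in 𝓝[<] (0 : ℝ), u ∈ Set.Ici (-(δ / 4)) :=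
        mem_nhdsWithin_of_mem_nhds (Ici_mem_nhds (by linarith))
      filter_upwards [h1, self_mem_nhdsWithin] with u h1 h2 using ⟨h1, h2⟩
    have hid : Tendsto (fun u : ℝ => u) (𝓝[<] 0) (𝓝 0) := tendsto_nhdsWithin_of_tendsto_nhds tendsto_id
    have t1 : Tendsto (fun u => (Y u / u ^ p) * u ^ (p - n)) (𝓝[<] 0) (𝓝 (0 * 0 ^ (p - n))) :=
      hp.mul (hid.pow _)
    rw [zero_mul] at t1
    have t2 : Tendsto (fun u : ℝ => C * |u|) (𝓝[<] 0) (𝓝 (C * |0|)) := (hid.abs).const_mul C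
    rw [abs_zero, mul_zero] at t2
    have t3 : Tendsto (fun u => (Y u / u ^ p) * u ^ (p - n) - y n) (𝓝[<] 0) (𝓝 0) := by
      refine squeeze_zero_norm' ?_ t2
      filter_upwards [hev] with u hu
      have h4 := hC u hu.1 hu.2
      have hu0 : u ≠ 0 := hu.2.ne
      rw [Finset.sum_range_succ, Finset.sum_eq_zero, zero_add] at h4
      · have e : (Y u / u ^ p) * u ^ (p - n) - y n = (Y u - y n * u ^ n) / u ^ n := by
          rw [← Nat.sub_add_cancel hn, pow_add]
          simp only [Nat.add_sub_cancel]
          field_simp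
        rw [e, Real.norm_eq_abs, abs_div, abs_pow, div_le_iff₀ (by positivity), mul_assoc, ← pow_succ']
        exact h4
      · intro i hi
        rw [ih i (Finset.mem_range.1 hi) (by have := Finset.mem_range.1 hi; omega), zero_mul]
    have := tendsto_nhds_unique (t1.sub_const (y n)) t3
    linarith

lemma integrable_of_tendsto_of_integral_le {Ω : Type*} [MeasurableSpace Ω] {μ : Measure Ω}
    {G : ℕ → Ω → ℝ} {f : Ω → ℝ} {C : ℝ}
    (hGf : ∀ᵐ ω ∂μ, Tendsto (fun n => G n ω) atTop (𝓝 (f ω))) (hG : ∀ n, Integrable (G n) μ)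
    (hC : ∀ n, ∫ ω, ‖G n ω‖ ∂μ ≤ C) : Integrable f μ := by
  refine ⟨aestronglyMeasurable_of_tendsto_ae _ (fun n => (hG n).1) hGf, ?_⟩
  have hle : ∫⁻ ω, ‖f ω‖ₑ ∂μ ≤ liminf (fun n => ∫⁻ ω, ‖G n ω‖ₑ ∂μ) atTop := by
    rw [lintegral_congr_ae (g := fun ω => liminf (fun n => ‖G n ω‖ₑ) atTop)
      (by filter_upwards [hGf] with ω hω using hω.enorm.liminf_eq.symm)]
    exact lintegral_liminf_le' fun n => (hG n).1.aemeasurable.enorm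
  refine lt_of_le_of_lt hle ?_
  refine lt_of_le_of_lt (?_ : _ ≤ ENNReal.ofReal C) ENNReal.ofReal_lt_top
  refine liminf_le_of_le (by isBoundedDefault) fun b hb => ?_
  obtain ⟨n, hn⟩ := hb.exists
  refine hn.trans ?_
  rw [← ofReal_integral_norm_eq_lintegral_enorm (hG n)]
  exact ENNReal.ofReal_le_ofReal (hC n)

/-! ### Moments of the spectral measure -/

/-- The factor `1 + (-1) ^ k * (1 + v) ^ (-k - 1)` that combines the `s`- and `t`-channel poles. -/
noncomputable def channelFactor (k : ℕ) (v : ℝ) : ℝ := 1 + (-1) ^ k * ((1 + v) ^ (k + 1))⁻¹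

/-- The contribution to the coefficient of `s ^ k` of the amplitude of a state `ω`, made up of its
spin `ω.1` and its squared mass `ω.2`. -/
noncomputable def dispersionKernel (d k : ℕ) (u : ℝ) (ω : ℕ × ℝ) : ℝ :=
  gegenbauer d ω.1 (1 + 2 * u / ω.2) * ((ω.2 ^ (k + 1))⁻¹ + (-1) ^ k * ((ω.2 + u) ^ (k + 1))⁻¹)

/-- The positive measure `μ` on spins and squared masses obeys the sum rules for the coefficients
`c k q` of `s ^ k * u ^ q` in the low-energy expansion, for `k` at least the even number `K`. All
squared masses are at least `m`. -/
structure SumRules (d K : ℕ) (m δ : ℝ) (c : ℕ → ℕ → ℝ) (μ : Measure (ℕ × ℝ)) : Prop where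
  three_le : 3 ≤ d
  even : Even K
  m_pos : 0 < m
  δ_pos : 0 < δ
  ae_le : ∀ᵐ ω ∂μ, m ≤ ω.2
  ae_even : ∀ᵐ ω ∂μ, Even ω.1
  integrable : Integrable (fun ω => (ω.2 ^ (K + 1))⁻¹) μ
  hasSum : ∀ k, K ≤ k → ∀ u, -δ < u → u < 0 →
    HasSum (fun q => c k q * u ^ q) (∫ ω, dispersionKernel d k u ω ∂μ)

lemma abs_channelFactor_le (k : ℕ) {v : ℝ} (hv : -(1 / 2) ≤ v) :
    |channelFactor k v| ≤ 1 + 2 ^ (k + 1) := by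
  have h1 : ((1 + v) ^ (k + 1))⁻¹ ≤ 2 ^ (k + 1) := by
    rw [← inv_pow]
    have : (1 + v)⁻¹ ≤ 2 := by
      rw [inv_le_comm₀ (by linarith) (by norm_num)]; linarith
    exact pow_le_pow_left₀ (inv_nonneg.2 (by linarith)) this _
  have h0 : 0 ≤ ((1 + v) ^ (k + 1))⁻¹ := inv_nonneg.2 (pow_nonneg (by linarith) _)
  refine (abs_add_le _ _).trans ?_
  rw [abs_one, abs_mul, abs_pow, abs_neg, abs_one, one_pow, one_mul, abs_of_nonneg h0]
  linarith

lemma dispersionKernel_eq {d : ℕ} (k : ℕ) {u : ℝ} {ω : ℕ × ℝ} (hω : 0 < ω.2) :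
    dispersionKernel d k u ω =
      (ω.2 ^ (k + 1))⁻¹ * (gegenbauer d ω.1 (1 + 2 * (u / ω.2)) * channelFactor k (u / ω.2)) := by
  have : ω.2 + u = ω.2 * (1 + u / ω.2) := by field_simp
  rw [dispersionKernel, channelFactor, this, mul_pow, mul_inv, mul_div_assoc]
  ring

lemma measurable_prod_nat {f : ℕ → ℝ → ℝ} (hf : ∀ j, Measurable (f j)) :
    Measurable (fun ω : ℕ × ℝ => f ω.1 ω.2) :=
  measurable_from_prod_countable_right (f := fun ω : ℕ × ℝ => f ω.1 ω.2) hf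

lemma measurable_gegenbauer {d : ℕ} (hd : 3 ≤ d) (j : ℕ) : Measurable (gegenbauer d j) := by
  have : gegenbauer d j = fun x => (gegenbauerPoly d j).eval ((x - 1) / 2) := by
    funext x
    rw [← gegenbauer_eq_eval hd]; congr 1; ring
  rw [this]
  exact (((gegenbauerPoly d j).continuous).comp (by fun_prop)).measurable

lemma measurable_channelFactor (k : ℕ) : Measurable (channelFactor k) := by
  unfold channelFactor; fun_prop

/-- The integrand of the moments of the spectral measure. -/
noncomputable def momentKernel (d k i : ℕ) (ω : ℕ × ℝ) : ℝ :=
  gegenbauerCoeff d ω.1 i * (ω.2 ^ (k + 1 + i))⁻¹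

lemma measurable_momentKernel (d k i : ℕ) : Measurable (momentKernel d k i) :=
  measurable_prod_nat (f := fun j x => gegenbauerCoeff d j i * (x ^ (k + 1 + i))⁻¹)
    fun j => by fun_prop

lemma neg_half_le_div {m u x : ℝ} (hm : 0 < m) (hu : |u| ≤ m / 2) (hx : m ≤ x) :
    |u / x| ≤ 1 / 2 := by
  rw [abs_div, abs_of_pos (hm.trans_le hx), div_le_iff₀ (hm.trans_le hx)]
  linarith

namespace SumRules

variable {d K : ℕ} {m δ : ℝ} {c : ℕ → ℕ → ℝ} {μ : Measure (ℕ × ℝ)}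

/-- Raising the power of the squared mass preserves integrability. -/
lemma integrable_mul_inv_pow (H : SumRules d K m δ c μ) {f : ℕ × ℝ → ℝ} (hf : Measurable f) {a b : ℕ}
    (hab : a ≤ b) (h : Integrable (fun ω => f ω * (ω.2 ^ a)⁻¹) μ) :
    Integrable (fun ω => f ω * (ω.2 ^ b)⁻¹) μ := by
  refine (h.norm.mul_const ((m ^ (b - a))⁻¹)).mono' (by fun_prop) ?_
  filter_upwards [H.ae_le] with ω hω
  have hx := H.m_pos.trans_le hω
  have hm := H.m_pos
  rw [← Nat.add_sub_cancel' hab, pow_add, mul_inv, ← mul_assoc, norm_mul]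
  refine mul_le_mul_of_nonneg_left ?_ (norm_nonneg _)
  rw [Real.norm_of_nonneg (by positivity), Nat.add_sub_cancel_left]
  gcongr

lemma integrable_momentKernel_of_le (H : SumRules d K m δ c μ) {k k' i : ℕ} (hk : k ≤ k')
    (h : Integrable (momentKernel d k i) μ) : Integrable (momentKernel d k' i) μ :=
  H.integrable_mul_inv_pow (f := fun ω => gegenbauerCoeff d ω.1 i)
    (measurable_prod_nat (f := fun j _ => gegenbauerCoeff d j i) fun _ => measurable_const)
    (by omega) h

lemma integrable_mul_channelFactor (H : SumRules d K m δ c μ) {f : ℕ × ℝ → ℝ} (hf : Measurable f)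
    (h : Integrable f μ) {u : ℝ} (hu : |u| ≤ m / 2) (k : ℕ) :
    Integrable (fun ω => f ω * channelFactor k (u / ω.2)) μ := by
  have := measurable_channelFactor k
  refine (h.norm.mul_const (1 + 2 ^ (k + 1))).mono' (by fun_prop) ?_
  filter_upwards [H.ae_le] with ω hω
  rw [norm_mul]
  exact mul_le_mul_of_nonneg_left (abs_channelFactor_le k
    (abs_le.1 (neg_half_le_div H.m_pos hu hω)).1) (norm_nonneg _)

lemma integrable_dispersionKernel (H : SumRules d K m δ c μ) {k : ℕ} (hk : K ≤ k) {u : ℝ}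
    (hu : |u| ≤ m / 2) (hu0 : u ≤ 0) : Integrable (dispersionKernel d k u) μ := by
  have hmeas : Measurable (fun ω : ℕ × ℝ =>
      (ω.2 ^ (k + 1))⁻¹ * gegenbauer d ω.1 (1 + 2 * (u / ω.2))) :=
    measurable_prod_nat (f := fun j x => (x ^ (k + 1))⁻¹ * gegenbauer d j (1 + 2 * (u / x)))
      fun j => by have := measurable_gegenbauer H.three_le j; fun_prop
  have h1 : Integrable (fun ω : ℕ × ℝ => (ω.2 ^ (k + 1))⁻¹) μ := by
    have := H.integrable_mul_inv_pow (f := fun _ => 1) measurable_const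
      (Nat.add_le_add_right hk 1) (by simpa using H.integrable)
    simpa using this
  have h2 : Integrable (fun ω : ℕ × ℝ =>
      (ω.2 ^ (k + 1))⁻¹ * gegenbauer d ω.1 (1 + 2 * (u / ω.2))) μ := by
    refine h1.norm.mono' hmeas.aestronglyMeasurable ?_
    filter_upwards [H.ae_le] with ω hω
    rw [norm_mul, gegenbauer_eq_eval H.three_le]
    have hx := H.m_pos.trans_le hω
    refine mul_le_of_le_one_right (norm_nonneg _) (abs_eval_gegenbauerPoly_le_one H.three_le _ ?_ ?_)
    · exact (abs_le.1 (neg_half_le_div H.m_pos hu hω)).1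
    · exact div_nonpos_of_nonpos_of_nonneg hu0 hx.le
  refine (H.integrable_mul_channelFactor hmeas h2 hu k).congr ?_
  filter_upwards [H.ae_le] with ω hω
  rw [dispersionKernel_eq k (H.m_pos.trans_le hω), mul_assoc]

/-- The Taylor coefficients of `channelFactor k`. -/
noncomputable def _root_.StuBootstrap.channelCoeff (k l : ℕ) : ℝ :=
  PowerSeries.coeff l (1 + (-1) ^ k * altGeom ^ (k + 1))

lemma _root_.StuBootstrap.sumsTo_channelFactor (k : ℕ) {v : ℝ} (hv : |v| < 1) :
    SumsTo (1 + (-1) ^ k * altGeom ^ (k + 1)) v (channelFactor k v) := by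
  have h1 := sumsTo_polynomial 1 v
  have h2 := sumsTo_polynomial (Polynomial.C ((-1) ^ k)) v
  have := h1.add (h2.mul ((sumsTo_altGeom hv).pow (k + 1)))
  rw [inv_pow] at this
  simpa [channelFactor] using this

lemma _root_.StuBootstrap.kernelCoeff_eq_sum (d j k q : ℕ) : kernelCoeff d j k q =
    ∑ i ∈ Finset.range (q + 1), gegenbauerCoeff d j i * channelCoeff k (q - i) := by
  rw [kernelCoeff, kernelSeries, PowerSeries.coeff_mul,
    Finset.Nat.sum_antidiagonal_eq_sum_range_succ (fun a b => PowerSeries.coeff a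
      (gegenbauerPoly d j : PowerSeries ℝ) *
        PowerSeries.coeff b (1 + (-1) ^ k * altGeom ^ (k + 1)))]
  simp [channelCoeff, coeff_gegenbauerPoly]

/-- Expansion in `u` of the dispersion kernel with a fixed order of the Gegenbauer polynomial. -/
lemma hasSum_integral_momentKernel (H : SumRules d K m δ c μ) {k i : ℕ}
    (h : Integrable (momentKernel d k i) μ) {u : ℝ} (hu : |u| ≤ m / 2) :
    HasSum (fun l => channelCoeff k l * (∫ ω, momentKernel d (k + l) i ω ∂μ) * u ^ l)
      (∫ ω, momentKernel d k i ω * channelFactor k (u / ω.2) ∂μ) := by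
  have hint : ∀ l, Integrable (momentKernel d (k + l) i) μ :=
    fun l => H.integrable_momentKernel_of_le (by omega) h
  have heq : ∀ l, ∀ᵐ ω ∂μ, channelCoeff k l * momentKernel d (k + l) i ω * u ^ l =
      momentKernel d k i ω * (channelCoeff k l * (u / ω.2) ^ l) := by
    intro l
    filter_upwards [H.ae_le] with ω hω
    have hx := H.m_pos.trans_le hω
    rw [momentKernel, momentKernel, show k + l + 1 + i = (k + 1 + i) + l by ring, pow_add, mul_inv,
      div_pow]
    ring
  have h1 := hasSum_integral_of_summable_integral_norm (μ := μ)
    (F := fun l ω => channelCoeff k l * momentKernel d (k + l) i ω * u ^ l)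
    (fun l => ((hint l).const_mul _).mul_const _) ?_
  · have e1 : ∀ l, ∫ ω, channelCoeff k l * momentKernel d (k + l) i ω * u ^ l ∂μ =
        channelCoeff k l * (∫ ω, momentKernel d (k + l) i ω ∂μ) * u ^ l := by
      intro l
      rw [integral_mul_const, integral_const_mul]
    simp only [e1] at h1
    have e2 : ∫ ω, momentKernel d k i ω * channelFactor k (u / ω.2) ∂μ =
        ∫ ω, ∑' l, channelCoeff k l * momentKernel d (k + l) i ω * u ^ l ∂μ := by
      refine integral_congr_ae ?_
      filter_upwards [ae_all_iff.2 heq, H.ae_le] with ω hω hω'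
      simp only [hω]
      rw [tsum_mul_left]
      congr 1
      exact (sumsTo_channelFactor k ((neg_half_le_div H.m_pos hu hω').trans_lt
        (by norm_num))).2.tsum_eq.symm
    rwa [e2]
  · refine Summable.of_nonneg_of_le (fun l => integral_nonneg fun _ => norm_nonneg _) (fun l => ?_)
      (((sumsTo_channelFactor k (v := 1 / 2) (by norm_num [abs_of_pos])).1).mul_left
        (∫ ω, ‖momentKernel d k i ω‖ ∂μ))
    rw [← integral_mul_const]
    refine integral_mono_ae (((hint l).const_mul _).mul_const _).norm (h.norm.mul_const _) ?_
    filter_upwards [heq l, H.ae_le] with ω hω hω'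
    rw [hω, norm_mul]
    refine mul_le_mul_of_nonneg_left ?_ (norm_nonneg _)
    rw [norm_mul, norm_mul, norm_pow, norm_pow]
    refine mul_le_mul_of_nonneg_left (pow_le_pow_left₀ (norm_nonneg _) ?_ _) (norm_nonneg _)
    exact (neg_half_le_div H.m_pos hu hω').trans (le_abs_self _)

/-- The remainder of the sum rule for the coefficient of `s ^ k` after the terms of order less
than `p` of the Gegenbauer polynomials are split off. -/
noncomputable def _root_.StuBootstrap.sumRuleRem (d k p : ℕ) (μ : Measure (ℕ × ℝ)) (u : ℝ) : ℝ :=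
  ∫ ω, (ω.2 ^ (k + 1))⁻¹ * gegenbauerRem d ω.1 p (u / ω.2) * channelFactor k (u / ω.2) ∂μ

lemma sumRuleRem_integrand (H : SumRules d K m δ c μ) (k p : ℕ) (u : ℝ) : ∀ᵐ ω ∂μ,
    (ω.2 ^ (k + 1))⁻¹ * gegenbauerRem d ω.1 p (u / ω.2) * channelFactor k (u / ω.2) =
      dispersionKernel d k u ω - ∑ i ∈ Finset.range p,
        u ^ i * (momentKernel d k i ω * channelFactor k (u / ω.2)) := by
  filter_upwards [H.ae_le] with ω hω
  rw [dispersionKernel_eq k (H.m_pos.trans_le hω), gegenbauer_eq_eval H.three_le, gegenbauerRem,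
    mul_sub, sub_mul, Finset.mul_sum, Finset.sum_mul]
  congr 1
  · ring
  · refine Finset.sum_congr rfl fun i _ => ?_
    rw [momentKernel, div_pow, pow_add, mul_inv]
    ring

lemma integrable_sumRuleRem (H : SumRules d K m δ c μ) {k p : ℕ} (hk : K ≤ k)
    (h : ∀ i < p, Integrable (momentKernel d k i) μ) {u : ℝ} (hu : |u| ≤ m / 2) (hu0 : u ≤ 0) :
    Integrable (fun ω => (ω.2 ^ (k + 1))⁻¹ * gegenbauerRem d ω.1 p (u / ω.2) *
      channelFactor k (u / ω.2)) μ := by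
  refine Integrable.congr ?_ ((H.sumRuleRem_integrand k p u).mono fun ω h => h.symm)
  refine (H.integrable_dispersionKernel hk hu hu0).sub (integrable_finsetSum _ fun i hi => ?_)
  exact (H.integrable_mul_channelFactor (measurable_momentKernel d k i)
    (h i (Finset.mem_range.1 hi)) hu k).const_mul _

lemma hasSum_sumRuleRem (H : SumRules d K m δ c μ) {k p : ℕ} (hk : K ≤ k)
    (h : ∀ i < p, Integrable (momentKernel d k i) μ) {u : ℝ} (hu : -(min δ (m / 2)) < u)
    (hu0 : u < 0) :
    HasSum (fun n => (c k n - ∑ i ∈ Finset.range p, if i ≤ n then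
        channelCoeff k (n - i) * ∫ ω, momentKernel d (k + (n - i)) i ω ∂μ else 0) * u ^ n)
      (sumRuleRem d k p μ u) := by
  have hu1 : -δ < u := by linarith [min_le_left δ (m / 2)]
  have hu2 : |u| ≤ m / 2 := by rw [abs_of_neg hu0]; linarith [min_le_right δ (m / 2)]
  have hint : ∀ i ∈ Finset.range p, Integrable (fun ω =>
      u ^ i * (momentKernel d k i ω * channelFactor k (u / ω.2))) μ := fun i hi =>
    (H.integrable_mul_channelFactor (measurable_momentKernel d k i)
      (h i (Finset.mem_range.1 hi)) hu2 k).const_mul _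
  rw [sumRuleRem, integral_congr_ae (H.sumRuleRem_integrand k p u),
    integral_sub (H.integrable_dispersionKernel hk hu2 hu0.le) (integrable_finsetSum _ hint),
    integral_finsetSum _ hint]
  simp only [sub_mul, Finset.sum_mul]
  refine (H.hasSum k hk u hu1 hu0).sub (hasSum_sum fun i hi => ?_)
  rw [integral_const_mul]
  have h1 := (H.hasSum_integral_momentKernel (h i (Finset.mem_range.1 hi)) hu2).mul_left (u ^ i)
  have h2 := (hasSum_nat_add_iff (f := fun n => (if i ≤ n then
    channelCoeff k (n - i) * ∫ ω, momentKernel d (k + (n - i)) i ω ∂μ else 0) * u ^ n) i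
    (g := u ^ i * ∫ ω, momentKernel d k i ω * channelFactor k (u / ω.2) ∂μ)).1
  have h3 : ∑ n ∈ Finset.range i, (if i ≤ n then
      channelCoeff k (n - i) * ∫ ω, momentKernel d (k + (n - i)) i ω ∂μ else 0) * u ^ n = 0 := by
    refine Finset.sum_eq_zero fun n hn => ?_
    rw [if_neg (by simpa using hn), zero_mul]
  rw [h3, add_zero] at h2
  refine h2 ?_
  refine (congrArg (fun f => HasSum f _) (funext fun n => ?_)).mpr h1
  rw [if_pos (by omega), Nat.add_sub_cancel, pow_add]
  ring

lemma measurable_gegenbauerRem (d j q : ℕ) : Measurable (gegenbauerRem d j q) := by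
  unfold gegenbauerRem
  have := (gegenbauerPoly d j).continuous
  fun_prop

lemma eventually_nhdsLT_zero {a : ℝ} (ha : 0 < a) : ∀ᶠ u in 𝓝[<] (0 : ℝ), -a < u ∧ u < 0 := by
  have h1 : ∀ᶠ u in 𝓝[<] (0 : ℝ), u ∈ Set.Ioi (-a) :=
    mem_nhdsWithin_of_mem_nhds (Ioi_mem_nhds (by linarith))
  filter_upwards [h1, self_mem_nhdsWithin] with u h1 h2 using ⟨h1, h2⟩

lemma div_mem_of_neg {m u x : ℝ} (hm : 0 < m) (hu : -(m / 2) < u) (hu0 : u < 0) (hx : m ≤ x) :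
    -(1 / 2) ≤ u / x ∧ u / x ≤ 0 :=
  ⟨(abs_le.1 (neg_half_le_div hm (by rw [abs_of_neg hu0]; linarith) hx)).1,
    div_nonpos_of_nonpos_of_nonneg hu0.le (hm.trans_le hx).le⟩

lemma tendsto_sumRuleRem_div (H : SumRules d K m δ c μ) {k q : ℕ}
    (h : Integrable (momentKernel d k q) μ) :
    Tendsto (fun u => sumRuleRem d k (q + 1) μ u / u ^ q) (𝓝[<] 0) (𝓝 0) := by
  have hd := H.three_le
  have hm := H.m_pos
  have e : ∀ u, sumRuleRem d k (q + 1) μ u / u ^ q = ∫ ω, (ω.2 ^ (k + 1))⁻¹ *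
      gegenbauerRem d ω.1 (q + 1) (u / ω.2) * channelFactor k (u / ω.2) / u ^ q ∂μ := by
    intro u; rw [sumRuleRem, integral_div]
  simp only [e]
  have hev := eventually_nhdsLT_zero (half_pos hm)
  have e0 : (0 : ℝ) = ∫ _ω : ℕ × ℝ, (0 : ℝ) ∂μ := by simp
  conv => rhs; rw [e0]
  refine tendsto_integral_filter_of_dominated_convergence
    (fun ω => momentKernel d k q ω * (2 * (1 + 2 ^ (k + 1)))) ?_ ?_ (h.mul_const _) ?_
  · refine Eventually.of_forall fun u => Measurable.aestronglyMeasurable ?_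
    have := measurable_channelFactor k
    exact measurable_prod_nat (f := fun j x => (x ^ (k + 1))⁻¹ *
      gegenbauerRem d j (q + 1) (u / x) * channelFactor k (u / x) / u ^ q)
      fun j => by have := measurable_gegenbauerRem d j (q + 1); fun_prop
  · filter_upwards [hev] with u hu
    filter_upwards [H.ae_le] with ω hω
    have hx := hm.trans_le hω
    obtain ⟨h1, h2⟩ := div_mem_of_neg hm hu.1 hu.2 hω
    have hR : |gegenbauerRem d ω.1 (q + 1) (u / ω.2)| ≤
        2 * (gegenbauerCoeff d ω.1 q * |u / ω.2| ^ q) := by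
      have h3 := (gegenbauerRem_bounds hd ω.1 q h1 h2).2
      have h4 : gegenbauerRem d ω.1 (q + 1) (u / ω.2) = gegenbauerRem d ω.1 q (u / ω.2) -
          gegenbauerCoeff d ω.1 q * (u / ω.2) ^ q := by
        rw [gegenbauerRem, gegenbauerRem, Finset.sum_range_succ]; ring
      rw [h4]
      refine (abs_sub _ _).trans ?_
      rw [abs_mul, abs_of_nonneg (gegenbauerCoeff_nonneg hd _ _), abs_pow]
      linarith
    have hu0 : 0 < |u| := abs_pos.2 hu.2.ne
    rw [norm_div, norm_mul, norm_mul, Real.norm_of_nonneg (by positivity : 0 ≤ (ω.2 ^ (k + 1))⁻¹),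
      norm_pow, Real.norm_eq_abs, Real.norm_eq_abs, Real.norm_eq_abs, div_le_iff₀ (by positivity)]
    have hV := gegenbauerCoeff_nonneg hd ω.1 q
    calc _ ≤ (ω.2 ^ (k + 1))⁻¹ * (2 * (gegenbauerCoeff d ω.1 q * |u / ω.2| ^ q)) *
          (1 + 2 ^ (k + 1)) := by
            gcongr
            exact abs_channelFactor_le k h1
      _ = _ := by
        rw [momentKernel, abs_div, abs_of_pos hx, div_pow, pow_add ω.2 (k + 1), mul_inv]
        ring
  · filter_upwards [H.ae_le] with ω hω
    have hx := hm.trans_le hω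
    have hid : Tendsto (fun u : ℝ => u) (𝓝[<] 0) (𝓝 0) :=
      tendsto_nhdsWithin_of_tendsto_nhds tendsto_id
    have t : Tendsto (fun u : ℝ => (ω.2 ^ (k + 1))⁻¹ * (gegenbauerCoeff d ω.1 (q + 1) *
        (ω.2 ^ (q + 1))⁻¹) * (1 + 2 ^ (k + 1)) * |u|) (𝓝[<] 0)
        (𝓝 ((ω.2 ^ (k + 1))⁻¹ * (gegenbauerCoeff d ω.1 (q + 1) *
        (ω.2 ^ (q + 1))⁻¹) * (1 + 2 ^ (k + 1)) * |0|)) := hid.abs.const_mul _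
    rw [abs_zero, mul_zero] at t
    refine squeeze_zero_norm' ?_ t
    filter_upwards [hev] with u hu
    obtain ⟨h1, h2⟩ := div_mem_of_neg hm hu.1 hu.2 hω
    have h3 := (gegenbauerRem_bounds hd ω.1 (q + 1) h1 h2).2
    have hu0 : 0 < |u| := abs_pos.2 hu.2.ne
    rw [norm_div, norm_mul, norm_mul, Real.norm_of_nonneg (by positivity : 0 ≤ (ω.2 ^ (k + 1))⁻¹),
      norm_pow, Real.norm_eq_abs, Real.norm_eq_abs, Real.norm_eq_abs, div_le_iff₀ (by positivity)]
    have hV := gegenbauerCoeff_nonneg hd ω.1 (q + 1)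
    calc _ ≤ (ω.2 ^ (k + 1))⁻¹ * (gegenbauerCoeff d ω.1 (q + 1) * |u / ω.2| ^ (q + 1)) *
          (1 + 2 ^ (k + 1)) := by
            gcongr
            exact abs_channelFactor_le k h1
      _ = _ := by
        rw [abs_div, abs_of_pos hx, div_pow]
        ring

lemma sumRuleRem_coeff_eq_zero (H : SumRules d K m δ c μ) {k q : ℕ} (hk : K ≤ k)
    (h : ∀ i ≤ q, Integrable (momentKernel d k i) μ) : ∀ n ≤ q,
    (c k n - ∑ i ∈ Finset.range (q + 1), if i ≤ n then
        channelCoeff k (n - i) * ∫ ω, momentKernel d (k + (n - i)) i ω ∂μ else 0) = 0 :=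
  coeff_eq_zero_of_tendsto (lt_min H.δ_pos (half_pos H.m_pos))
    (fun _ hu hu0 => H.hasSum_sumRuleRem hk (p := q + 1)
      (fun i hi => h i (Nat.lt_succ_iff.1 hi)) hu hu0) (H.tendsto_sumRuleRem_div (h q le_rfl))

/-- All moments of the spectral measure are finite: the sum rule is smooth up to the forward limit
`u = 0`, and the remainders of the Taylor expansion of the Gegenbauer polynomials have a sign. -/
lemma integrable_momentKernel_self (H : SumRules d K m δ c μ) (i : ℕ) :
    Integrable (momentKernel d K i) μ := by
  have hd := H.three_le
  have hm := H.m_pos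
  induction i using Nat.strong_induction_on with
  | _ i ih =>
  rcases i with _ | q
  · refine H.integrable.congr (Eventually.of_forall fun ω => ?_)
    simp [momentKernel, gegenbauerCoeff_zero]
  have hle : ∀ i ≤ q, Integrable (momentKernel d K i) μ := fun i hi => ih i (by omega)
  have hz := H.sumRuleRem_coeff_eq_zero le_rfl hle
  set δ' := min δ (m / 2) with hδ'
  have hδ'0 : 0 < δ' := lt_min H.δ_pos (half_pos hm)
  have hδ'm : δ' ≤ m / 2 := min_le_right _ _
  obtain ⟨C, hC⟩ := exists_abs_sub_partialSum_le hδ'0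
    (fun _ hu hu0 => H.hasSum_sumRuleRem le_rfl (p := q + 1)
      (fun i hi => hle i (Nat.lt_succ_iff.1 hi)) hu hu0) (q + 1)
  let v : ℕ → ℝ := fun n => -(δ' / 4) * (1 / ((n : ℝ) + 1))
  have hv1 : ∀ n, -(δ' / 4) ≤ v n := by
    intro n
    have : 1 / ((n : ℝ) + 1) ≤ 1 := by
      rw [div_le_one (by positivity)]; linarith [n.cast_nonneg (α := ℝ)]
    simp only [v]; nlinarith
  have hv0 : ∀ n, v n < 0 := by
    intro n
    simp only [v]
    exact mul_neg_of_neg_of_pos (by linarith) (by positivity)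
  have hvt : Tendsto v atTop (𝓝 0) := by
    have := (tendsto_one_div_add_atTop_nhds_zero_nat (𝕜 := ℝ)).const_mul (-(δ' / 4))
    rwa [mul_zero] at this
  have hvu : ∀ n, |v n| ≤ m / 2 := fun n => by
    rw [abs_of_neg (hv0 n)]; linarith [hv1 n]
  have hint := fun n => H.integrable_sumRuleRem le_rfl (p := q + 1)
      (fun i hi => hle i (Nat.lt_succ_iff.1 hi)) (hvu n) (hv0 n).le
  have hbound : ∀ n, ∀ᵐ ω ∂μ,
      ‖(ω.2 ^ (K + 1))⁻¹ * gegenbauerRem d ω.1 (q + 1) (v n / ω.2) / v n ^ (q + 1)‖ ≤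
      (-1) ^ (q + 1) * ((ω.2 ^ (K + 1))⁻¹ * gegenbauerRem d ω.1 (q + 1) (v n / ω.2) *
        channelFactor K (v n / ω.2)) / |v n| ^ (q + 1) := by
    intro n
    filter_upwards [H.ae_le] with ω hω
    have hx := hm.trans_le hω
    obtain ⟨h1, h2⟩ := div_mem_of_neg hm (by linarith [hv1 n]) (hv0 n) hω
    have h3 := (gegenbauerRem_bounds hd ω.1 q h1 h2).1
    have h4 : |gegenbauerRem d ω.1 (q + 1) (v n / ω.2)| =
        (-1) ^ (q + 1) * gegenbauerRem d ω.1 (q + 1) (v n / ω.2) := by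
      rw [← abs_of_nonneg h3, abs_mul, abs_pow, abs_neg, abs_one, one_pow, one_mul]
    have h5 : 1 ≤ channelFactor K (v n / ω.2) := by
      rw [channelFactor, H.even.neg_one_pow, one_mul]
      have : 0 ≤ ((1 + v n / ω.2) ^ (K + 1))⁻¹ := inv_nonneg.2 (pow_nonneg (by linarith) _)
      linarith
    rw [norm_div, norm_mul, Real.norm_of_nonneg (by positivity : 0 ≤ (ω.2 ^ (K + 1))⁻¹),
      norm_pow, Real.norm_eq_abs, Real.norm_eq_abs, h4]
    refine div_le_div_of_nonneg_right ?_ (by positivity)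
    have h6 : 0 ≤ (ω.2 ^ (K + 1))⁻¹ := by positivity
    nlinarith [mul_nonneg h6 h3, mul_nonneg (mul_nonneg h6 h3) (sub_nonneg.2 h5)]
  have hGmeas : ∀ n, Measurable (fun ω : ℕ × ℝ =>
      (ω.2 ^ (K + 1))⁻¹ * gegenbauerRem d ω.1 (q + 1) (v n / ω.2) / v n ^ (q + 1)) := fun n =>
    measurable_prod_nat (f := fun j x => (x ^ (K + 1))⁻¹ *
      gegenbauerRem d j (q + 1) (v n / x) / v n ^ (q + 1))
      fun j => by have := measurable_gegenbauerRem d j (q + 1); fun_prop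
  refine integrable_of_tendsto_of_integral_le (C := C) (G := fun n ω =>
    (ω.2 ^ (K + 1))⁻¹ * gegenbauerRem d ω.1 (q + 1) (v n / ω.2) / v n ^ (q + 1)) ?_ ?_ ?_
  · filter_upwards [H.ae_le] with ω hω
    have hx := hm.trans_le hω
    have t : Tendsto (fun n => (ω.2 ^ (K + 1))⁻¹ * (gegenbauerCoeff d ω.1 (q + 2) *
        (ω.2 ^ (q + 2))⁻¹) * |v n|) atTop (𝓝 ((ω.2 ^ (K + 1))⁻¹ *
        (gegenbauerCoeff d ω.1 (q + 2) * (ω.2 ^ (q + 2))⁻¹) * |0|)) := hvt.abs.const_mul _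
    rw [abs_zero, mul_zero] at t
    rw [← tendsto_sub_nhds_zero_iff]
    refine squeeze_zero_norm (fun n => ?_) t
    obtain ⟨h1, h2⟩ := div_mem_of_neg hm (by linarith [hv1 n]) (hv0 n) hω
    have h3 := (gegenbauerRem_bounds hd ω.1 (q + 2) h1 h2).2
    have hvn : v n ≠ 0 := (hv0 n).ne
    have h4 : gegenbauerRem d ω.1 (q + 1) (v n / ω.2) = gegenbauerRem d ω.1 (q + 2) (v n / ω.2) +
        gegenbauerCoeff d ω.1 (q + 1) * (v n / ω.2) ^ (q + 1) := by
      rw [gegenbauerRem, gegenbauerRem, Finset.sum_range_succ _ (q + 1)]; ring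
    have h5 : (ω.2 ^ (K + 1))⁻¹ * gegenbauerRem d ω.1 (q + 1) (v n / ω.2) / v n ^ (q + 1) -
        momentKernel d K (q + 1) ω =
        (ω.2 ^ (K + 1))⁻¹ * gegenbauerRem d ω.1 (q + 2) (v n / ω.2) / v n ^ (q + 1) := by
      rw [h4, momentKernel, pow_add ω.2 (K + 1), mul_inv, div_pow]
      field_simp
      ring
    rw [h5, norm_div, norm_mul, Real.norm_of_nonneg (by positivity : 0 ≤ (ω.2 ^ (K + 1))⁻¹),
      norm_pow, Real.norm_eq_abs, Real.norm_eq_abs, div_le_iff₀ (by positivity)]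
    calc _ ≤ (ω.2 ^ (K + 1))⁻¹ * (gegenbauerCoeff d ω.1 (q + 2) * |v n / ω.2| ^ (q + 2)) := by
          gcongr
      _ = _ := by
        rw [abs_div, abs_of_pos hx, div_pow]
        ring
  · intro n
    exact (((hint n).const_mul ((-1) ^ (q + 1))).div_const (|v n| ^ (q + 1))).mono'
      (hGmeas n).aestronglyMeasurable (hbound n)
  · intro n
    have hvn : 0 < |v n| := abs_pos.2 (hv0 n).ne
    refine (integral_mono_of_nonneg (Eventually.of_forall fun _ => norm_nonneg _)
      (((hint n).const_mul ((-1) ^ (q + 1))).div_const (|v n| ^ (q + 1))) (hbound n)).trans ?_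
    rw [integral_div, integral_const_mul, div_le_iff₀ (by positivity)]
    have h6 := hC (v n) (hv1 n) (hv0 n)
    rw [Finset.sum_eq_zero, sub_zero] at h6
    · refine (le_abs_self _).trans ?_
      rw [abs_mul, abs_pow, abs_neg, abs_one, one_pow, one_mul]
      exact h6
    · intro i hi
      rw [hz i (Nat.lt_succ_iff.1 (Finset.mem_range.1 hi)), zero_mul]

lemma integrable_momentKernel (H : SumRules d K m δ c μ) {k : ℕ} (hk : K ≤ k) (i : ℕ) :
    Integrable (momentKernel d k i) μ :=
  H.integrable_momentKernel_of_le hk (H.integrable_momentKernel_self i)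

/-- The contribution of a state to the coefficient of `s ^ k * u ^ q` of the amplitude. -/
noncomputable def _root_.StuBootstrap.coeffKernel (d k q : ℕ) (ω : ℕ × ℝ) : ℝ :=
  kernelCoeff d ω.1 k q * (ω.2 ^ (k + 1 + q))⁻¹

lemma _root_.StuBootstrap.coeffKernel_eq_sum (d k q : ℕ) (ω : ℕ × ℝ) : coeffKernel d k q ω =
    ∑ i ∈ Finset.range (q + 1), channelCoeff k (q - i) * momentKernel d (k + (q - i)) i ω := by
  rw [coeffKernel, kernelCoeff_eq_sum, Finset.sum_mul]
  refine Finset.sum_congr rfl fun i hi => ?_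
  have : k + (q - i) + 1 + i = k + 1 + q := by have := Finset.mem_range.1 hi; omega
  rw [momentKernel, this]
  ring

lemma integrable_coeffKernel (H : SumRules d K m δ c μ) {k : ℕ} (hk : K ≤ k) (q : ℕ) :
    Integrable (coeffKernel d k q) μ := by
  simp only [funext (coeffKernel_eq_sum d k q)]
  exact integrable_finsetSum _ fun i _ => (H.integrable_momentKernel (by omega) i).const_mul _

lemma coeff_eq_integral (H : SumRules d K m δ c μ) {k : ℕ} (hk : K ≤ k) (q : ℕ) :
    c k q = ∫ ω, coeffKernel d k q ω ∂μ := by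
  have h := H.sumRuleRem_coeff_eq_zero hk (fun i _ => H.integrable_momentKernel hk i) q le_rfl
  rw [sub_eq_zero] at h
  rw [h]
  simp only [funext (coeffKernel_eq_sum d k q)]
  rw [integral_finsetSum _ fun i _ => (H.integrable_momentKernel (by omega) i).const_mul _]
  refine Finset.sum_congr rfl fun i hi => ?_
  rw [if_pos (Nat.lt_succ_iff.1 (Finset.mem_range.1 hi)), integral_const_mul]

end SumRules

/-! ### The residue of the first pole in the crossed channel -/

/-- The Abel means of a convergent sequence converge to its limit. -/
lemma tendsto_one_sub_mul_tsum {b : ℕ → ℝ} {l : ℝ} (hb : Tendsto b atTop (𝓝 l)) :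
    Tendsto (fun z => (1 - z) * ∑' n, b n * z ^ n) (𝓝[<] 1) (𝓝 l) := by
  let f : ℕ → ℝ := fun n => b n - if n = 0 then 0 else b (n - 1)
  have hf : ∀ n, ∑ i ∈ Finset.range (n + 1), f i = b n := by
    intro n
    induction n with
    | zero => simp [f]
    | succ n ih => rw [Finset.sum_range_succ, ih]; simp [f]
  have h1 : Tendsto (fun n => ∑ i ∈ Finset.range n, f i) atTop (𝓝 l) := by
    rw [← tendsto_add_atTop_iff_nat 1]
    simpa only [hf] using hb
  refine (Real.tendsto_tsum_powerSeries_nhdsWithin_lt h1).congr' ?_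
  have hev : ∀ᶠ z in 𝓝[<] (1 : ℝ), z ∈ Set.Ioi (0 : ℝ) :=
    mem_nhdsWithin_of_mem_nhds (Ioi_mem_nhds one_pos)
  filter_upwards [hev, self_mem_nhdsWithin] with z hz0 hz1
  have hz0 : 0 < z := hz0
  have hz1 : z < 1 := hz1
  obtain ⟨B, hB⟩ := hb.norm.bddAbove_range
  have hs : Summable (fun n => b n * z ^ n) := by
    refine Summable.of_norm_bounded ((summable_geometric_of_lt_one hz0.le hz1).mul_left B)
      fun n => ?_
    rw [norm_mul, norm_pow, Real.norm_of_nonneg hz0.le]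
    exact mul_le_mul_of_nonneg_right (hB ⟨n, rfl⟩) (by positivity)
  have h2 : HasSum (fun n => (if n = 0 then 0 else b (n - 1)) * z ^ n)
      (z * ∑' n, b n * z ^ n) := by
    refine (hasSum_nat_add_iff' 1).1 ?_
    simp only [Finset.range_one, Finset.sum_singleton, if_true, zero_mul, sub_zero]
    refine (congrArg (fun f => HasSum f _) (funext fun n => ?_)).mpr (hs.hasSum.mul_left z)
    rw [if_neg (by omega), Nat.add_sub_cancel, pow_succ]
    ring
  have h3 := (hs.hasSum.sub h2).tsum_eq
  rw [sub_mul, one_mul, ← h3]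
  refine tsum_congr fun n => ?_
  simp only [f, sub_mul]

namespace SumRules

variable {d K : ℕ} {m δ : ℝ} {c : ℕ → ℕ → ℝ} {μ : Measure (ℕ × ℝ)}

/-- The residue in `u` at `u = R` of the coefficient of `s ^ k` of the amplitude. -/
noncomputable def _root_.StuBootstrap.crossedResidue (d k : ℕ) (R : ℝ) (μ : Measure (ℕ × ℝ)) : ℝ :=
  ∫ ω in {ω | ω.2 = R}, gegenbauerCoeff d ω.1 k * (ω.2 ^ (k + 1))⁻¹ ∂μ

/-- The states above `R` contribute little to the coefficients of `s ^ q * u ^ k` for large `q`. -/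
lemma tendsto_pow_mul_setIntegral_coeffKernel (H : SumRules d K m δ c μ) {k : ℕ}
    {R R' : ℝ} (hR : 0 < R) (hRR' : R < R') (hgap : ∀ᵐ ω ∂μ, ω.2 ≤ R ∨ R' ≤ ω.2) :
    Tendsto (fun q => R ^ q * ∫ ω in {ω | R < ω.2}, coeffKernel d q k ω ∂μ) atTop (𝓝 0) := by
  have hd := H.three_le
  have hR' : 0 < R' := hR.trans hRR'
  have hset : MeasurableSet {ω : ℕ × ℝ | R < ω.2} := measurableSet_lt measurable_const measurable_snd
  let S : ℕ × ℝ → ℝ := fun ω =>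
    (∑ i ∈ Finset.range (k + 1), gegenbauerCoeff d ω.1 i) * (ω.2 ^ (K + 1 + k))⁻¹
  have hS : Integrable S μ := by
    simp only [S, Finset.sum_mul]
    refine integrable_finsetSum _ fun i hi => ?_
    exact H.integrable_mul_inv_pow (f := fun ω => gegenbauerCoeff d ω.1 i)
      (measurable_prod_nat (f := fun j _ => gegenbauerCoeff d j i) fun _ => measurable_const)
      (by have := Finset.mem_range.1 hi; omega) (H.integrable_momentKernel_self i)
  set D := ∫ ω in {ω | R < ω.2}, S ω ∂μ
  have hgap' : ∀ᵐ ω ∂(μ.restrict {ω | R < ω.2}), R' ≤ ω.2 := by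
    filter_upwards [ae_restrict_of_ae hgap, ae_restrict_mem hset] with ω h1 h2
    exact h1.resolve_left (not_le.2 h2)
  have hb : ∀ q ≥ K, ‖R ^ q * ∫ ω in {ω | R < ω.2}, coeffKernel d q k ω ∂μ‖ ≤
      (2 * R' ^ K * D * ((R / R') ^ (k + 1))⁻¹) *
        (((q + (k + 1) : ℕ) : ℝ) ^ k * (R / R') ^ (q + (k + 1))) := by
    intro q hq
    have h1 : ‖∫ ω in {ω | R < ω.2}, coeffKernel d q k ω ∂μ‖ ≤
        ∫ ω in {ω | R < ω.2}, 2 * (q + k + 1) ^ k * (R' ^ (q - K))⁻¹ * S ω ∂μ := by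
      refine norm_integral_le_of_norm_le (hS.integrableOn.const_mul _) ?_
      filter_upwards [hgap'] with ω hω
      have hx := hR'.trans_le hω
      have hsum0 : 0 ≤ ∑ i ∈ Finset.range (k + 1), gegenbauerCoeff d ω.1 i :=
        Finset.sum_nonneg fun i _ => gegenbauerCoeff_nonneg hd _ _
      have h2 : (ω.2 ^ (q + 1 + k))⁻¹ ≤ (R' ^ (q - K))⁻¹ * (ω.2 ^ (K + 1 + k))⁻¹ := by
        rw [show q + 1 + k = (q - K) + (K + 1 + k) by omega, pow_add, mul_inv]
        gcongr
      rw [coeffKernel, norm_mul, Real.norm_eq_abs,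
        Real.norm_of_nonneg (by positivity : 0 ≤ (ω.2 ^ (q + 1 + k))⁻¹)]
      calc _ ≤ (2 * (q + k + 1) ^ k * ∑ i ∈ Finset.range (k + 1), gegenbauerCoeff d ω.1 i) *
            ((R' ^ (q - K))⁻¹ * (ω.2 ^ (K + 1 + k))⁻¹) :=
          mul_le_mul (abs_kernelCoeff_le hd _ _ _) h2 (by positivity) (by positivity)
        _ = _ := by simp only [S]; ring
    rw [integral_const_mul] at h1
    rw [norm_mul, Real.norm_of_nonneg (by positivity)]
    refine (mul_le_mul_of_nonneg_left h1 (by positivity)).trans_eq ?_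
    have h3 : R' ^ q = R' ^ (q - K) * R' ^ K := by rw [← pow_add]; congr 1; omega
    have h4 : (R / R') ^ (k + 1) ≠ 0 := by positivity
    have h5 : ((q + (k + 1) : ℕ) : ℝ) = q + k + 1 := by push_cast; ring
    rw [pow_add (R / R') q, h5, div_pow R R' q, h3]
    field_simp
    simp only [D]
  have hr : |R / R'| < 1 := by
    rw [abs_of_pos (by positivity), div_lt_one hR']; exact hRR'
  have ht := ((tendsto_pow_const_mul_const_pow_of_abs_lt_one k hr).comp
    (tendsto_add_atTop_nat (k + 1))).const_mul (2 * R' ^ K * D * ((R / R') ^ (k + 1))⁻¹)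
  rw [mul_zero] at ht
  refine squeeze_zero_norm' ?_ ht
  filter_upwards [eventually_ge_atTop K] with q hq using hb q hq

/-- Crossing symmetry determines the growth in `q` of the coefficients of `s ^ k * u ^ q`, once the
`s`- and `t`-channel poles at squared masses up to `R` are removed: the first singularity in `u` is
the pole at `u = R`. -/
lemma tendsto_pow_mul_setIntegral_coeffKernel' (H : SumRules d K m δ c μ)
    (hc : ∀ k q, c k q = c q k) {k : ℕ} (hk : K ≤ k) (hke : Even k)
    {R R' : ℝ} (hR : 0 < R) (hRR' : R < R') (hgap : ∀ᵐ ω ∂μ, ω.2 ≤ R ∨ R' ≤ ω.2)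
    (hlow : ∀ᵐ ω ∂μ, ω.2 < R → ω.1 < K) (hat : ∀ᵐ ω ∂μ, ω.2 = R → ω.1 ≤ K + 2) :
    Tendsto (fun q => R ^ q * ∫ ω in {ω | R < ω.2}, coeffKernel d k q ω ∂μ) atTop
      (𝓝 (crossedResidue d k R μ)) := by
  have ht := (H.tendsto_pow_mul_setIntegral_coeffKernel (k := k) hR hRR' hgap).add_const
    (crossedResidue d k R μ)
  rw [zero_add] at ht
  refine ht.congr' ?_
  filter_upwards [eventually_gt_atTop (K + 2)] with q hq
  have hset : MeasurableSet {ω : ℕ × ℝ | R < ω.2} := measurableSet_lt measurable_const measurable_snd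
  have hset' : MeasurableSet {ω : ℕ × ℝ | ω.2 = R} := measurableSet_eq_fun measurable_snd
    measurable_const
  have hi1 := H.integrable_coeffKernel hk q
  have hi2 := H.integrable_coeffKernel (k := q) (by omega) k
  have h1 := integral_add_compl hset hi1
  have h2 := integral_add_compl hset hi2
  rw [← H.coeff_eq_integral hk q, hc, H.coeff_eq_integral (k := q) (by omega) k, ← h2] at h1
  have h3 : ∫ ω in {ω | R < ω.2}ᶜ, coeffKernel d q k ω ∂μ -
      ∫ ω in {ω | R < ω.2}ᶜ, coeffKernel d k q ω ∂μ =
      ∫ ω in {ω | ω.2 = R}, gegenbauerCoeff d ω.1 k * (ω.2 ^ (k + 1 + q))⁻¹ ∂μ := by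
    rw [← integral_sub hi2.integrableOn hi1.integrableOn, ← integral_indicator hset.compl,
      ← integral_indicator hset']
    refine integral_congr_ae ?_
    filter_upwards [hlow, hat, H.ae_even] with ω h4 h5 h6
    by_cases hω : ω.2 ≤ R
    · have h7 : ω ∈ {ω : ℕ × ℝ | R < ω.2}ᶜ := by simpa using hω
      have h8 : ω.1 < q := by
        rcases hω.lt_or_eq with h | h
        · have := h4 h; omega
        · have := h5 h; omega
      rw [Set.indicator_of_mem h7, coeffKernel, coeffKernel,
        show q + 1 + k = k + 1 + q by ring, ← sub_mul,
        kernelCoeff_sub_kernelCoeff H.three_le h6 hke h8]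
      rcases hω.lt_or_eq with h | h
      · rw [Set.indicator_of_notMem (by simpa using h.ne),
          gegenbauerCoeff_eq_zero ((h4 h).trans_le hk), zero_mul]
      · rw [Set.indicator_of_mem (by simpa using h)]
    · rw [Set.indicator_of_notMem (by simpa using hω),
        Set.indicator_of_notMem (by simpa using fun h : ω.2 = R => hω h.le)]
  have h4 : R ^ q * ∫ ω in {ω | ω.2 = R}, gegenbauerCoeff d ω.1 k * (ω.2 ^ (k + 1 + q))⁻¹ ∂μ =
      crossedResidue d k R μ := by
    rw [crossedResidue, ← integral_const_mul]
    refine setIntegral_congr_fun hset' fun ω (hω : ω.2 = R) => ?_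
    simp only [hω, pow_add R (k + 1) q]
    field_simp
  rw [← h4, ← h3]
  linear_combination (-R ^ q) * h1

/-- Continuation of the sum rule to `0 ≤ u < R`, for the states above `R`. -/
lemma integrableOn_dispersionKernel (H : SumRules d K m δ c μ) {k : ℕ} (hk : K ≤ k) (hke : Even k)
    {R : ℝ} (hR : 0 < R) {l : ℝ}
    (hb : Tendsto (fun q => R ^ q * ∫ ω in {ω | R < ω.2}, coeffKernel d k q ω ∂μ) atTop (𝓝 l))
    {z : ℝ} (hz0 : 0 ≤ z) (hz1 : z < 1) :
    IntegrableOn (dispersionKernel d k (R * z)) {ω | R < ω.2} μ ∧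
      ∫ ω in {ω | R < ω.2}, dispersionKernel d k (R * z) ω ∂μ =
        ∑' q, (R ^ q * ∫ ω in {ω | R < ω.2}, coeffKernel d k q ω ∂μ) * z ^ q := by
  have hd := H.three_le
  have hset : MeasurableSet {ω : ℕ × ℝ | R < ω.2} := measurableSet_lt measurable_const measurable_snd
  set b : ℕ → ℝ := fun q => R ^ q * ∫ ω in {ω | R < ω.2}, coeffKernel d k q ω ∂μ with hbdef
  let N : ℕ → ℕ × ℝ → ℝ := fun n ω =>
    (ω.2 ^ (k + 1))⁻¹ * improvedCoeff d ω.1 k (R / ω.2) n * z ^ n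
  have hz : |z| < 1 := by rwa [abs_of_nonneg hz0]
  have hN0 : ∀ n, ∀ᵐ ω ∂(μ.restrict {ω | R < ω.2}), 0 ≤ N n ω := by
    intro n
    filter_upwards [ae_restrict_mem hset] with ω hω
    have hω : R < ω.2 := hω
    have hx := hR.trans hω
    have := improvedCoeff_nonneg hd ω.1 hke (y := R / ω.2) (by positivity)
      ((div_le_one hx).2 hω.le) n
    simp only [N]
    positivity
  have hNeq : ∀ n, N n = fun ω => ∑ i ∈ Finset.range (n + 1),
      ((k + (n - i)).choose k * R ^ i * z ^ n) * coeffKernel d k i ω := by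
    intro n
    funext ω
    simp only [N, improvedCoeff_eq_sum, Finset.mul_sum, Finset.sum_mul, coeffKernel]
    refine Finset.sum_congr rfl fun i _ => ?_
    rw [div_pow, pow_add ω.2 (k + 1) i, mul_inv]
    ring
  have hNint : ∀ n, IntegrableOn (N n) {ω | R < ω.2} μ := by
    intro n
    rw [hNeq]
    exact integrable_finsetSum _ fun i _ => ((H.integrable_coeffKernel hk i).const_mul _).integrableOn
  have hNval : ∀ n, ∫ ω in {ω | R < ω.2}, N n ω ∂μ =
      PowerSeries.coeff n (PowerSeries.mk b * PowerSeries.mk 1 ^ (k + 1)) * z ^ n := by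
    intro n
    rw [hNeq, integral_finsetSum _ fun i _ =>
      ((H.integrable_coeffKernel hk i).const_mul _).integrableOn, PowerSeries.coeff_mul,
      Finset.Nat.sum_antidiagonal_eq_sum_range_succ (fun x y => PowerSeries.coeff x
      (PowerSeries.mk b) * PowerSeries.coeff y (PowerSeries.mk (1 : ℕ → ℝ) ^ (k + 1))),
      Finset.sum_mul]
    refine Finset.sum_congr rfl fun i _ => ?_
    rw [integral_const_mul, PowerSeries.coeff_mk, PowerSeries.mk_one_pow_eq_mk_choose_add,
      PowerSeries.coeff_mk, hbdef]
    ring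
  obtain ⟨B, hB⟩ := hb.norm.bddAbove_range
  have hbs : SumsTo (PowerSeries.mk b) z (∑' n, b n * z ^ n) := by
    have h1 : Summable (fun n => ‖b n * z ^ n‖) := by
      refine Summable.of_nonneg_of_le (fun _ => norm_nonneg _) (fun n => ?_)
        ((summable_geometric_of_lt_one hz0 hz1).mul_left B)
      rw [norm_mul, norm_pow, Real.norm_of_nonneg hz0]
      exact mul_le_mul_of_nonneg_right (hB ⟨n, rfl⟩) (by positivity)
    simp only [SumsTo, PowerSeries.coeff_mk]
    exact ⟨h1, h1.of_norm.hasSum⟩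
  have hNs := hbs.mul ((sumsTo_geom hz).pow (k + 1))
  have hnorm : ∀ n, ∫ ω in {ω | R < ω.2}, ‖N n ω‖ ∂μ = ∫ ω in {ω | R < ω.2}, N n ω ∂μ := by
    intro n
    refine integral_congr_ae ?_
    filter_upwards [hN0 n] with ω hω using Real.norm_of_nonneg hω
  have hsum := hasSum_integral_of_summable_integral_norm (μ := μ.restrict {ω | R < ω.2})
    hNint (by simp only [hnorm, hNval]; exact hNs.1.of_norm)
  have hpt : ∀ᵐ ω ∂(μ.restrict {ω | R < ω.2}), HasSum (fun n => N n ω)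
      (dispersionKernel d k (R * z) ω * ((1 - z)⁻¹) ^ (k + 1)) := by
    filter_upwards [ae_restrict_mem hset] with ω hω
    have hω : R < ω.2 := hω
    have hx := hR.trans hω
    have := (hasSum_improvedCoeff hd ω.1 k (y := R / ω.2) (by positivity)
      ((div_le_one hx).2 hω.le) hz).mul_left ((ω.2 ^ (k + 1))⁻¹)
    rw [dispersionKernel_eq k hx, channelFactor, mul_div_right_comm, mul_assoc]
    simpa only [N, mul_assoc] using this
  have hz' : ((1 - z)⁻¹) ^ (k + 1) ≠ 0 := by
    have : 0 < 1 - z := by linarith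
    positivity
  have hint : Integrable (fun ω => dispersionKernel d k (R * z) ω * ((1 - z)⁻¹) ^ (k + 1))
      (μ.restrict {ω | R < ω.2}) := by
    refine integrable_of_tendsto_of_integral_le
      (G := fun n ω => ∑ i ∈ Finset.range n, N i ω)
      (C := ∑' n, PowerSeries.coeff n (PowerSeries.mk b * PowerSeries.mk 1 ^ (k + 1)) * z ^ n)
      ?_ (fun n => integrable_finsetSum _ fun i _ => hNint i) fun n => ?_
    · filter_upwards [hpt] with ω hω using hω.tendsto_sum_nat
    · have : ∫ ω in {ω | R < ω.2}, ‖∑ i ∈ Finset.range n, N i ω‖ ∂μ =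
          ∑ i ∈ Finset.range n, PowerSeries.coeff i
            (PowerSeries.mk b * PowerSeries.mk 1 ^ (k + 1)) * z ^ i := by
        simp only [← hNval]
        rw [← integral_finsetSum _ fun i _ => hNint i]
        refine integral_congr_ae ?_
        filter_upwards [ae_all_iff.2 hN0] with ω hω
        exact Real.norm_of_nonneg (Finset.sum_nonneg fun i _ => hω i)
      rw [this]
      refine hNs.1.of_norm.sum_le_tsum _ fun i _ => ?_
      rw [← hNval]
      exact integral_nonneg_of_ae (hN0 i)
  constructor
  · refine (hint.mul_const ((((1 - z)⁻¹) ^ (k + 1))⁻¹)).congr (Eventually.of_forall fun ω => ?_)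
    simp only
    rw [mul_assoc, mul_inv_cancel₀ hz', mul_one]
  · have h1 : ∫ ω in {ω | R < ω.2}, (∑' n, N n ω) ∂μ =
        (∫ ω in {ω | R < ω.2}, dispersionKernel d k (R * z) ω ∂μ) * ((1 - z)⁻¹) ^ (k + 1) := by
      rw [← integral_mul_const]
      refine integral_congr_ae ?_
      filter_upwards [hpt] with ω hω using hω.tsum_eq
    simp only [hNval] at hsum
    have h2 := hsum.unique hNs.2
    rw [h1] at h2
    exact mul_right_cancel₀ hz' h2

lemma dispersionKernel_convex {d K : ℕ} (hd : 3 ≤ d) (hK : Even K) {u lam : ℝ} (hu : 0 ≤ u)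
    (hl : 0 < lam) {ω : ℕ × ℝ} (hω : 0 < ω.2) :
    2 * dispersionKernel d (K + 2) u ω ≤
      lam * dispersionKernel d K u ω + lam⁻¹ * dispersionKernel d (K + 4) u ω := by
  have h2 : Even (K + 2) := hK.add (by decide)
  have h4 : Even (K + 4) := hK.add (by decide)
  have hP : 0 ≤ gegenbauer d ω.1 (1 + 2 * u / ω.2) := by
    rw [mul_div_assoc, gegenbauer_eq_eval hd, eval_gegenbauerPoly]
    exact Finset.sum_nonneg fun i _ => mul_nonneg (gegenbauerCoeff_nonneg hd _ _) (by positivity)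
  have key : ∀ a : ℝ, 0 < a → 2 * (a ^ (K + 2 + 1))⁻¹ ≤
      lam * (a ^ (K + 1))⁻¹ + lam⁻¹ * (a ^ (K + 4 + 1))⁻¹ := by
    intro a ha
    have e : lam * (a ^ (K + 1))⁻¹ + lam⁻¹ * (a ^ (K + 4 + 1))⁻¹ - 2 * (a ^ (K + 2 + 1))⁻¹ =
        (a ^ (K + 1))⁻¹ * lam⁻¹ * (lam - (a ^ 2)⁻¹) ^ 2 := by
      rw [show K + 4 + 1 = (K + 1) + 4 by ring, show K + 2 + 1 = (K + 1) + 2 by ring, pow_add a _ 4,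
        pow_add a _ 2]
      field_simp
      ring
    have : 0 ≤ (a ^ (K + 1))⁻¹ * lam⁻¹ * (lam - (a ^ 2)⁻¹) ^ 2 := by positivity
    linarith
  simp only [dispersionKernel, hK.neg_one_pow, h2.neg_one_pow, h4.neg_one_pow, one_mul]
  have k1 := mul_le_mul_of_nonneg_left (key ω.2 hω) hP
  have k2 := mul_le_mul_of_nonneg_left (key (ω.2 + u) (by linarith)) hP
  linarith

/-- The core of the argument. If spins at least `K` are absent below the squared mass `R`, then spin
`K + 2` cannot be the largest spin at `R`: near the pole at `u = R` the coefficients of `s ^ K`,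
`s ^ (K + 2)` and `s ^ (K + 4)` are moments of a positive measure, so that the residue of the second
is bounded by the geometric mean of the residues of the others, the last of which vanishes. -/
theorem gap_contradiction (H : SumRules d K m δ c μ)
    (hc : ∀ k q, c k q = c q k) {R R' : ℝ} (hR : 0 < R) (hRR' : R < R')
    (hgap : ∀ᵐ ω ∂μ, ω.2 ≤ R ∨ R' ≤ ω.2) (hlow : ∀ᵐ ω ∂μ, ω.2 < R → ω.1 < K)
    (hat : ∀ᵐ ω ∂μ, ω.2 = R → ω.1 ≤ K + 2) (hpos : μ {(K + 2, R)} ≠ 0) : False := by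
  have hd := H.three_le
  have h2 : Even (K + 2) := H.even.add (by decide)
  have h4 : Even (K + 4) := H.even.add (by decide)
  have hset' : MeasurableSet {ω : ℕ × ℝ | ω.2 = R} := measurableSet_eq_fun measurable_snd
    measurable_const
  have hset : MeasurableSet {ω : ℕ × ℝ | R < ω.2} := measurableSet_lt measurable_const measurable_snd
  have t : ∀ k, K ≤ k → Even k → _ := fun k hk hke =>
    H.tendsto_pow_mul_setIntegral_coeffKernel' hc hk hke hR hRR' hgap hlow hat
  have hlim : ∀ k, K ≤ k → Even k → Tendsto (fun z => (1 - z) *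
      ∫ ω in {ω | R < ω.2}, dispersionKernel d k (R * z) ω ∂μ) (𝓝[<] 1)
      (𝓝 (crossedResidue d k R μ)) := by
    intro k hk hke
    refine (tendsto_one_sub_mul_tsum (t k hk hke)).congr' ?_
    have hev : ∀ᶠ z in 𝓝[<] (1 : ℝ), z ∈ Set.Ioi (0 : ℝ) :=
      mem_nhdsWithin_of_mem_nhds (Ioi_mem_nhds one_pos)
    filter_upwards [hev, self_mem_nhdsWithin] with z hz0 hz1
    rw [(H.integrableOn_dispersionKernel hk hke hR (t k hk hke) (le_of_lt hz0) hz1).2]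
  have hw4 : crossedResidue d (K + 4) R μ = 0 := by
    rw [crossedResidue]
    refine (integral_congr_ae (g := fun _ => 0) ?_).trans (integral_zero _ _)
    filter_upwards [ae_restrict_of_ae hat, ae_restrict_mem hset'] with ω h5 h6
    rw [gegenbauerCoeff_eq_zero (by have := h5 h6; omega), zero_mul]
  have hw0 : 0 ≤ crossedResidue d K R μ := by
    refine setIntegral_nonneg hset' fun ω (hω : ω.2 = R) => ?_
    rw [hω]
    exact mul_nonneg (gegenbauerCoeff_nonneg hd _ _) (by positivity)
  have hw2 : 0 < crossedResidue d (K + 2) R μ := by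
    have hnn : ∀ ω ∈ {ω : ℕ × ℝ | ω.2 = R},
        0 ≤ gegenbauerCoeff d ω.1 (K + 2) * (ω.2 ^ (K + 2 + 1))⁻¹ := by
      intro ω (hω : ω.2 = R)
      rw [hω]
      exact mul_nonneg (gegenbauerCoeff_nonneg hd _ _) (by positivity)
    have hint : IntegrableOn (fun ω => gegenbauerCoeff d ω.1 (K + 2) * (ω.2 ^ (K + 2 + 1))⁻¹)
        {ω : ℕ × ℝ | ω.2 = R} μ := by
      refine ((H.integrable_momentKernel (k := K + 2) (by omega) (K + 2)).mul_const
        (R ^ (K + 2))).integrableOn.congr_fun (fun ω (hω : ω.2 = R) => ?_) hset'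
      simp only [momentKernel, hω, pow_add R (K + 2 + 1) (K + 2)]
      field_simp
    rw [crossedResidue, setIntegral_pos_iff_support_of_nonneg_ae
      (by filter_upwards [ae_restrict_mem hset'] with ω hω using hnn ω hω) hint]
    refine lt_of_lt_of_le (pos_iff_ne_zero.2 hpos) (measure_mono ?_)
    intro ω hω
    rw [Set.mem_singleton_iff] at hω
    subst hω
    refine ⟨?_, rfl⟩
    rw [Function.mem_support]
    have := gegenbauerCoeff_pos hd (le_refl (K + 2))
    positivity
  have main : ∀ lam : ℝ, 0 < lam →
      2 * crossedResidue d (K + 2) R μ ≤ lam * crossedResidue d K R μ := by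
    intro lam hl
    have l1 := (hlim (K + 2) (by omega) h2).const_mul 2
    have l2 := ((hlim K le_rfl H.even).const_mul lam).add
      ((hlim (K + 4) (by omega) h4).const_mul lam⁻¹)
    rw [hw4, mul_zero, add_zero] at l2
    refine le_of_tendsto_of_tendsto l1 l2 ?_
    have hev : ∀ᶠ z in 𝓝[<] (1 : ℝ), z ∈ Set.Ioi (0 : ℝ) :=
      mem_nhdsWithin_of_mem_nhds (Ioi_mem_nhds one_pos)
    filter_upwards [hev, self_mem_nhdsWithin] with z hz0 hz1
    have hz0 : 0 < z := hz0
    have hz1 : z < 1 := hz1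
    have i0 := (H.integrableOn_dispersionKernel le_rfl H.even hR (t K le_rfl H.even) hz0.le hz1).1
    have i2 := (H.integrableOn_dispersionKernel (by omega) h2 hR (t _ (by omega) h2) hz0.le hz1).1
    have i4 := (H.integrableOn_dispersionKernel (by omega) h4 hR (t _ (by omega) h4) hz0.le hz1).1
    have := setIntegral_mono_on (i2.const_mul 2) ((i0.const_mul lam).add (i4.const_mul lam⁻¹)) hset
      fun ω (hω : R < ω.2) => dispersionKernel_convex hd H.even (by positivity) hl (hR.trans hω)
    rw [integral_const_mul, integral_add' (i0.const_mul lam) (i4.const_mul lam⁻¹),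
      integral_const_mul, integral_const_mul] at this
    have := mul_le_mul_of_nonneg_left this (sub_nonneg.2 hz1.le)
    linarith
  have h5 := main (crossedResidue d (K + 2) R μ / (crossedResidue d K R μ + 1)) (by positivity)
  have h6 : crossedResidue d (K + 2) R μ / (crossedResidue d K R μ + 1) * crossedResidue d K R μ ≤
      crossedResidue d (K + 2) R μ := by
    rw [div_mul_eq_mul_div, div_le_iff₀ (by positivity)]
    nlinarith
  linarith

end SumRules

/-! ### The low-energy expansion -/

/-- Cauchy's estimate for the coefficients of a polynomial. -/
lemma norm_coeff_le_of_norm_eval_le (p : Polynomial ℂ) {M : ℝ}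
    (hM : ∀ z : ℂ, ‖z‖ = 1 → ‖p.eval z‖ ≤ M) (n : ℕ) : ‖p.coeff n‖ ≤ M := by
  have hder : ∀ (n : ℕ), iteratedDeriv n (fun z => p.eval z) =
      fun z => (Polynomial.derivative^[n] p).eval z := by
    intro n
    induction n with
    | zero => simp
    | succ n ih =>
      rw [iteratedDeriv_succ, ih, Function.iterate_succ_apply']
      funext z
      exact Polynomial.deriv _
  have h := Complex.norm_iteratedDeriv_le_of_forall_mem_sphere_norm_le (c := 0) (R := 1) (C := M)
    (f := fun z => p.eval z) n one_pos (Polynomial.differentiable p).diffContOnCl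
    (fun z hz => hM z (by simpa using hz))
  rw [hder] at h
  simp only at h
  rw [← Polynomial.coeff_zero_eq_eval_zero, Polynomial.coeff_iterate_derivative, zero_add,
    Nat.descFactorial_self, nsmul_eq_mul, norm_mul, Complex.norm_natCast, one_pow, div_one] at h
  exact le_of_mul_le_mul_left h (by positivity)

/-- A bound for a polynomial on some disc bounds its coefficients, at a rate exponential in
the degree. -/
lemma norm_coeff_le_of_norm_eval_le_on_ball (z₀ : ℂ) {ρ : ℝ} (hρ : 0 < ρ) :
    ∃ Q : ℝ, 0 < Q ∧ ∀ (p : Polynomial ℂ) (k : ℕ) (M : ℝ), p.natDegree ≤ k →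
      (∀ z, ‖z - z₀‖ ≤ ρ → ‖p.eval z‖ ≤ M) → ∀ n, ‖p.coeff n‖ ≤ M * Q ^ k := by
  set T : ℝ := max 1 ((1 + ‖z₀‖) / ρ) with hT
  have hT1 : 1 ≤ T := le_max_left _ _
  refine ⟨2 * T, by linarith, fun p k M hp hM n => ?_⟩
  have hM0 : 0 ≤ M := (norm_nonneg _).trans (hM z₀ (by simpa using hρ.le))
  have hρ' : (ρ : ℂ) ≠ 0 := by exact_mod_cast hρ.ne'
  set q : Polynomial ℂ := p.comp (Polynomial.C z₀ + Polynomial.C (ρ : ℂ) * Polynomial.X) with hq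
  have hqdeg : q.natDegree ≤ k := by
    refine Polynomial.natDegree_comp_le.trans ?_
    calc _ ≤ k * 1 := Nat.mul_le_mul hp (by
          refine (Polynomial.natDegree_add_le _ _).trans ?_
          simpa using (Polynomial.natDegree_C_mul_le _ _).trans Polynomial.natDegree_X_le)
      _ = k := mul_one k
  have hqc : ∀ i, ‖q.coeff i‖ ≤ M := by
    refine norm_coeff_le_of_norm_eval_le q fun z hz => ?_
    rw [hq, Polynomial.eval_comp]
    refine hM _ ?_
    simp [hz, abs_of_pos hρ]
  refine (norm_coeff_le_of_norm_eval_le p (M := M * (2 * T) ^ k) fun z hz => ?_) n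
  have h1 : p.eval z = q.eval ((z - z₀) / ρ) := by
    rw [hq, Polynomial.eval_comp]
    congr 1
    simp only [Polynomial.eval_add, Polynomial.eval_C, Polynomial.eval_mul, Polynomial.eval_X]
    field_simp
    ring
  have h2 : ‖(z - z₀) / (ρ : ℂ)‖ ≤ T := by
    rw [norm_div, Complex.norm_real, Real.norm_of_nonneg hρ.le]
    refine le_trans ?_ (le_max_right _ _)
    gcongr
    exact (norm_sub_le _ _).trans (by rw [hz])
  rw [h1, Polynomial.eval_eq_sum_range' (Nat.lt_succ_of_le hqdeg)]
  refine (norm_sum_le _ _).trans ?_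
  calc ∑ i ∈ Finset.range (k + 1), ‖q.coeff i * ((z - z₀) / ρ) ^ i‖
      ≤ ∑ i ∈ Finset.range (k + 1), M * T ^ k := by
        refine Finset.sum_le_sum fun i hi => ?_
        rw [norm_mul, norm_pow]
        refine mul_le_mul (hqc i) ?_ (by positivity) hM0
        exact (pow_le_pow_left₀ (norm_nonneg _) h2 i).trans
          (pow_le_pow_right₀ hT1 (Nat.lt_succ_iff.1 (Finset.mem_range.1 hi)))
    _ = M * ((k + 1) * T ^ k) := by
        rw [Finset.sum_const, Finset.card_range, nsmul_eq_mul]; push_cast; ring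
    _ ≤ M * (2 * T) ^ k := by
        rw [mul_pow]
        gcongr
        have : k + 1 ≤ 2 ^ k := Nat.lt_two_pow_self
        exact_mod_cast this

/-- Homogeneous polynomials which are bounded pointwise on a disc have coefficients of at most
exponential growth, by Baire's theorem. -/
lemma exists_norm_coeff_le {p : ℕ → Polynomial ℂ} (hdeg : ∀ k, (p k).natDegree ≤ k) {r : ℝ}
    {z₀ : ℂ} {ρ : ℝ} (hr : 0 < r) (hρ : 0 < ρ)
    (hb : ∀ z ∈ Metric.ball z₀ ρ, ∃ C : ℝ, ∀ k, r ^ k * ‖(p k).eval z‖ ≤ C) :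
    ∃ C Q : ℝ, 0 < Q ∧ ∀ k n, ‖(p k).coeff n‖ ≤ C * Q ^ k := by
  let F : ℕ → Set ℂ := fun N => (Metric.ball z₀ ρ)ᶜ ∪ ⋂ k, {z | r ^ k * ‖(p k).eval z‖ ≤ N}
  have hF : ∀ N, IsClosed (F N) := by
    intro N
    refine Metric.isOpen_ball.isClosed_compl.union (isClosed_iInter fun k => ?_)
    exact isClosed_le (continuous_const.mul (p k).continuous.norm) continuous_const
  have hU : ⋃ N, F N = Set.univ := by
    refine Set.eq_univ_of_forall fun z => ?_
    by_cases hz : z ∈ Metric.ball z₀ ρ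
    · obtain ⟨C, hC⟩ := hb z hz
      obtain ⟨N, hN⟩ := exists_nat_ge C
      exact Set.mem_iUnion.2 ⟨N, Or.inr (Set.mem_iInter.2 fun k => (hC k).trans hN)⟩
    · exact Set.mem_iUnion.2 ⟨0, Or.inl hz⟩
  have hd := dense_iUnion_interior_of_closed hF hU
  obtain ⟨z₁, hz₁, hz₁'⟩ := hd.inter_open_nonempty _ Metric.isOpen_ball ⟨z₀, Metric.mem_ball_self hρ⟩
  obtain ⟨N, hN⟩ := Set.mem_iUnion.1 hz₁'
  obtain ⟨ρ', hρ', hsub⟩ := Metric.isOpen_iff.1 (Metric.isOpen_ball.inter isOpen_interior)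
    z₁ ⟨hz₁, hN⟩
  obtain ⟨Q, hQ, h⟩ := norm_coeff_le_of_norm_eval_le_on_ball z₁ (half_pos hρ')
  refine ⟨N, r⁻¹ * Q, by positivity, fun k n => ?_⟩
  have := h (p k) k (N * (r⁻¹) ^ k) (hdeg k) (fun z hz => ?_) n
  · rw [mul_pow]; linarith
  · have hz' : z ∈ Metric.ball z₁ ρ' := by
      rw [Metric.mem_ball, dist_eq_norm]; linarith
    obtain ⟨h1, h2⟩ := hsub hz'
    rcases interior_subset h2 with h3 | h3
    · exact absurd h1 h3
    · have h4 := Set.mem_iInter.1 h3 k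
      rw [inv_pow, ← div_eq_mul_inv, le_div_iff₀ (by positivity), mul_comm]
      exact h4

lemma hasSum_zero_of_real {y : ℕ → ℂ} {δ : ℝ} (hδ : 0 < δ)
    (h : ∀ u : ℝ, -δ < u → u < 0 → HasSum (fun n => y n * (u : ℂ) ^ n) 0) : ∀ n, y n = 0 := by
  intro n
  have ht : Tendsto (fun u : ℝ => (0 : ℝ) / u ^ n) (𝓝[<] 0) (𝓝 0) := by
    simp only [zero_div]; exact tendsto_const_nhds
  apply Complex.ext
  · refine coeff_eq_zero_of_tendsto hδ (y := fun n => (y n).re) (Y := fun _ => 0) (fun u hu hu0 => ?_)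
      ht n le_rfl
    have := Complex.hasSum_re (h u hu hu0)
    simpa [← Complex.ofReal_pow] using this
  · refine coeff_eq_zero_of_tendsto hδ (y := fun n => (y n).im) (Y := fun _ => 0) (fun u hu hu0 => ?_)
      ht n le_rfl
    have := Complex.hasSum_im (h u hu hu0)
    simpa [← Complex.ofReal_pow] using this

/-- A sum over `ℕ × ℕ` can be graded by the total degree. -/
lemma hasSum_prod_of_hasSum_graded {f : ℕ × ℕ → ℂ} (hf : Summable f) {y : ℂ}
    (h : HasSum (fun k => ∑ q ∈ Finset.range (k + 1), f (k - q, q)) y) : HasSum f y := by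
  have h1 := (Finset.HasAntidiagonal.sigmaAntidiagonalEquivProd (A := ℕ)).hasSum_iff.2 hf.hasSum
  have h2 := h1.sigma fun n => hasSum_fintype _
  have h3 : (fun k => ∑ q ∈ Finset.range (k + 1), f (k - q, q)) = fun n =>
      ∑ b : Finset.HasAntidiagonal.antidiagonal n, (f ∘ Finset.HasAntidiagonal.sigmaAntidiagonalEquivProd)
        ⟨n, b⟩ := by
    funext n
    rw [← Finset.Nat.sum_antidiagonal_eq_sum_range_succ (fun a b => f (b, a))]
    refine (Finset.Nat.sum_antidiagonal_swap (f := f) (n := n)).trans ?_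
    exact (Finset.sum_coe_sort (Finset.HasAntidiagonal.antidiagonal n) f).symm
  rw [h3] at h
  rw [h.unique h2]
  exact hf.hasSum

namespace Spectrum

lemma masslessAmplitude_comm (S : Spectrum) (s u : ℂ) :
    S.masslessAmplitude s u = S.masslessAmplitude u s := by
  unfold masslessAmplitude
  congr 1
  refine Finset.sum_congr rfl fun j _ => ?_
  rw [add_comm u s]
  ring

lemma masslessAmplitude_cross (S : Spectrum) (s u : ℂ) :
    S.masslessAmplitude (-(s + u)) u = S.masslessAmplitude s u := by
  unfold masslessAmplitude
  congr 1
  refine Finset.sum_congr rfl fun j _ => ?_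
  rw [show -(-(s + u) + u) = s by ring]
  ring

lemma IsAdmissible.mass_pos {S : Spectrum} (hS : S.IsAdmissible) {n : ℕ}
    (hn : S.IsMassiveLevel n) : 0 < S.mass n := by
  rw [← hS.mass_zero]; exact hS.mass_lt_mass 0 n hn.1 hn.2

lemma isLevel_of_le {S : Spectrum} {p n : ℕ} (h : p ≤ n) (hn : S.IsLevel n) : S.IsLevel p :=
  le_trans (by exact_mod_cast h) hn

lemma IsAdmissible.sq_mass_lt_cutoff {S : Spectrum} (hS : S.IsAdmissible) {n : ℕ}
    (hn : S.IsMassiveLevel n) : ENNReal.ofReal (S.mass n ^ 2) < S.cutoff ^ 2 := by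
  rw [ENNReal.ofReal_pow (hS.mass_pos hn).le]
  exact (ENNReal.pow_lt_pow_left_iff two_ne_zero).2 (hS.mass_lt_cutoff n hn.2)

lemma IsAdmissible.mass_le_mass {S : Spectrum} (hS : S.IsAdmissible) {p n : ℕ} (h : p ≤ n)
    (hn : S.IsLevel n) : S.mass p ≤ S.mass n := by
  rcases h.lt_or_eq with h | rfl
  · exact (hS.mass_lt_mass p n h hn).le
  · exact le_rfl

lemma IsAdmissible.belowThresholds {S : Spectrum} (hS : S.IsAdmissible) (h1 : S.IsMassiveLevel 1)
    {z : ℂ} (hz : ‖z‖ < S.mass 1 ^ 2) : S.BelowThresholds z := by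
  refine ⟨fun n hn => hz.trans_le ?_, ?_⟩
  · exact pow_le_pow_left₀ (hS.mass_pos h1).le (hS.mass_le_mass hn.1 hn.2) 2
  · exact (ENNReal.ofReal_le_ofReal hz.le).trans_lt (hS.sq_mass_lt_cutoff h1)

end Spectrum

/-- The double power series `∑ c k q * s ^ k * u ^ q` of the amplitude without its massless poles
converges absolutely for `‖s‖, ‖u‖ ≤ η`. -/
structure IsLowEnergySeries (A : ℂ → ℂ → ℂ) (S : Spectrum) (c : ℕ → ℕ → ℂ) (η : ℝ) : Prop where
  pos : 0 < η
  symm : ∀ k q, c k q = c q k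
  summable : Summable (fun p : ℕ × ℕ => ‖c p.1 p.2‖ * η ^ p.1 * η ^ p.2)
  hasSum : ∀ s u : ℂ, ‖s‖ ≤ η → ‖u‖ ≤ η → s ≠ 0 → u ≠ 0 → s + u ≠ 0 →
    HasSum (fun p : ℕ × ℕ => c p.1 p.2 * s ^ p.1 * u ^ p.2) (A s u - S.masslessAmplitude s u)

lemma exists_isLowEnergySeries {A : ℂ → ℂ → ℂ} {S : Spectrum} (hS : S.IsAdmissible)
    (h1 : S.IsMassiveLevel 1) (hc : CrossingSymmetric A) (hl : LowEnergyExpansion A S) :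
    ∃ c η, IsLowEnergySeries A S c η := by
  obtain ⟨a, ha⟩ := hl
  set μ := S.mass 1 ^ 2 with hμ
  have hμ0 : 0 < μ := pow_pos (hS.mass_pos h1) 2
  have ha' : ∀ s u : ℂ, s ≠ 0 → u ≠ 0 → s + u ≠ 0 → ‖s‖ < μ → ‖u‖ < μ → ‖s + u‖ < μ →
      HasSum (fun k => ∑ q ∈ Finset.range (k + 1), a k q * s ^ (k - q) * u ^ q)
        (A s u - S.masslessAmplitude s u) := fun s u hs hu hsu h2 h3 h4 =>
    ha s u hs hu hsu (hS.belowThresholds h1 h2) (hS.belowThresholds h1 h3)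
      (hS.belowThresholds h1 h4)
  let p : ℕ → Polynomial ℂ := fun k =>
    ∑ q ∈ Finset.range (k + 1), Polynomial.monomial (k - q) (a k q)
  have hpe : ∀ k z, (p k).eval z = ∑ q ∈ Finset.range (k + 1), a k q * z ^ (k - q) := by
    intro k z
    simp [p, Polynomial.eval_finsetSum]
  have hpc : ∀ k q, q ≤ k → (p k).coeff (k - q) = a k q := by
    intro k q hq
    simp only [p, Polynomial.finsetSum_coeff, Polynomial.coeff_monomial]
    rw [Finset.sum_eq_single q]
    · simp
    · intro b hb hbq
      rw [if_neg]
      have := Finset.mem_range.1 hb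
      omega
    · intro h; exact absurd (Finset.mem_range.2 (by omega)) h
  have hpd : ∀ k, (p k).natDegree ≤ k := fun k =>
    Polynomial.natDegree_sum_le_of_forall_le _ _ fun q _ =>
      (Polynomial.natDegree_monomial_le _).trans (Nat.sub_le _ _)
  -- the graded terms along a ray
  have hray : ∀ (l z : ℂ) k, ∑ q ∈ Finset.range (k + 1), a k q * (l * z) ^ (k - q) * l ^ q =
      (p k).eval z * l ^ k := by
    intro l z k
    rw [hpe, Finset.sum_mul]
    refine Finset.sum_congr rfl fun q hq => ?_
    have : l ^ k = l ^ (k - q) * l ^ q := by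
      rw [← pow_add, Nat.sub_add_cancel (Nat.lt_succ_iff.1 (Finset.mem_range.1 hq))]
    rw [this, mul_pow]
    ring
  have hbound : ∃ C Q : ℝ, 0 < Q ∧ ∀ k n, ‖(p k).coeff n‖ ≤ C * Q ^ k := by
    refine exists_norm_coeff_le hpd (r := μ / 3) (z₀ := 1) (ρ := 1 / 2) (by positivity) (by norm_num)
      fun z hz => ?_
    rw [Metric.mem_ball, dist_eq_norm] at hz
    have hz2 : ‖z‖ < 2 := by
      calc ‖z‖ = ‖(z - 1) + 1‖ := by ring_nf
        _ ≤ ‖z - 1‖ + 1 := by simpa using norm_add_le (z - 1) 1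
        _ < 2 := by linarith
    have hz0 : z ≠ 0 := by
      rintro rfl
      norm_num at hz
    have hz1 : z + 1 ≠ 0 := by
      intro h
      rw [show z - 1 = -2 by linear_combination h] at hz
      norm_num at hz
    have hz3 : ‖z + 1‖ < 3 := by
      have := norm_add_le z 1
      rw [norm_one] at this
      linarith
    set l : ℂ := ((μ / 3 : ℝ) : ℂ) with hl
    have hl0 : l ≠ 0 := by
      rw [hl]; exact_mod_cast (by positivity : μ / 3 ≠ 0)
    have hln : ‖l‖ = μ / 3 := by rw [hl, Complex.norm_real, Real.norm_of_nonneg (by positivity)]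
    have h3 := (ha' (l * z) l (mul_ne_zero hl0 hz0) hl0
      (by rw [show l * z + l = l * (z + 1) by ring]; exact mul_ne_zero hl0 hz1)
      (by rw [norm_mul, hln]; nlinarith) (by rw [hln]; linarith)
      (by rw [show l * z + l = l * (z + 1) by ring, norm_mul, hln]; nlinarith)).summable
    simp only [hray] at h3
    obtain ⟨B, hB⟩ := h3.tendsto_atTop_zero.norm.bddAbove_range
    refine ⟨B, fun k => ?_⟩
    have := hB ⟨k, rfl⟩
    simpa [norm_mul, hln, mul_comm] using this
  obtain ⟨C, Q, hQ, hCQ⟩ := hbound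
  have hak : ∀ k q, q ≤ k → ‖a k q‖ ≤ C * Q ^ k := fun k q hq => by
    rw [← hpc k q hq]; exact hCQ _ _
  -- crossing symmetry of the coefficients
  have hsymm : ∀ k q, q ≤ k → a k q = a k (k - q) := by
    let p' : ℕ → Polynomial ℂ := fun k =>
      ∑ q ∈ Finset.range (k + 1), Polynomial.monomial q (a k q)
    have hpe' : ∀ k z, (p' k).eval z = ∑ q ∈ Finset.range (k + 1), a k q * z ^ q := by
      intro k z
      simp [p', Polynomial.eval_finsetSum]
    have hpc' : ∀ k q, q ≤ k → (p' k).coeff q = a k q := by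
      intro k q hq
      simp only [p', Polynomial.finsetSum_coeff, Polynomial.coeff_monomial]
      rw [Finset.sum_ite_eq', if_pos (Finset.mem_range.2 (by omega))]
    have hray' : ∀ (l z : ℂ) k, ∑ q ∈ Finset.range (k + 1), a k q * l ^ (k - q) * (l * z) ^ q =
        (p' k).eval z * l ^ k := by
      intro l z k
      rw [hpe', Finset.sum_mul]
      refine Finset.sum_congr rfl fun q hq => ?_
      have : l ^ k = l ^ (k - q) * l ^ q := by
        rw [← pow_add, Nat.sub_add_cancel (Nat.lt_succ_iff.1 (Finset.mem_range.1 hq))]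
      rw [this, mul_pow]
      ring
    have heq : ∀ k, p k = p' k := by
      intro k
      refine Polynomial.eq_of_infinite_eval_eq _ _ (Set.Infinite.mono (s :=
        (fun x : ℝ => (x : ℂ)) '' Set.Ioo 0 1) ?_ ?_)
      · rintro _ ⟨z, ⟨hz0, hz1⟩, rfl⟩
        have h5 : ∀ n, (p n).eval (z : ℂ) - (p' n).eval (z : ℂ) = 0 := by
          refine hasSum_zero_of_real (δ := μ / 2) (by positivity) fun u hu hu0 => ?_
          have hu0' : (u : ℂ) ≠ 0 := by exact_mod_cast hu0.ne
          have hz0' : (z : ℂ) ≠ 0 := by exact_mod_cast hz0.ne'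
          have hz1' : (z : ℂ) + 1 ≠ 0 := by exact_mod_cast (by linarith : z + 1 ≠ 0)
          have e : (u : ℂ) * z + u = u * (z + 1) := by ring
          have n1 : ‖(u : ℂ)‖ < μ / 2 := by
            rw [Complex.norm_real, Real.norm_of_nonpos hu0.le]; linarith
          have n2 : ‖(u : ℂ) * z‖ < μ := by
            rw [norm_mul, Complex.norm_real z, Real.norm_of_nonneg hz0.le]
            nlinarith [norm_nonneg (u : ℂ)]
          have n3 : ‖(u : ℂ) * (z + 1)‖ < μ := by
            have : ‖(z : ℂ) + 1‖ ≤ 2 := by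
              refine (norm_add_le _ _).trans ?_
              rw [Complex.norm_real z, Real.norm_of_nonneg hz0.le, norm_one]; linarith
            rw [norm_mul]
            nlinarith [norm_nonneg (u : ℂ)]
          have t1 := ha' (u * z) u (mul_ne_zero hu0' hz0') hu0' (by rw [e]; exact mul_ne_zero hu0' hz1')
            n2 (by linarith) (by rw [e]; exact n3)
          have t2 := ha' u (u * z) hu0' (mul_ne_zero hu0' hz0')
            (by rw [add_comm, e]; exact mul_ne_zero hu0' hz1')
            (by linarith) n2 (by rw [add_comm, e]; exact n3)
          simp only [hray] at t1
          simp only [hray'] at t2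
          have e2 : A (u * z) u - S.masslessAmplitude (u * z) u =
              A u (u * z) - S.masslessAmplitude u (u * z) := by
            rw [S.masslessAmplitude_comm, (hc (u * z) (-(u * z) - u) u (by ring)).2.2.1]
          rw [e2] at t1
          have t3 := t1.sub t2
          simpa only [sub_mul, sub_self] using t3
        exact sub_eq_zero.1 (h5 k)
      · exact (Set.Ioo_infinite one_pos).image Complex.ofReal_injective.injOn
    intro k q hq
    rw [← hpc k q hq, heq, hpc' k (k - q) (Nat.sub_le _ _)]
  set η : ℝ := min (μ / 3) (1 / (2 * Q)) with hη
  have hη0 : 0 < η := lt_min (by positivity) (by positivity)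
  have hημ : η ≤ μ / 3 := min_le_left _ _
  have hηQ : Q * η ≤ 1 / 2 := by
    have : η ≤ 1 / (2 * Q) := min_le_right _ _
    calc Q * η ≤ Q * (1 / (2 * Q)) := by gcongr
      _ = 1 / 2 := by field_simp
  have hsum : Summable (fun p : ℕ × ℕ => ‖a (p.1 + p.2) p.2‖ * η ^ p.1 * η ^ p.2) := by
    have h6 : Summable (fun p : ℕ × ℕ => C * ((1 / 2 : ℝ) ^ p.1 * (1 / 2 : ℝ) ^ p.2)) :=
      (summable_geometric_two.mul_of_nonneg summable_geometric_two (fun _ => by positivity)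
        (fun _ => by positivity)).mul_left C
    refine Summable.of_nonneg_of_le (fun p => by positivity) (fun p => ?_) h6
    have hC0 : 0 ≤ C := by
      have := (norm_nonneg _).trans (hak 0 0 le_rfl)
      simpa using this
    calc ‖a (p.1 + p.2) p.2‖ * η ^ p.1 * η ^ p.2 ≤ C * Q ^ (p.1 + p.2) * η ^ p.1 * η ^ p.2 := by
          gcongr; exact hak _ _ (by omega)
      _ = C * ((Q * η) ^ p.1 * (Q * η) ^ p.2) := by rw [pow_add, mul_pow, mul_pow]; ring
      _ ≤ _ := by gcongr
  refine ⟨fun k q => a (k + q) q, η, hη0, fun k q => ?_, hsum, fun s u hs hu hs0 hu0 hsu => ?_⟩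
  · rw [hsymm (k + q) q (by omega), Nat.add_sub_cancel, add_comm]
  · refine hasSum_prod_of_hasSum_graded ?_ ?_
    · refine Summable.of_norm_bounded hsum fun p => ?_
      rw [norm_mul, norm_mul, norm_pow, norm_pow]
      gcongr
    · have hsu' : ‖s + u‖ < μ := (norm_add_le _ _).trans_lt (by linarith)
      have := ha' s u hs0 hu0 hsu (by linarith) (by linarith) hsu'
      refine (congrArg (fun f => HasSum f _) (funext fun k => ?_)).mpr this
      refine Finset.sum_congr rfl fun q hq => ?_
      rw [Nat.sub_add_cancel (Nat.lt_succ_iff.1 (Finset.mem_range.1 hq))]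

/-! ### Cauchy's theorem in the upper half-plane -/

/-- The integral of `F` along the upper half of the circle of radius `R` around `0`,
counterclockwise. -/
noncomputable def archIntegral (F : ℂ → ℂ) (R : ℝ) : ℂ :=
  ∫ θ in (0 : ℝ)..Real.pi, F (circleMap 0 R θ) * (circleMap 0 R θ * Complex.I)

lemma im_circleMap_zero (R θ : ℝ) : (circleMap 0 R θ).im = R * Real.sin θ := by
  simp [circleMap, Complex.exp_im]

lemma norm_archIntegral_le {F : ℂ → ℂ} {R M : ℝ} (hR : 0 < R)
    (hM : ∀ w, ‖w‖ = R → 0 < w.im → ‖F w‖ ≤ M) : ‖archIntegral F R‖ ≤ Real.pi * R * M := by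
  have h := intervalIntegral.norm_integral_le_of_norm_le_const_ae (a := 0) (b := Real.pi)
    (f := fun θ => F (circleMap 0 R θ) * (circleMap 0 R θ * Complex.I)) (C := M * R) ?_
  · refine h.trans (le_of_eq ?_)
    rw [sub_zero, abs_of_pos Real.pi_pos]
    ring
  · have : ∀ᵐ θ : ℝ, θ ≠ Real.pi := by simp [ae_iff, measure_singleton]
    filter_upwards [this] with θ hθ hmem
    rw [Set.uIoc_of_le Real.pi_pos.le] at hmem
    have hn : ‖circleMap 0 R θ‖ = R := by simp [abs_of_pos hR]
    rw [norm_mul, norm_mul, hn, Complex.norm_I, mul_one]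
    refine mul_le_mul_of_nonneg_right (hM _ hn ?_) hR.le
    rw [im_circleMap_zero]
    exact mul_pos hR (Real.sin_pos_of_pos_of_lt_pi hmem.1 (lt_of_le_of_ne hmem.2 hθ))

lemma tendsto_archIntegral {ι : Type*} {l : Filter ι} [l.IsCountablyGenerated] {F : ι → ℂ → ℂ}
    {F₀ : ℂ → ℂ} {R M : ℝ} (hR : 0 < R)
    (hc : ∀ᶠ i in l, ∀ w, ‖w‖ = R → 0 ≤ w.im → ContinuousAt (F i) w)
    (hM : ∀ᶠ i in l, ∀ w, ‖w‖ = R → 0 ≤ w.im → ‖F i w‖ ≤ M)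
    (hl : ∀ w, ‖w‖ = R → 0 ≤ w.im → Tendsto (fun i => F i w) l (𝓝 (F₀ w))) :
    Tendsto (fun i => archIntegral (F i) R) l (𝓝 (archIntegral F₀ R)) := by
  have hn : ∀ θ, ‖circleMap 0 R θ‖ = R := fun θ => by simp [abs_of_pos hR]
  have him : ∀ θ ∈ Set.uIoc 0 Real.pi, 0 ≤ (circleMap 0 R θ).im := by
    intro θ hθ
    rw [Set.uIoc_of_le Real.pi_pos.le] at hθ
    rw [im_circleMap_zero]
    exact mul_nonneg hR.le (Real.sin_nonneg_of_nonneg_of_le_pi hθ.1.le hθ.2)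
  refine intervalIntegral.tendsto_integral_filter_of_dominated_convergence (fun _ => M * R)
    ?_ ?_ intervalIntegrable_const ?_
  · filter_upwards [hc] with i hi
    refine ContinuousOn.aestronglyMeasurable (fun θ hθ => ?_) measurableSet_uIoc
    refine ContinuousAt.continuousWithinAt ?_
    exact (ContinuousAt.comp (f := circleMap 0 R) (hi _ (hn θ) (him θ hθ))
      (continuous_circleMap 0 R).continuousAt).mul
      ((continuous_circleMap 0 R).continuousAt.mul continuousAt_const)
  · filter_upwards [hM] with i hi
    refine Eventually.of_forall fun θ hθ => ?_
    rw [norm_mul, norm_mul, hn, Complex.norm_I, mul_one]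
    exact mul_le_mul_of_nonneg_right (hi _ (hn θ) (him θ hθ)) hR.le
  · exact Eventually.of_forall fun θ hθ => (hl _ (hn θ) (him θ hθ)).mul_const _

lemma archIntegral_congr {F G : ℂ → ℂ} {R : ℝ} (hR : 0 < R)
    (h : ∀ w, ‖w‖ = R → 0 < w.im → F w = G w) : archIntegral F R = archIntegral G R := by
  refine intervalIntegral.integral_congr_ae ?_
  have : ∀ᵐ θ : ℝ, θ ≠ Real.pi := by simp [ae_iff, measure_singleton]
  filter_upwards [this] with θ hθ hmem
  rw [Set.uIoc_of_le Real.pi_pos.le] at hmem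
  rw [h _ (by simp [abs_of_pos hR])]
  rw [im_circleMap_zero]
  exact mul_pos hR (Real.sin_pos_of_pos_of_lt_pi hmem.1 (lt_of_le_of_ne hmem.2 hθ))

/-- Cauchy's theorem in a half-annulus, obtained from a rectangle by the exponential map. -/
lemma integral_add_comp_neg_eq_archIntegral_sub {F : ℂ → ℂ} {r R : ℝ} (hr : 0 < r) (hrR : r ≤ R)
    (hF : ∀ w : ℂ, r ≤ ‖w‖ → ‖w‖ ≤ R → 0 ≤ w.im → DifferentiableAt ℂ F w) :
    (∫ x in r..R, (F x + F (-x))) = archIntegral F r - archIntegral F R := by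
  have hR : 0 < R := hr.trans_le hrR
  have hlog : Real.log r ≤ Real.log R := Real.log_le_log hr hrR
  have hmem : ∀ x ∈ Set.uIcc r R, r ≤ x ∧ x ≤ R := fun x hx => by
    rwa [Set.uIcc_of_le hrR] at hx
  have h := Complex.integral_boundary_rect_eq_zero_of_differentiableOn
    (fun ζ => F (Complex.exp ζ) * Complex.exp ζ) (Real.log r : ℂ) (Real.log R + Real.pi * Complex.I)
    (fun ζ hζ => by
      rw [Complex.mem_reProdIm] at hζ
      simp only [Complex.ofReal_re, Complex.ofReal_im, Complex.add_re, Complex.add_im,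
        Complex.mul_re, Complex.mul_im, Complex.I_re, Complex.I_im] at hζ
      simp only [mul_zero, sub_zero, add_zero, mul_one, zero_add] at hζ
      rw [Set.uIcc_of_le hlog, Set.uIcc_of_le Real.pi_pos.le] at hζ
      have hnorm : ‖Complex.exp ζ‖ = Real.exp ζ.re := Complex.norm_exp ζ
      have h1 : DifferentiableAt ℂ F (Complex.exp ζ) := by
        refine hF _ ?_ ?_ ?_
        · rw [hnorm, ← Real.log_le_iff_le_exp hr]; exact hζ.1.1
        · rw [hnorm, ← Real.le_log_iff_exp_le hR]; exact hζ.1.2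
        · rw [Complex.exp_im]
          exact mul_nonneg (Real.exp_pos _).le (Real.sin_nonneg_of_nonneg_of_le_pi hζ.2.1 hζ.2.2)
      exact ((h1.comp ζ Complex.differentiableAt_exp).mul
        Complex.differentiableAt_exp).differentiableWithinAt)
  simp only [Complex.ofReal_re, Complex.ofReal_im, Complex.add_re, Complex.add_im,
        Complex.mul_re, Complex.mul_im, Complex.I_re, Complex.I_im] at h
  simp only [mul_zero, sub_zero, add_zero, mul_one, zero_add, zero_mul, Complex.ofReal_zero] at h
  have hside : ∀ ρ : ℝ, 0 < ρ → Complex.I • (∫ y in (0 : ℝ)..Real.pi,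
      F (Complex.exp (Real.log ρ + y * Complex.I)) * Complex.exp (Real.log ρ + y * Complex.I)) =
      archIntegral F ρ := by
    intro ρ hρ
    rw [archIntegral, ← intervalIntegral.integral_smul]
    refine intervalIntegral.integral_congr fun y _ => ?_
    have : Complex.exp (Real.log ρ + y * Complex.I) = circleMap 0 ρ y := by
      rw [Complex.exp_add, ← Complex.ofReal_exp, Real.exp_log hρ, circleMap, zero_add]
    simp only [this, smul_eq_mul]
    ring
  rw [hside R hR, hside r hr, ← intervalIntegral.integral_sub] at h
  · have hsub : (∫ x in r..R, (F x + F (-x))) = ∫ x in Real.log r..Real.log R,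
        (F (Complex.exp x) * Complex.exp x - F (Complex.exp (x + Real.pi * Complex.I)) *
          Complex.exp (x + Real.pi * Complex.I)) := by
      have h2 := intervalIntegral.integral_deriv_smul_comp' (a := Real.log r) (b := Real.log R)
        (f := Real.exp) (f' := Real.exp) (g := fun x : ℝ => F x + F (-x))
        (fun x _ => Real.hasDerivAt_exp x) Real.continuous_exp.continuousOn ?_
      · rw [Real.exp_log hr, Real.exp_log hR] at h2
        rw [← h2]
        refine intervalIntegral.integral_congr fun x _ => ?_
        simp only [Function.comp, Complex.exp_add, Complex.exp_pi_mul_I, Complex.ofReal_exp,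
          Complex.real_smul]
        rw [mul_neg_one]
        ring
      · rintro _ ⟨y, hy, rfl⟩
        rw [Set.uIcc_of_le hlog] at hy
        have hy1 : r ≤ Real.exp y := by rw [← Real.log_le_iff_le_exp hr]; exact hy.1
        have hy2 : Real.exp y ≤ R := by rw [← Real.le_log_iff_exp_le hR]; exact hy.2
        have hn : ‖((Real.exp y : ℝ) : ℂ)‖ = Real.exp y := by
          rw [Complex.norm_real, Real.norm_of_nonneg (Real.exp_pos y).le]
        refine ContinuousAt.continuousWithinAt (ContinuousAt.add ?_ ?_)
        · exact ContinuousAt.comp (f := fun x : ℝ => (x : ℂ)) (hF _ (by rw [hn]; exact hy1)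
            (by rw [hn]; exact hy2) (by simp)).continuousAt Complex.continuous_ofReal.continuousAt
        · exact ContinuousAt.comp (f := fun x : ℝ => (-x : ℂ)) (hF _ (by rw [norm_neg, hn]; exact hy1)
            (by rw [norm_neg, hn]; exact hy2)
            (by rw [Complex.neg_im, Complex.ofReal_im]; simp)).continuousAt
            Complex.continuous_ofReal.neg.continuousAt
    rw [hsub]
    linear_combination h
  all_goals
    refine ContinuousOn.intervalIntegrable fun x hx => ContinuousAt.continuousWithinAt ?_
    rw [Set.uIcc_of_le hlog] at hx
    have hy1 : r ≤ Real.exp x := by rw [← Real.log_le_iff_le_exp hr]; exact hx.1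
    have hy2 : Real.exp x ≤ R := by rw [← Real.le_log_iff_exp_le hR]; exact hx.2
    refine ContinuousAt.mul (ContinuousAt.comp (g := F) (hF _ ?_ ?_ ?_).continuousAt ?_) ?_
  · rw [Complex.norm_exp]; simpa using hy1
  · rw [Complex.norm_exp]; simpa using hy2
  · rw [Complex.exp_im]; simp
  · fun_prop
  · fun_prop
  · rw [Complex.norm_exp]; simpa using hy1
  · rw [Complex.norm_exp]; simpa using hy2
  · rw [Complex.exp_im]; simp
  · fun_prop
  · fun_prop

/-- The integral along a half-circle of an expression odd in `w` unfolds to one along the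
circle. -/
lemma archIntegral_sub_comp_neg_eq_circleIntegral {f : ℂ → ℂ} {R : ℝ} (hR : 0 < R)
    (hf : ∀ w, ‖w‖ = R → ContinuousAt f w) :
    archIntegral (fun w => f w - f (-w)) R = ∮ w in C(0, R), f w := by
  have hn : ∀ θ, ‖circleMap 0 R θ‖ = R := fun θ => by simp [abs_of_pos hR]
  set h : ℝ → ℂ := fun θ => f (circleMap 0 R θ) * (circleMap 0 R θ * Complex.I) with hh
  have hcont : Continuous h := by
    refine Continuous.mul ?_ ((continuous_circleMap 0 R).mul continuous_const)
    exact continuous_iff_continuousAt.2 fun θ =>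
      ContinuousAt.comp (g := f) (hf _ (hn θ)) (continuous_circleMap 0 R).continuousAt
  have h1 : (∮ w in C(0, R), f w) = ∫ θ in (0 : ℝ)..2 * Real.pi, h θ := by
    rw [circleIntegral]
    refine intervalIntegral.integral_congr fun θ _ => ?_
    simp only [hh, deriv_circleMap, smul_eq_mul]
    ring
  have h2 : (∫ θ in Real.pi..2 * Real.pi, h θ) = ∫ θ in (0 : ℝ)..Real.pi, h (θ + Real.pi) := by
    rw [intervalIntegral.integral_comp_add_right (f := h)]
    congr 1 <;> ring
  have h3 : IntervalIntegrable (fun θ => h (θ + Real.pi)) volume 0 Real.pi :=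
    (hcont.comp (continuous_add_const Real.pi)).intervalIntegrable _ _
  rw [h1, ← intervalIntegral.integral_add_adjacent_intervals (b := Real.pi)
    (hcont.intervalIntegrable _ _) (hcont.intervalIntegrable _ _), h2,
    ← intervalIntegral.integral_add (hcont.intervalIntegrable _ _) h3, archIntegral]
  refine intervalIntegral.integral_congr fun θ _ => ?_
  have : circleMap 0 R (θ + Real.pi) = - circleMap 0 R θ := by
    simp only [circleMap, zero_add, Complex.ofReal_add, add_mul, Complex.exp_add,
      Complex.exp_pi_mul_I]
    ring
  simp only [hh, this]
  ring

/-! ### The low-energy series on small contours -/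

/-- The sum of the double power series with coefficients `c`. -/
noncomputable def lowEnergySum (c : ℕ → ℕ → ℂ) (s u : ℂ) : ℂ :=
  ∑' p : ℕ × ℕ, c p.1 p.2 * s ^ p.1 * u ^ p.2

/-- The part of the dispersion kernel which does not depend on the spin, in the variable
`w = s + u / 2` which changes sign under the exchange of `s` and `t`. It is odd in `w`. -/
noncomputable def crossingKernel (k : ℕ) (u w : ℂ) : ℂ :=
  ((w - u / 2) ^ (k + 1))⁻¹ + (-1) ^ k * ((w + u / 2) ^ (k + 1))⁻¹

lemma crossingKernel_neg (k : ℕ) (u w : ℂ) : crossingKernel k u (-w) = -crossingKernel k u w := by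
  unfold crossingKernel
  rw [show -w - u / 2 = -(w + u / 2) by ring, show -w + u / 2 = -(w - u / 2) by ring,
    neg_pow (w + u / 2), neg_pow (w - u / 2), mul_inv, mul_inv]
  have h1 : ((-1 : ℂ) ^ (k + 1))⁻¹ = (-1) ^ (k + 1) := by
    rw [← inv_pow]; norm_num
  have h2 : (-1 : ℂ) ^ k * (-1) ^ k = 1 := by rw [← mul_pow]; norm_num
  rw [h1, pow_succ]
  linear_combination (-((w - u / 2) ^ (k + 1))⁻¹) * h2

lemma norm_half_sub_le {u w : ℂ} {r : ℝ} (hu : ‖u‖ ≤ r) (hw : r ≤ ‖w‖) :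
    r / 2 ≤ ‖w - u / 2‖ ∧ r / 2 ≤ ‖w + u / 2‖ := by
  have h1 : ‖u / 2‖ ≤ r / 2 := by
    rw [norm_div, Complex.norm_ofNat]; linarith
  constructor
  · have := norm_sub_norm_le w (u / 2); linarith
  · have := norm_sub_norm_le w (-(u / 2)); rw [norm_neg, sub_neg_eq_add] at this; linarith

lemma norm_crossingKernel_le {k : ℕ} {u w : ℂ} {r : ℝ} (hr : 0 < r) (hu : ‖u‖ ≤ r) (hw : r ≤ ‖w‖) :
    ‖crossingKernel k u w‖ ≤ 2 * (2 / r) ^ (k + 1) := by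
  have hk : ∀ z : ℂ, r / 2 ≤ ‖z‖ → ‖(z ^ (k + 1))⁻¹‖ ≤ (2 / r) ^ (k + 1) := by
    intro z hz
    rw [norm_inv, norm_pow, ← inv_pow]
    refine pow_le_pow_left₀ (by positivity) ?_ _
    rw [← inv_div]
    exact inv_anti₀ (by positivity) hz
  obtain ⟨h1, h2⟩ := norm_half_sub_le hu hw
  refine (norm_add_le _ _).trans ?_
  rw [norm_mul, norm_pow, norm_neg, norm_one, one_pow, one_mul]
  linarith [hk _ h1, hk _ h2]

lemma differentiableAt_crossingKernel {k : ℕ} {u w : ℂ} {r : ℝ} (hr : 0 < r) (hu : ‖u‖ ≤ r)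
    (hw : r ≤ ‖w‖) : DifferentiableAt ℂ (crossingKernel k u) w := by
  obtain ⟨h1, h2⟩ := norm_half_sub_le hu hw
  have e1 : w - u / 2 ≠ 0 := norm_pos_iff.1 (by linarith)
  have e2 : w + u / 2 ≠ 0 := norm_pos_iff.1 (by linarith)
  have d1 : DifferentiableAt ℂ (fun w => (w - u / 2) ^ (k + 1)) w := by fun_prop
  have d2 : DifferentiableAt ℂ (fun w => (w + u / 2) ^ (k + 1)) w := by fun_prop
  exact (d1.fun_inv (pow_ne_zero _ e1)).add ((d2.fun_inv (pow_ne_zero _ e2)).const_mul _)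

namespace IsLowEnergySeries

variable {A : ℂ → ℂ → ℂ} {S : Spectrum} {c : ℕ → ℕ → ℂ} {η : ℝ}

lemma norm_term_le (p : ℕ × ℕ) {s u : ℂ} (hs : ‖s‖ ≤ η)
    (hu : ‖u‖ ≤ η) : ‖c p.1 p.2 * s ^ p.1 * u ^ p.2‖ ≤ ‖c p.1 p.2‖ * η ^ p.1 * η ^ p.2 := by
  have hη := (norm_nonneg _).trans hs
  rw [norm_mul, norm_mul, norm_pow, norm_pow]
  gcongr

lemma hasSum_lowEnergySum (H : IsLowEnergySeries A S c η) {s u : ℂ} (hs : ‖s‖ ≤ η)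
    (hu : ‖u‖ ≤ η) :
    HasSum (fun p : ℕ × ℕ => c p.1 p.2 * s ^ p.1 * u ^ p.2) (lowEnergySum c s u) :=
  (Summable.of_norm_bounded H.summable fun p => norm_term_le p hs hu).hasSum

lemma norm_lowEnergySum_le (H : IsLowEnergySeries A S c η) {s u : ℂ} (hs : ‖s‖ ≤ η)
    (hu : ‖u‖ ≤ η) :
    ‖lowEnergySum c s u‖ ≤ ∑' p : ℕ × ℕ, ‖c p.1 p.2‖ * η ^ p.1 * η ^ p.2 :=
  tsum_of_norm_bounded H.summable.hasSum fun p => norm_term_le p hs hu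

lemma continuousAt_lowEnergySum (H : IsLowEnergySeries A S c η) {s u : ℂ} (hs : ‖s‖ < η)
    (hu : ‖u‖ ≤ η) : ContinuousAt (fun z => lowEnergySum c z u) s := by
  have h : ContinuousOn (fun z => lowEnergySum c z u) (Metric.closedBall 0 η) := by
    refine continuousOn_tsum (fun p => by fun_prop) H.summable fun p z hz => norm_term_le p ?_ hu
    simpa using hz
  exact h.continuousAt (Metric.closedBall_mem_nhds_of_mem (by simpa using hs))

lemma eq_lowEnergySum (H : IsLowEnergySeries A S c η) {s u : ℂ} (hs : ‖s‖ ≤ η) (hu : ‖u‖ ≤ η)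
    (hs0 : s ≠ 0) (hu0 : u ≠ 0) (hsu : s + u ≠ 0) :
    A s u - S.masslessAmplitude s u = lowEnergySum c s u :=
  (H.hasSum s u hs hu hs0 hu0 hsu).unique (H.hasSum_lowEnergySum hs hu)

lemma lowEnergySum_cross (H : IsLowEnergySeries A S c η) (hc : CrossingSymmetric A) {s u : ℂ}
    (hs : ‖s‖ ≤ η) (hsu' : ‖s + u‖ ≤ η) (hu : ‖u‖ ≤ η) (hs0 : s ≠ 0) (hu0 : u ≠ 0)
    (hsu : s + u ≠ 0) : lowEnergySum c (-(s + u)) u = lowEnergySum c s u := by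
  rw [← H.eq_lowEnergySum hs hu hs0 hu0 hsu, ← H.eq_lowEnergySum (by rwa [norm_neg]) hu
    (neg_ne_zero.2 hsu) hu0 (by rw [show -(s + u) + u = -s by ring]; exact neg_ne_zero.2 hs0),
    S.masslessAmplitude_cross, (hc s (-(s + u)) u (by ring)).2.2.2.1]

/-- Cauchy's formula for the coefficients in `s`, with a contour which is not centered at the
origin. -/
lemma hasSum_circleIntegral (H : IsLowEnergySeries A S c η) (k : ℕ) {u a : ℂ} {r : ℝ} (hr : 0 < r)
    (ha : ‖a‖ < r) (hra : r + ‖a‖ ≤ η) (hu : ‖u‖ ≤ η) :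
    HasSum (fun q => 2 * Real.pi * Complex.I * (c k q * u ^ q))
      (∮ w in C(0, r), lowEnergySum c (w - a) u * ((w - a) ^ (k + 1))⁻¹) := by
  have hn : ∀ θ, ‖circleMap 0 r θ‖ = r := fun θ => by simp [abs_of_pos hr]
  have hwa : ∀ θ, ‖circleMap 0 r θ - a‖ ≤ η := fun θ =>
    (norm_sub_le _ _).trans (by rw [hn]; exact hra)
  have hwa' : ∀ θ, r - ‖a‖ ≤ ‖circleMap 0 r θ - a‖ := fun θ => by
    have := norm_sub_norm_le (circleMap 0 r θ) a
    rwa [hn] at this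
  have hne : ∀ θ, circleMap 0 r θ - a ≠ 0 := fun θ =>
    norm_pos_iff.1 (lt_of_lt_of_le (by linarith) (hwa' θ))
  set D : ℝ := r * ((r - ‖a‖) ^ (k + 1))⁻¹ with hD
  have key : HasSum (fun p : ℕ × ℕ => ∮ w in C(0, r), c p.1 p.2 * (w - a) ^ p.1 * u ^ p.2 *
      ((w - a) ^ (k + 1))⁻¹)
      (∮ w in C(0, r), lowEnergySum c (w - a) u * ((w - a) ^ (k + 1))⁻¹) := by
    simp only [circleIntegral]
    refine intervalIntegral.hasSum_integral_of_dominated_convergence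
      (fun p _ => D * (‖c p.1 p.2‖ * η ^ p.1 * η ^ p.2)) (fun p => ?_) (fun p => ?_) ?_ ?_ ?_
    · refine Continuous.aestronglyMeasurable ?_
      simp only [deriv_circleMap]
      have hc := continuous_circleMap 0 r
      have c1 : Continuous fun θ => (circleMap 0 r θ - a) ^ (k + 1) := by fun_prop
      have c2 : Continuous fun θ => c p.1 p.2 * (circleMap 0 r θ - a) ^ p.1 * u ^ p.2 := by fun_prop
      exact (hc.mul continuous_const).smul (c2.mul (c1.inv₀ fun θ => pow_ne_zero _ (hne θ)))
    · refine Eventually.of_forall fun θ _ => ?_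
      rw [norm_smul, norm_mul, norm_inv, norm_pow, deriv_circleMap, norm_mul, hn, Complex.norm_I,
        mul_one, hD]
      calc _ ≤ r * (‖c p.1 p.2‖ * η ^ p.1 * η ^ p.2 * ((r - ‖a‖) ^ (k + 1))⁻¹) := by
            refine mul_le_mul_of_nonneg_left (mul_le_mul (norm_term_le p (hwa θ) hu) ?_
              (by positivity) ?_) hr.le
            · exact inv_anti₀ (pow_pos (by linarith) _)
                (pow_le_pow_left₀ (by linarith) (hwa' θ) _)
            · have := H.pos
              positivity
        _ = _ := by ring
    · exact Eventually.of_forall fun θ _ => H.summable.mul_left D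
    · exact intervalIntegrable_const
    · refine Eventually.of_forall fun θ _ => ?_
      exact ((H.hasSum_lowEnergySum (hwa θ) hu).mul_right _).const_smul _
  have hval : ∀ p : ℕ × ℕ, (∮ w in C(0, r), c p.1 p.2 * (w - a) ^ p.1 * u ^ p.2 *
      ((w - a) ^ (k + 1))⁻¹) =
      if p.1 = k then 2 * Real.pi * Complex.I * (c p.1 p.2 * u ^ p.2) else 0 := by
    intro p
    have e1 : (∮ w in C(0, r), c p.1 p.2 * (w - a) ^ p.1 * u ^ p.2 * ((w - a) ^ (k + 1))⁻¹) =
        ∮ w in C(0, r), (c p.1 p.2 * u ^ p.2) * (w - a) ^ ((p.1 : ℤ) - (k + 1)) := by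
      refine circleIntegral.integral_congr hr.le fun w hw => ?_
      have hw0 : w - a ≠ 0 := by
        rw [mem_sphere_zero_iff_norm] at hw
        rw [sub_ne_zero]
        rintro rfl
        exact ha.ne hw
      rw [zpow_sub₀ hw0, zpow_natCast, show ((k : ℤ) + 1) = ((k + 1 : ℕ) : ℤ) by push_cast; rfl,
        zpow_natCast, div_eq_mul_inv]
      ring
    rw [e1, circleIntegral.integral_const_mul]
    split_ifs with hp
    · rw [show ((p.1 : ℤ) - (k + 1)) = -1 by omega]
      simp only [zpow_neg_one]
      rw [circleIntegral.integral_sub_inv_of_mem_ball (by simpa using ha)]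
      ring
    · rw [circleIntegral.integral_sub_zpow_of_ne (by omega), mul_zero]
  simp only [hval] at key
  have hinj : Function.Injective fun q : ℕ => ((k, q) : ℕ × ℕ) := fun a b h => (Prod.mk.inj h).2
  rw [← hinj.hasSum_iff] at key
  · refine (congrArg (fun f => HasSum f _) (funext fun q => ?_)).mpr key
    simp
  · rintro ⟨p1, p2⟩ hp
    rw [if_neg]
    rintro h
    exact hp ⟨p2, by simp only at h; rw [h]⟩

/-- The expansion in `u` of a coefficient in `s`, from an integral over a half-circle. -/
lemma hasSum_archIntegral (H : IsLowEnergySeries A S c η) (hc : CrossingSymmetric A) (k : ℕ)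
    {u r : ℝ} (hr : 0 < r) (hrη : 2 * r ≤ η) (hu : -r < u) (hu0 : u < 0) :
    HasSum (fun q => 2 * Real.pi * Complex.I * (c k q * (u : ℂ) ^ q))
      (archIntegral (fun w => lowEnergySum c (w - u / 2) u * crossingKernel k u w) r) := by
  have hun : ‖(u : ℂ)‖ = -u := by rw [Complex.norm_real, Real.norm_of_nonpos hu0.le]
  have ha : ‖(u / 2 : ℂ)‖ = -u / 2 := by rw [norm_div, hun, Complex.norm_ofNat]
  have h := H.hasSum_circleIntegral k (u := u) (a := u / 2) hr (by rw [ha]; linarith)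
    (by rw [ha]; linarith) (by rw [hun]; linarith)
  have hle : ∀ w : ℂ, ‖w‖ = r → ‖w - u / 2‖ < η ∧ ‖w + u / 2‖ < η := fun w hw =>
    ⟨(norm_sub_le _ _).trans_lt (by rw [ha, hw]; linarith),
      (norm_add_le _ _).trans_lt (by rw [ha, hw]; linarith)⟩
  rw [← archIntegral_sub_comp_neg_eq_circleIntegral hr] at h
  · rw [archIntegral_congr hr (fun w hw him => ?_)]
    · exact h
    · have e1 : lowEnergySum c (-w - u / 2) u = lowEnergySum c (w - u / 2) u := by
        have := H.lowEnergySum_cross hc (s := w - u / 2) (u := u) (hle w hw).1.le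
          (by rw [show w - (u : ℂ) / 2 + u = w + u / 2 by ring]; exact (hle w hw).2.le)
          (by rw [hun]; linarith)
          (fun h => by
            have := congrArg Complex.im h
            simp at this
            linarith)
          (by exact_mod_cast hu0.ne)
          (fun h => by
            have := congrArg Complex.im h
            simp at this
            linarith)
        rw [← this]
        congr 1
        ring
      have h1 : ((-1 : ℂ) ^ (k + 1))⁻¹ = (-1) ^ (k + 1) := by
        rw [← inv_pow]; norm_num
      simp only [crossingKernel]
      rw [e1, show -w - (u : ℂ) / 2 = -(w + u / 2) by ring, neg_pow (w + (u : ℂ) / 2), mul_inv, h1,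
        pow_succ (-1 : ℂ)]
      ring
  · intro w hw
    have hne : w - u / 2 ≠ 0 := norm_pos_iff.1 (by
      have := norm_sub_norm_le w (u / 2 : ℂ)
      rw [ha, hw] at this
      linarith)
    refine ContinuousAt.mul ?_ (ContinuousAt.inv₀ (by fun_prop) (pow_ne_zero _ hne))
    exact ContinuousAt.comp (g := fun z => lowEnergySum c z u) (f := fun w : ℂ => w - u / 2)
      (H.continuousAt_lowEnergySum (hle w hw).1 (by rw [hun]; linarith)) (by fun_prop)

end IsLowEnergySeries

/-! ### The discontinuity smeared with a test function -/

/-- Where a function is continuous, its discontinuity across the real axis vanishes. -/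
lemma tendsto_integral_sub_of_continuousOn {h : ℂ → ℂ} {f : ℝ → ℂ} {a b ρ : ℝ} (hab : a ≤ b)
    (hρ : 0 < ρ) (hf : Continuous f)
    (hh : ContinuousOn h {z | (a ≤ z.re ∧ z.re ≤ b) ∧ (-ρ ≤ z.im ∧ z.im ≤ ρ)}) :
    Tendsto (fun ε : ℝ => ∫ x in a..b, f x * (h (x + ε * Complex.I) - h (x - ε * Complex.I)))
      (𝓝[>] 0) (𝓝 0) := by
  set K : Set ℂ := {z | (a ≤ z.re ∧ z.re ≤ b) ∧ (-ρ ≤ z.im ∧ z.im ≤ ρ)} with hK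
  have hKc : IsCompact K := by
    have : K = Set.Icc a b ×ℂ Set.Icc (-ρ) ρ := by
      ext z; simp [hK, Complex.mem_reProdIm]
    rw [this]
    exact isCompact_Icc.reProdIm isCompact_Icc
  obtain ⟨M, hM⟩ := hKc.exists_bound_of_continuousOn hh
  obtain ⟨N, hN⟩ := (isCompact_Icc (a := a) (b := b)).exists_bound_of_continuousOn hf.continuousOn
  have hmem : ∀ x ∈ Set.Icc a b, ∀ ε : ℝ, |ε| ≤ ρ → (x : ℂ) + ε * Complex.I ∈ K := by
    intro x hx ε hε
    have := abs_le.1 hε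
    simp only [hK, Set.mem_ofPred_eq]
    simp [hx.1, hx.2, this.1, this.2]
  have hmem' : ∀ x ∈ Set.Icc a b, ∀ ε : ℝ, |ε| ≤ ρ → (x : ℂ) - ε * Complex.I ∈ K := by
    intro x hx ε hε
    have := hmem x hx (-ε) (by rwa [abs_neg])
    rw [sub_eq_add_neg]
    simpa using this
  have hev : ∀ᶠ ε : ℝ in 𝓝[>] 0, |ε| ≤ ρ := by
    filter_upwards [Ioo_mem_nhdsGT hρ] with ε hε
    rw [abs_of_pos hε.1]; exact hε.2.le
  have hIoc : Set.uIoc a b ⊆ Set.Icc a b := by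
    rw [Set.uIoc_of_le hab]; exact Set.Ioc_subset_Icc_self
  rw [show (0 : ℂ) = ∫ x in a..b, (0 : ℂ) by simp]
  refine intervalIntegral.tendsto_integral_filter_of_dominated_convergence (fun _ => N * (M + M))
    ?_ ?_ intervalIntegrable_const ?_
  · filter_upwards [hev] with ε hε
    refine ContinuousOn.aestronglyMeasurable ?_ measurableSet_uIoc
    refine ContinuousOn.mono ?_ hIoc
    refine hf.continuousOn.mul (ContinuousOn.sub ?_ ?_)
    · exact hh.comp (by fun_prop) fun x hx => hmem x hx ε hε
    · exact hh.comp (by fun_prop) fun x hx => hmem' x hx ε hε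
  · filter_upwards [hev] with ε hε
    refine Eventually.of_forall fun x hx => ?_
    rw [norm_mul]
    have hx' := hIoc hx
    refine mul_le_mul (hN x hx') ((norm_sub_le _ _).trans (add_le_add (hM _ (hmem x hx' ε hε))
      (hM _ (hmem' x hx' ε hε)))) (norm_nonneg _) ((norm_nonneg _).trans (hN x hx'))
  · refine Eventually.of_forall fun x hx => ?_
    have hx' := hIoc hx
    have hx0 : (x : ℂ) ∈ K := by simpa using hmem x hx' 0 (by simpa using hρ.le)
    have e1 : Tendsto (fun ε : ℝ => (x : ℂ) + ε * Complex.I) (𝓝[>] 0) (𝓝[K] (x : ℂ)) := by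
      refine tendsto_nhdsWithin_iff.2 ⟨?_, by filter_upwards [hev] with ε hε using hmem x hx' ε hε⟩
      have : Continuous fun ε : ℝ => (x : ℂ) + ε * Complex.I := by fun_prop
      exact (by simpa using this.tendsto 0 : Tendsto _ (𝓝 (0 : ℝ)) (𝓝 (x : ℂ))).mono_left
        nhdsWithin_le_nhds
    have e2 : Tendsto (fun ε : ℝ => (x : ℂ) - ε * Complex.I) (𝓝[>] 0) (𝓝[K] (x : ℂ)) := by
      refine tendsto_nhdsWithin_iff.2 ⟨?_, by filter_upwards [hev] with ε hε using hmem' x hx' ε hε⟩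
      have : Continuous fun ε : ℝ => (x : ℂ) - ε * Complex.I := by fun_prop
      exact (by simpa using this.tendsto 0 : Tendsto _ (𝓝 (0 : ℝ)) (𝓝 (x : ℂ))).mono_left
        nhdsWithin_le_nhds
    have := (((hh x hx0).tendsto.comp e1).sub ((hh x hx0).tendsto.comp e2)).const_mul (f x)
    simpa using this

lemma differentiableAt_masslessAmplitude (S : Spectrum) {s u : ℂ} (hs : s ≠ 0) (hsu : s + u ≠ 0) :
    DifferentiableAt ℂ (fun z => S.masslessAmplitude z u) s := by
  unfold Spectrum.masslessAmplitude
  refine DifferentiableAt.neg (DifferentiableAt.fun_sum fun j _ => DifferentiableAt.const_mul ?_ _)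
  have d1 : DifferentiableAt ℂ (fun z : ℂ => -(z + u)) s := by fun_prop
  have d2 : DifferentiableAt ℂ (fun z : ℂ => z) s := by fun_prop
  refine DifferentiableAt.add (DifferentiableAt.add ?_ ?_) ?_
  · exact ((d1.pow j).add_const _).div d2 hs
  · exact ((d2.pow j).const_add _).div d1 (neg_ne_zero.2 hsu)
  · exact ((d2.pow j).add (d1.pow j)).div_const _

lemma WeakCouplingAnalytic.differentiableAt {d : ℕ} {A : ℂ → ℂ → ℂ} {S : Spectrum}
    (H : WeakCouplingAnalytic d A S) {u : ℝ} (hu : u < 0) {s : ℂ} (hs : s.im ≠ 0) :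
    DifferentiableAt ℂ (fun z => A z u) s := by
  refine (H.analyticAt u hu s ?_).differentiableAt
  rintro ⟨x, rfl, -⟩
  exact hs (Complex.ofReal_im x)

/-- The dispersion kernel in the variable `w = x + u / 2`, times a cut-off at `w = X`, and continued
by a ramp to a continuous function which vanishes for `w ≤ 3 * r / 4`. The power `L` of the
cut-off compensates for the growth of the amplitude near the real axis. -/
noncomputable def testFunction (k L : ℕ) (u r X x : ℝ) : ℝ :=
  max 0 (min 1 (4 * (x + u / 2) / r - 3)) *
    (((max r (x + u / 2) - u / 2) ^ (k + 1))⁻¹ +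
      (-1) ^ k * ((max r (x + u / 2) + u / 2) ^ (k + 1))⁻¹) *
    (max 0 (1 - (x + u / 2) ^ 2 / X ^ 2)) ^ L

section TestFunction

variable {k L : ℕ} {u r X : ℝ}

lemma continuous_testFunction (hu : -r < u) (hu0 : u < 0) :
    Continuous (testFunction k L u r X) := by
  unfold testFunction
  have h : ∀ x, 0 < max r (x + u / 2) + u / 2 := fun x => by
    have := le_max_left r (x + u / 2); linarith
  have h' : ∀ x, 0 < max r (x + u / 2) - u / 2 := fun x => by
    have := le_max_left r (x + u / 2); linarith
  have c1 : Continuous fun x => ((max r (x + u / 2) - u / 2) ^ (k + 1))⁻¹ :=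
    Continuous.inv₀ (by fun_prop) fun x => (pow_pos (h' x) _).ne'
  have c2 : Continuous fun x => ((max r (x + u / 2) + u / 2) ^ (k + 1))⁻¹ :=
    Continuous.inv₀ (by fun_prop) fun x => (pow_pos (h x) _).ne'
  have c3 : Continuous fun x : ℝ => max 0 (min 1 (4 * (x + u / 2) / r - 3)) := by fun_prop
  have c4 : Continuous fun x : ℝ => (max 0 (1 - (x + u / 2) ^ 2 / X ^ 2)) ^ L := by fun_prop
  exact (c3.mul (c1.add (c2.const_mul _))).mul c4

lemma testFunction_eq_zero_of_le (hr : 0 < r) {x : ℝ} (hx : x + u / 2 ≤ 3 * r / 4) :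
    testFunction k L u r X x = 0 := by
  have : 4 * (x + u / 2) / r - 3 ≤ 0 := by
    rw [sub_nonpos, div_le_iff₀ hr]; linarith
  rw [testFunction, max_eq_left ((min_le_right _ _).trans this), zero_mul, zero_mul]

lemma testFunction_eq_zero_of_ge (hL : L ≠ 0) (hX : 0 < X) {x : ℝ} (hx : X ≤ x + u / 2) :
    testFunction k L u r X x = 0 := by
  have : 1 - (x + u / 2) ^ 2 / X ^ 2 ≤ 0 := by
    rw [sub_nonpos, one_le_div (by positivity)]
    exact pow_le_pow_left₀ hX.le hx 2
  rw [testFunction, max_eq_left this, zero_pow hL, mul_zero]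

lemma testFunction_of_ge (hr : 0 < r) {x : ℝ} (hx : r ≤ x + u / 2) :
    testFunction k L u r X x = ((x ^ (k + 1))⁻¹ + (-1) ^ k * ((x + u) ^ (k + 1))⁻¹) *
      (max 0 (1 - (x + u / 2) ^ 2 / X ^ 2)) ^ L := by
  have : 1 ≤ 4 * (x + u / 2) / r - 3 := by
    rw [le_sub_iff_add_le, le_div_iff₀ hr]; linarith
  rw [testFunction, min_eq_left this, max_eq_right zero_le_one, one_mul, max_eq_right hx]
  ring_nf

lemma ofReal_testFunction (hr : 0 < r) {x : ℝ} (hx : r ≤ x + u / 2) (hX : x + u / 2 ≤ X) :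
    (testFunction k L u r X x : ℂ) = crossingKernel k u (x + u / 2 : ℝ) *
      (1 - ((x + u / 2 : ℝ) : ℂ) ^ 2 / X ^ 2) ^ L := by
  have hX0 : 0 < X := by linarith
  have : 0 ≤ 1 - (x + u / 2) ^ 2 / X ^ 2 := by
    rw [sub_nonneg, div_le_one (by positivity)]
    exact pow_le_pow_left₀ (hr.le.trans hx) hX 2
  rw [testFunction_of_ge hr hx, max_eq_right this, crossingKernel]
  push_cast
  ring_nf

lemma support_testFunction_subset (hL : L ≠ 0) (hr : 0 < r) (hX : 0 < X) :
    Function.support (testFunction k L u r X) ⊆ Set.Ioc (3 * r / 4 - u / 2) (X - u / 2) := by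
  intro x hx
  by_contra h
  rw [Set.mem_Ioc, not_and_or, not_lt, not_le] at h
  rcases h with h | h
  · exact hx (testFunction_eq_zero_of_le hr (by linarith))
  · exact hx (testFunction_eq_zero_of_ge hL hX (by linarith))

end TestFunction

/-! ### The dispersion relation with a cut-off -/

/-- The smeared discontinuity of the amplitude, at `u` and smeared with the test function of the
dispersion relation. -/
noncomputable def smearedDisc (d : ℕ) (ρ : ℕ → Measure ℝ) (k L : ℕ) (u r X : ℝ) : ℝ :=
  ∑' j, ∫ x, testFunction k L u r X x * x ^ ((4 - d : ℝ) / 2) * gegenbauer d j (1 + 2 * u / x) ∂(ρ j)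

/-- The crossing kernel with a cut-off at radius `X`. -/
noncomputable def cutoffKernel (k L : ℕ) (u X : ℝ) (w : ℂ) : ℂ :=
  crossingKernel k u w * (1 - w ^ 2 / X ^ 2) ^ L

lemma cutoffKernel_neg (k L : ℕ) (u X : ℝ) (w : ℂ) :
    cutoffKernel k L u X (-w) = -cutoffKernel k L u X w := by
  unfold cutoffKernel
  rw [crossingKernel_neg, neg_sq, neg_mul]

lemma differentiableAt_cutoffKernel {k L : ℕ} {u X r : ℝ} {w : ℂ} (hr : 0 < r) (hu : -r < u)
    (hu0 : u < 0) (hw : r ≤ ‖w‖) : DifferentiableAt ℂ (cutoffKernel k L u X) w := by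
  have hun : ‖(u : ℂ)‖ ≤ r := by
    rw [Complex.norm_real, Real.norm_of_nonpos hu0.le]; linarith
  exact (differentiableAt_crossingKernel hr hun hw).mul (by fun_prop)

lemma norm_cutoffKernel_le {k L : ℕ} {u X r : ℝ} {w : ℂ} (hr : 0 < r) (hu : -r < u)
    (hu0 : u < 0) (hw : ‖w‖ = r) (hX : r ≤ X) :
    ‖cutoffKernel k L u X w‖ ≤ 2 * (2 / r) ^ (k + 1) * 2 ^ L := by
  have hun : ‖(u : ℂ)‖ ≤ r := by
    rw [Complex.norm_real, Real.norm_of_nonpos hu0.le]; linarith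
  rw [cutoffKernel, norm_mul, norm_pow]
  have hX0 : 0 < X := hr.trans_le hX
  refine mul_le_mul (norm_crossingKernel_le hr hun hw.ge) (pow_le_pow_left₀ (norm_nonneg _) ?_ _)
    (by positivity) (by positivity)
  refine (norm_sub_le _ _).trans ?_
  rw [norm_one, norm_div, norm_pow, norm_pow, Complex.norm_real, Real.norm_of_nonneg hX0.le, hw]
  have : r ^ 2 / X ^ 2 ≤ 1 := by
    rw [div_le_one (by positivity)]; exact pow_le_pow_left₀ hr.le hX 2
  linarith

/-- On the circle of radius `X` the cut-off vanishes linearly at the real axis. -/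
lemma norm_one_sub_sq_div {X : ℝ} (hX : 0 < X) {w : ℂ} (hw : ‖w‖ = X) :
    ‖1 - w ^ 2 / X ^ 2‖ = 2 * |w.im| / X := by
  have hX' : (X : ℂ) ≠ 0 := by exact_mod_cast hX.ne'
  have h1 : (X : ℂ) ^ 2 = w * (starRingEnd ℂ) w := by
    rw [Complex.mul_conj, Complex.normSq_eq_norm_sq, hw]; push_cast; rfl
  have h2 : 1 - w ^ 2 / X ^ 2 = -(w * (2 * w.im * Complex.I)) / X ^ 2 := by
    rw [eq_div_iff (pow_ne_zero 2 hX'), sub_mul, div_mul_cancel₀ _ (pow_ne_zero 2 hX'), one_mul, h1,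
      ← Complex.ofReal_ofNat, ← Complex.ofReal_mul, ← Complex.sub_conj]
    ring
  rw [h2, norm_div, norm_neg, norm_mul, norm_mul, norm_mul, hw, norm_pow, Complex.norm_I,
    Complex.norm_real, Complex.norm_real, Complex.norm_ofNat, Real.norm_of_nonneg hX.le,
    Real.norm_eq_abs]
  field_simp

/-- The growth of `B` near the real axis is compensated for by the cut-off. -/
lemma norm_mul_cutoffKernel_le {B : ℂ → ℂ} {k L : ℕ} {u X r E ε : ℝ} (hu : -r < u)
    (hu0 : u < 0) (hX : 2 * r ≤ X) (hE : 0 ≤ E)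
    (hB : ∀ s : ℂ, X / 2 ≤ ‖s‖ → s.im ≠ 0 → (|s.im| / ‖s‖) ^ L * ‖B s‖ ≤ E * ‖s‖ ^ k)
    (hε : 0 < ε) (hεX : ε ≤ X / 4) {w : ℂ} (hw : ‖w‖ = X) (him : 0 < w.im) :
    ‖B (w + ε * Complex.I - u / 2) * cutoffKernel k L u X w‖ ≤ 4 ^ (k + L + 1) * E / X := by
  have hX0 : 0 < X := by linarith
  set s : ℂ := w + ε * Complex.I - u / 2 with hs
  have hun : ‖(u : ℂ)‖ = -u := by rw [Complex.norm_real, Real.norm_of_nonpos hu0.le]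
  have h1 : ‖ε * Complex.I - (u : ℂ) / 2‖ ≤ X / 2 := by
    refine (norm_sub_le _ _).trans ?_
    rw [norm_mul, Complex.norm_I, Complex.norm_real, Real.norm_of_nonneg hε.le, norm_div, hun,
      Complex.norm_ofNat]
    linarith
  have hs1 : X / 2 ≤ ‖s‖ := by
    have := norm_sub_norm_le w (-(ε * Complex.I - (u : ℂ) / 2))
    rw [norm_neg, sub_neg_eq_add, hw, ← add_sub_assoc] at this
    linarith
  have hs2 : ‖s‖ ≤ 2 * X := by
    have := norm_add_le w (ε * Complex.I - (u : ℂ) / 2)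
    rw [hw, ← add_sub_assoc] at this
    linarith
  have hsim : s.im = w.im + ε := by simp [hs]
  have hs0 : 0 < ‖s‖ := by linarith
  have hB' := hB s hs1 (by rw [hsim]; linarith)
  rw [hsim, abs_of_pos (by linarith)] at hB'
  have hker : ‖crossingKernel k u w‖ ≤ 2 * (2 / X) ^ (k + 1) :=
    norm_crossingKernel_le hX0 (by rw [hun]; linarith) hw.ge
  have hcut : ‖1 - w ^ 2 / X ^ 2‖ ≤ 4 * ((w.im + ε) / ‖s‖) := by
    rw [norm_one_sub_sq_div hX0 hw, abs_of_pos him]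
    calc 2 * w.im / X = 4 * (w.im / (2 * X)) := by field_simp; norm_num
      _ ≤ 4 * ((w.im + ε) / ‖s‖) := by gcongr; linarith
  rw [cutoffKernel, norm_mul, norm_mul, norm_pow]
  calc ‖B s‖ * (‖crossingKernel k u w‖ * ‖1 - w ^ 2 / X ^ 2‖ ^ L)
      ≤ ‖B s‖ * ((2 * (2 / X) ^ (k + 1)) * (4 * ((w.im + ε) / ‖s‖)) ^ L) := by gcongr
    _ = (2 * (2 / X) ^ (k + 1)) * 4 ^ L * (((w.im + ε) / ‖s‖) ^ L * ‖B s‖) := by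
        rw [mul_pow]; ring
    _ ≤ (2 * (2 / X) ^ (k + 1)) * 4 ^ L * (E * (2 * X) ^ k) := by
        refine mul_le_mul_of_nonneg_left (hB'.trans ?_) (by positivity)
        gcongr
    _ = 4 ^ (k + L + 1) * E / X := by
        have : (4 : ℝ) = 2 * 2 := by norm_num
        rw [div_pow, mul_pow, pow_add, pow_add, pow_one, this]
        simp only [mul_pow, pow_succ]
        field_simp
        ring

/-- Cauchy's theorem for the amplitude: its smeared discontinuity is fixed by the low-energy
series, up to the contribution of a half-circle of radius `X`. -/
lemma norm_smearedDisc_sub_le {d : ℕ} {A : ℂ → ℂ → ℂ} {S : Spectrum} {ρ : ℕ → Measure ℝ}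
    {c : ℕ → ℕ → ℂ} {η : ℝ} (H : IsLowEnergySeries A S c η) (hc : CrossingSymmetric A)
    (hA : WeakCouplingAnalytic d A S) (hP : PartialWaves d A S ρ) {k L : ℕ} (hL : L ≠ 0)
    {u r X E : ℝ} (hr : 0 < r) (hrη : 2 * r ≤ η) (hu : -r < u) (hu0 : u < 0) (hX : 2 * r ≤ X)
    (hE : 0 ≤ E)
    (hB : ∀ s : ℂ, X / 2 ≤ ‖s‖ → s.im ≠ 0 →
      (|s.im| / ‖s‖) ^ L * ‖A s u - S.masslessAmplitude s u‖ ≤ E * ‖s‖ ^ k) :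
    ‖2 * Real.pi * Complex.I * (smearedDisc d ρ k L u r X : ℂ) -
      archIntegral (fun w => lowEnergySum c (w - u / 2) u * cutoffKernel k L u X w) r‖ ≤
      Real.pi * 4 ^ (k + L + 1) * E := by
  have hX0 : 0 < X := by linarith
  have hun : ‖(u : ℂ)‖ = -u := by rw [Complex.norm_real, Real.norm_of_nonpos hu0.le]
  have huC : (u : ℂ) ≠ 0 := by exact_mod_cast hu0.ne
  set B : ℂ → ℂ := fun s => A s u - S.masslessAmplitude s u with hBdef
  have himne : ∀ s : ℂ, s.im ≠ 0 → s ≠ 0 ∧ s + u ≠ 0 := fun s hs =>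
    ⟨fun h => hs (by rw [h]; rfl), fun h => hs (by
      have := congrArg Complex.im h
      simpa using this)⟩
  have hAd : ∀ s : ℂ, s.im ≠ 0 → DifferentiableAt ℂ (fun z => A z u) s := fun s hs =>
    hA.differentiableAt hu0 hs
  have hmd : ∀ s : ℂ, s.im ≠ 0 → DifferentiableAt ℂ (fun z => S.masslessAmplitude z u) s :=
    fun s hs => differentiableAt_masslessAmplitude S (himne s hs).1 (himne s hs).2
  have hBd : ∀ s : ℂ, s.im ≠ 0 → DifferentiableAt ℂ B s := fun s hs => (hAd s hs).sub (hmd s hs)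
  have hBcross : ∀ s : ℂ, B (-(s + u)) = B s := fun s => by
    simp only [hBdef]
    rw [S.masslessAmplitude_cross, (hc s (-(s + u)) u (by ring)).2.2.2.1]
  have hBser : ∀ s : ℂ, ‖s‖ ≤ η → s.im ≠ 0 → B s = lowEnergySum c s u := fun s hs hs' =>
    H.eq_lowEnergySum hs (by rw [hun]; linarith) (himne s hs').1 huC (himne s hs').2
  -- shifting the contour up by `ε` keeps it away from the singularities on the real axis
  let G : ℝ → ℂ → ℂ := fun ε w => B (w + ε * Complex.I - u / 2) * cutoffKernel k L u X w
  have hGd : ∀ ε : ℝ, 0 < ε → ∀ w : ℂ, r ≤ ‖w‖ → 0 ≤ w.im → DifferentiableAt ℂ (G ε) w := by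
    intro ε hε w hw him
    refine DifferentiableAt.mul ?_ (differentiableAt_cutoffKernel hr hu hu0 hw)
    refine DifferentiableAt.comp w (g := B) (f := fun w : ℂ => w + ε * Complex.I - u / 2)
      (hBd _ ?_) (by fun_prop)
    have : (w + ε * Complex.I - u / 2).im = w.im + ε := by simp
    rw [this]
    linarith
  have hcauchy : ∀ ε : ℝ, 0 < ε → (∫ x in r..X, cutoffKernel k L u X x *
      (B (x + ε * Complex.I - u / 2) - B (x - ε * Complex.I - u / 2))) =
      archIntegral (G ε) r - archIntegral (G ε) X := by
    intro ε hε
    rw [← integral_add_comp_neg_eq_archIntegral_sub hr (by linarith)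
      (fun w h1 _ h3 => hGd ε hε w h1 h3)]
    refine intervalIntegral.integral_congr fun x _ => ?_
    have e1 : B (-x + ε * Complex.I - u / 2) = B (x - ε * Complex.I - u / 2) := by
      rw [← hBcross (x - ε * Complex.I - u / 2)]
      congr 1
      ring
    simp only [G, cutoffKernel_neg, e1]
    ring
  -- the inner half-circle
  have hinner : Tendsto (fun ε => archIntegral (G ε) r) (𝓝[>] 0)
      (𝓝 (archIntegral (fun w => lowEnergySum c (w - u / 2) u * cutoffKernel k L u X w) r)) := by
    have hsmall : ∀ᶠ ε : ℝ in 𝓝[>] 0, 0 < ε ∧ ε < r / 2 := by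
      filter_upwards [Ioo_mem_nhdsGT (half_pos hr)] with ε hε using hε
    have hsη : ∀ (w : ℂ) (ε : ℝ), ‖w‖ = r → 0 ≤ ε → ε < r / 2 →
        ‖w + ε * Complex.I - u / 2‖ < η := by
      intro w ε hw hε hε'
      refine (norm_sub_le _ _).trans_lt ?_
      refine (add_le_add (norm_add_le _ _) le_rfl).trans_lt ?_
      rw [norm_mul, Complex.norm_I, Complex.norm_real, Real.norm_of_nonneg hε, norm_div, hun,
        Complex.norm_ofNat, hw]
      linarith
    have hser : ∀ (w : ℂ) (ε : ℝ), ‖w‖ = r → 0 ≤ w.im → 0 < ε → ε < r / 2 →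
        G ε w = lowEnergySum c (w + ε * Complex.I - u / 2) u * cutoffKernel k L u X w := by
      intro w ε hw him hε hε'
      simp only [G]
      rw [hBser _ (hsη w ε hw hε.le hε').le]
      have : (w + ε * Complex.I - u / 2).im = w.im + ε := by simp
      rw [this]
      linarith
    refine tendsto_archIntegral hr (M := (∑' p : ℕ × ℕ, ‖c p.1 p.2‖ * η ^ p.1 * η ^ p.2) *
      (2 * (2 / r) ^ (k + 1) * 2 ^ L)) ?_ ?_ ?_
    · filter_upwards [hsmall] with ε hε w hw him
      exact (hGd ε hε.1 w hw.ge him).continuousAt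
    · filter_upwards [hsmall] with ε hε w hw him
      rw [hser w ε hw him hε.1 hε.2, norm_mul]
      refine mul_le_mul (H.norm_lowEnergySum_le (hsη w ε hw hε.1.le hε.2).le
        (by rw [hun]; linarith)) (norm_cutoffKernel_le hr hu hu0 hw (by linarith)) (norm_nonneg _)
        (tsum_nonneg fun p => ?_)
      have := H.pos
      positivity
    · intro w hw him
      have hcont : ContinuousAt (fun ε : ℝ => lowEnergySum c (w + ε * Complex.I - u / 2) u) 0 := by
        refine ContinuousAt.comp (g := fun z => lowEnergySum c z u)
          (f := fun ε : ℝ => w + ε * Complex.I - u / 2) (H.continuousAt_lowEnergySum ?_ ?_)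
          (by fun_prop)
        · exact hsη w 0 hw le_rfl (by positivity)
        · rw [hun]; linarith
      have h1 := (hcont.tendsto.mono_left (nhdsWithin_le_nhds (s := Set.Ioi 0))).mul_const
        (cutoffKernel k L u X w)
      simp only [Complex.ofReal_zero, zero_mul, add_zero] at h1
      refine h1.congr' ?_
      filter_upwards [hsmall] with ε hε
      rw [hser w ε hw him hε.1 hε.2]
  -- the outer half-circle
  have houter : ∀ᶠ ε : ℝ in 𝓝[>] 0, ‖archIntegral (G ε) X‖ ≤ Real.pi * 4 ^ (k + L + 1) * E := by
    filter_upwards [Ioo_mem_nhdsGT (by positivity : 0 < X / 4)] with ε hε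
    refine (norm_archIntegral_le hX0 (fun w hw him => norm_mul_cutoffKernel_le hu hu0 hX hE hB
      hε.1 hε.2.le hw him)).trans (le_of_eq ?_)
    field_simp
  -- the discontinuity
  set f : ℝ → ℝ := testFunction k L u r X with hf
  set a : ℝ := 3 * r / 4 - u / 2 with ha
  set b : ℝ := r - u / 2 with hb
  set e : ℝ := X - u / 2 with he
  have hab : a ≤ b := by linarith
  have hbe : b ≤ e := by linarith
  have hfc : Continuous f := continuous_testFunction hu hu0
  have hfs : Function.support f ⊆ Set.Ioc a e := support_testFunction_subset hL hr hX0
  have hts : tsupport f ⊆ Set.Icc a e :=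
    closure_minimal (hfs.trans Set.Ioc_subset_Icc_self) isClosed_Icc
  have hdisc := hP.discontinuity u hu0 f hfc
    (HasCompactSupport.of_support_subset_isCompact isCompact_Icc (hfs.trans Set.Ioc_subset_Icc_self))
    (fun x hx => by
      have := (hts hx).1
      rw [Set.mem_Ioi]
      linarith)
  have hfC : Continuous fun x => (f x : ℂ) := Complex.continuous_ofReal.comp hfc
  have hmass := tendsto_integral_sub_of_continuousOn (h := fun s => S.masslessAmplitude s u)
    (f := fun x => (f x : ℂ)) (a := a) (b := e) (hab.trans hbe) one_pos hfC (fun s hs => by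
      refine (differentiableAt_masslessAmplitude S ?_ ?_).continuousAt.continuousWithinAt
      · rintro rfl
        have := hs.1.1
        simp only [Complex.zero_re] at this
        linarith
      · intro h
        have h2 := congrArg Complex.re h
        have := hs.1.1
        simp at h2
        linarith)
  have hramp := tendsto_integral_sub_of_continuousOn (h := fun s => lowEnergySum c s u)
    (f := fun x => (f x : ℂ)) (a := a) (b := b) hab (ρ := r / 4) (by positivity) hfC (fun s hs => by
      refine (H.continuousAt_lowEnergySum ?_ (by rw [hun]; linarith)).continuousWithinAt
      refine (Complex.norm_le_abs_re_add_abs_im s).trans_lt ?_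
      have h1 : |s.re| ≤ b := abs_le.2 ⟨by linarith [hs.1.1], hs.1.2⟩
      have h2 : |s.im| ≤ r / 4 := abs_le.2 hs.2
      linarith)
  have hcontI : ∀ (h : ℂ → ℂ) (ε : ℝ), 0 < ε → (∀ s : ℂ, s.im ≠ 0 → DifferentiableAt ℂ h s) →
      Continuous fun x : ℝ => (f x : ℂ) * (h (x + ε * Complex.I) - h (x - ε * Complex.I)) := by
    intro h ε hε hh
    refine hfC.mul (Continuous.sub ?_ ?_)
    · refine continuous_iff_continuousAt.2 fun x => ContinuousAt.comp (g := h)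
        (f := fun x : ℝ => (x : ℂ) + ε * Complex.I) (hh _ ?_).continuousAt (by fun_prop)
      simpa using hε.ne'
    · refine continuous_iff_continuousAt.2 fun x => ContinuousAt.comp (g := h)
        (f := fun x : ℝ => (x : ℂ) - ε * Complex.I) (hh _ ?_).continuousAt (by fun_prop)
      simpa using hε.ne'
  have hsplit : ∀ᶠ ε : ℝ in 𝓝[>] 0, 2 * Complex.I * (∫ x : ℝ, (f x : ℂ) *
      ((A (x + ε * Complex.I) u - A (x - ε * Complex.I) u) / (2 * Complex.I))) -
      (∫ x in a..e, (f x : ℂ) * (S.masslessAmplitude (x + ε * Complex.I) u -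
        S.masslessAmplitude (x - ε * Complex.I) u)) -
      (∫ x in a..b, (f x : ℂ) * (lowEnergySum c (x + ε * Complex.I) u -
        lowEnergySum c (x - ε * Complex.I) u)) - archIntegral (G ε) r = -archIntegral (G ε) X := by
    filter_upwards [Ioo_mem_nhdsGT (by positivity : 0 < r / 4)] with ε hε
    have e1 : 2 * Complex.I * (∫ x : ℝ, (f x : ℂ) *
        ((A (x + ε * Complex.I) u - A (x - ε * Complex.I) u) / (2 * Complex.I))) =
        ∫ x in a..e, (f x : ℂ) * (A (x + ε * Complex.I) u - A (x - ε * Complex.I) u) := by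
      rw [intervalIntegral.integral_eq_integral_of_support_subset, ← integral_const_mul]
      · congr 1
        funext x
        have : (2 : ℂ) * Complex.I ≠ 0 := mul_ne_zero two_ne_zero Complex.I_ne_zero
        field_simp
      · refine Set.Subset.trans (fun x hx => ?_) hfs
        intro h0
        apply hx
        beta_reduce
        rw [h0, Complex.ofReal_zero, zero_mul]
    have e2 : (∫ x in a..e, (f x : ℂ) * (A (x + ε * Complex.I) u - A (x - ε * Complex.I) u)) -
        (∫ x in a..e, (f x : ℂ) * (S.masslessAmplitude (x + ε * Complex.I) u -
          S.masslessAmplitude (x - ε * Complex.I) u)) =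
        ∫ x in a..e, (f x : ℂ) * (B (x + ε * Complex.I) - B (x - ε * Complex.I)) := by
      rw [← intervalIntegral.integral_sub
        ((hcontI (fun s => A s u) ε hε.1 hAd).intervalIntegrable _ _)
        ((hcontI (fun s => S.masslessAmplitude s u) ε hε.1 hmd).intervalIntegrable _ _)]
      refine intervalIntegral.integral_congr fun x _ => ?_
      simp only [hBdef]
      ring
    have hBi := hcontI B ε hε.1 hBd
    have e3 : (∫ x in a..b, (f x : ℂ) * (lowEnergySum c (x + ε * Complex.I) u -
        lowEnergySum c (x - ε * Complex.I) u)) =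
        ∫ x in a..b, (f x : ℂ) * (B (x + ε * Complex.I) - B (x - ε * Complex.I)) := by
      refine intervalIntegral.integral_congr fun x hx => ?_
      rw [Set.uIcc_of_le hab] at hx
      have hxn : ‖(x : ℂ)‖ ≤ b := by
        rw [Complex.norm_real, Real.norm_of_nonneg (by linarith [hx.1])]; exact hx.2
      have hεn : ‖(ε : ℂ) * Complex.I‖ ≤ r / 4 := by
        rw [norm_mul, Complex.norm_I, Complex.norm_real, Real.norm_of_nonneg hε.1.le]
        linarith [hε.2]
      rw [hBser _ ((norm_add_le _ _).trans (by linarith)) (by simpa using hε.1.ne'),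
        hBser _ ((norm_sub_le _ _).trans (by linarith)) (by simpa using hε.1.ne')]
    have e4 : (∫ x in b..e, (f x : ℂ) * (B (x + ε * Complex.I) - B (x - ε * Complex.I))) =
        archIntegral (G ε) r - archIntegral (G ε) X := by
      rw [← hcauchy ε hε.1, hb, he, ← intervalIntegral.integral_comp_sub_right
        (fun x : ℝ => (f x : ℂ) * (B (x + ε * Complex.I) - B (x - ε * Complex.I)))]
      refine intervalIntegral.integral_congr fun x hx => ?_
      rw [Set.uIcc_of_le (by linarith)] at hx
      simp only [hf]
      rw [ofReal_testFunction hr (by linarith [hx.1]) (by linarith [hx.2]), cutoffKernel,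
        sub_add_cancel]
      push_cast
      rw [show (x : ℂ) - u / 2 + ε * Complex.I = x + ε * Complex.I - u / 2 by ring,
        show (x : ℂ) - u / 2 - ε * Complex.I = x - ε * Complex.I - u / 2 by ring]
    rw [e1, e2, e3, ← intervalIntegral.integral_add_adjacent_intervals (b := b)
      (hBi.intervalIntegrable _ _) (hBi.intervalIntegrable _ _), e4]
    ring
  have hlim := (((hdisc.const_mul (2 * Complex.I)).sub hmass).sub hramp).sub hinner
  have hfin := le_of_tendsto (hlim.norm) (by
    filter_upwards [hsplit, houter] with ε h1 h2
    rw [h1, norm_neg]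
    exact h2)
  refine le_trans (le_of_eq ?_) hfin
  congr 1
  rw [smearedDisc]
  push_cast
  ring

/-! ### The spectral measure -/

/-- The spectral density of spin `j` at positive `s`, with the factor of the partial wave
decomposition that does not depend on the spin. -/
noncomputable def spinMeasure (d : ℕ) (ρ : ℕ → Measure ℝ) (j : ℕ) : Measure ℝ :=
  ((ρ j).restrict (Set.Ioi 0)).withDensity fun x => ENNReal.ofReal (x ^ ((4 - d : ℝ) / 2))

/-- The spectral densities of all spins, as one measure on pairs of a spin and a squared mass. -/
noncomputable def spectralMeasure (d : ℕ) (ρ : ℕ → Measure ℝ) : Measure (ℕ × ℝ) :=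
  Measure.sum fun j => (spinMeasure d ρ j).map (Prod.mk j)

section SpectralMeasure

variable {d : ℕ} {A : ℂ → ℂ → ℂ} {S : Spectrum} {ρ : ℕ → Measure ℝ}

lemma measurable_density (d : ℕ) :
    Measurable fun x : ℝ => ENNReal.ofReal (x ^ ((4 - d : ℝ) / 2)) := by
  fun_prop

lemma measurableSet_pos_lt_cutoff (S : Spectrum) :
    MeasurableSet {x : ℝ | 0 < x ∧ ENNReal.ofReal x < S.cutoff ^ 2} :=
  (measurableSet_lt measurable_const measurable_id).inter
    (measurableSet_lt ENNReal.measurable_ofReal measurable_const)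

/-- On the support of the spectral measure spins are even, squared masses are positive, and below
the cut-off there is nothing but the exchanged states. -/
lemma PartialWaves.ae_spectralMeasure (hP : PartialWaves d A S ρ) :
    ∀ᵐ ω ∂(spectralMeasure d ρ), 0 < ω.2 ∧ Even ω.1 ∧ (ENNReal.ofReal ω.2 < S.cutoff ^ 2 →
      ∃ n, S.IsMassiveLevel n ∧ ω.2 = S.mass n ^ 2 ∧ S.coupling n ω.1 ≠ 0) := by
  rw [spectralMeasure, Measure.ae_sum_iff]
  intro j
  rw [(measurableEmbedding_prodMk_left j).ae_map_iff]
  refine (withDensity_absolutelyContinuous _ _).ae_le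
    (show ∀ᵐ x ∂((ρ j).restrict (Set.Ioi 0)), 0 < x ∧ Even j ∧ (ENNReal.ofReal x < S.cutoff ^ 2 →
      ∃ n, S.IsMassiveLevel n ∧ x = S.mass n ^ 2 ∧ S.coupling n j ≠ 0) from ?_)
  rcases Nat.even_or_odd j with hj | hj
  · have h1 : ∀ᵐ x ∂((ρ j).restrict {x | 0 < x ∧ ENNReal.ofReal x < S.cutoff ^ 2}),
        ∃ n, S.IsMassiveLevel n ∧ x = S.mass n ^ 2 ∧ S.coupling n j ≠ 0 := by
      rw [hP.below_cutoff j, Measure.ae_sum_iff]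
      rintro ⟨n, hn⟩
      by_cases hg : S.coupling n j = 0
      · simp [hg]
      · refine Measure.ae_smul_measure ?_ _
        rw [ae_dirac_eq]
        exact ⟨n, hn, rfl, hg⟩
    rw [ae_restrict_iff' (measurableSet_pos_lt_cutoff S)] at h1
    rw [ae_restrict_iff' measurableSet_Ioi]
    filter_upwards [h1] with x hx hx0
    exact ⟨hx0, hj, fun hlt => hx ⟨hx0, hlt⟩⟩
  · rw [hP.odd_eq_zero j hj]
    simp

lemma PartialWaves.spectralMeasure_singleton_ne_zero (hP : PartialWaves d A S ρ)
    (hS : S.IsAdmissible) {n j : ℕ} (hn : S.IsMassiveLevel n) (hg : S.coupling n j ≠ 0) :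
    spectralMeasure d ρ {(j, S.mass n ^ 2)} ≠ 0 := by
  intro h0
  have hm := hS.mass_pos hn
  have h1 : (spinMeasure d ρ j) {S.mass n ^ 2} = 0 := by
    have h2 := (Measure.le_sum (fun j => (spinMeasure d ρ j).map (Prod.mk j)) j)
      {(j, S.mass n ^ 2)}
    rw [show (Measure.sum fun j => (spinMeasure d ρ j).map (Prod.mk j)) = spectralMeasure d ρ from rfl,
      h0, Measure.map_apply measurable_prodMk_left (measurableSet_singleton _)] at h2
    refine le_antisymm (le_trans (measure_mono ?_) h2) zero_le
    rintro x rfl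
    simp
  have h3 : ((ρ j).restrict (Set.Ioi 0)) {S.mass n ^ 2} = 0 := by
    refine withDensity_absolutelyContinuous' (measurable_density d).aemeasurable ?_ h1
    rw [ae_restrict_iff' measurableSet_Ioi]
    refine Eventually.of_forall fun x hx => ?_
    rw [Ne, ENNReal.ofReal_eq_zero, not_le]
    exact Real.rpow_pos_of_pos hx _
  have h4 : ((ρ j).restrict {x | 0 < x ∧ ENNReal.ofReal x < S.cutoff ^ 2}) {S.mass n ^ 2} = 0 :=
    le_antisymm ((Measure.restrict_mono (fun x hx => hx.1) le_rfl _).trans h3.le) zero_le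
  rw [hP.below_cutoff j] at h4
  have h5 := Measure.le_sum (fun n : {n // S.IsMassiveLevel n} =>
      ENNReal.ofReal (S.mass n ^ 2 * S.coupling n j ^ 2) • Measure.dirac (S.mass n ^ 2)) ⟨n, hn⟩
      {S.mass n ^ 2}
  rw [h4] at h5
  simp only [Measure.smul_apply, smul_eq_mul, Measure.dirac_apply_of_mem (Set.mem_singleton _),
    mul_one, nonpos_iff_eq_zero, ENNReal.ofReal_eq_zero] at h5
  have : 0 < S.mass n ^ 2 * S.coupling n j ^ 2 := by positivity
  linarith

lemma PartialWaves.spectralMeasure_lt_top (hP : PartialWaves d A S ρ) {a b : ℝ} (ha : 0 < a) :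
    spectralMeasure d ρ (Prod.snd ⁻¹' Set.Icc a b) < ∞ := by
  obtain ⟨M, hM⟩ := (isCompact_Icc (a := a) (b := b)).exists_bound_of_continuousOn
    (f := fun x : ℝ => x ^ ((4 - d : ℝ) / 2))
    (fun x hx => (Real.continuousAt_rpow_const x _ (Or.inl (by linarith [hx.1] : 0 < x).ne')).continuousWithinAt)
  rw [spectralMeasure, Measure.sum_apply _ (measurable_snd measurableSet_Icc)]
  calc ∑' j, (spinMeasure d ρ j).map (Prod.mk j) (Prod.snd ⁻¹' Set.Icc a b)
      ≤ ∑' j, ENNReal.ofReal M * ρ j (Set.Icc a b) := by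
        refine ENNReal.tsum_le_tsum fun j => ?_
        have e : (Prod.mk j : ℝ → ℕ × ℝ) ⁻¹' (Prod.snd ⁻¹' Set.Icc a b) = Set.Icc a b := rfl
        rw [Measure.map_apply measurable_prodMk_left (measurable_snd measurableSet_Icc), e,
          spinMeasure, withDensity_apply _ measurableSet_Icc]
        calc ∫⁻ x in Set.Icc a b, ENNReal.ofReal (x ^ ((4 - d : ℝ) / 2)) ∂((ρ j).restrict (Set.Ioi 0))
            ≤ ∫⁻ _ in Set.Icc a b, ENNReal.ofReal M ∂((ρ j).restrict (Set.Ioi 0)) := by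
              refine setLIntegral_mono measurable_const fun x hx => ENNReal.ofReal_le_ofReal ?_
              exact (le_abs_self _).trans (hM x hx)
          _ ≤ ENNReal.ofReal M * ρ j (Set.Icc a b) := by
              rw [setLIntegral_const]
              gcongr
              exact Measure.restrict_le_self
    _ = ENNReal.ofReal M * ∑' j, ρ j (Set.Icc a b) := ENNReal.tsum_mul_left
    _ < ∞ := ENNReal.mul_lt_top ENNReal.ofReal_lt_top (hP.locallyFinite a b ha).lt_top

/-- Bounded functions of bounded support are integrable. -/
lemma PartialWaves.integrable_of_bound (hP : PartialWaves d A S ρ) {F : ℕ × ℝ → ℝ}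
    (hF : Measurable F) {a b C : ℝ} (ha : 0 < a)
    (hC : ∀ᵐ ω ∂(spectralMeasure d ρ), |F ω| ≤ C)
    (hs : ∀ᵐ ω ∂(spectralMeasure d ρ), ω.2 ∉ Set.Icc a b → F ω = 0) :
    Integrable F (spectralMeasure d ρ) := by
  have hI : Integrable (Set.indicator (Prod.snd ⁻¹' Set.Icc a b) fun _ : ℕ × ℝ => C)
      (spectralMeasure d ρ) := by
    rw [integrable_indicator_iff (measurable_snd measurableSet_Icc)]
    exact integrableOn_const (hP.spectralMeasure_lt_top ha).ne
  refine hI.mono' hF.aestronglyMeasurable ?_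
  filter_upwards [hC, hs] with ω h1 h2
  by_cases h : ω.2 ∈ Set.Icc a b
  · rw [Set.indicator_of_mem (show ω ∈ Prod.snd ⁻¹' Set.Icc a b from h)]
    exact h1
  · rw [Set.indicator_of_notMem (show ω ∉ Prod.snd ⁻¹' Set.Icc a b from h), h2 h, norm_zero]

/-- The sum over spins of the integrals against the spectral densities. -/
lemma integral_spectralMeasure {F : ℕ × ℝ → ℝ} (hF : Integrable F (spectralMeasure d ρ))
    (h0 : ∀ j x, x ≤ 0 → F (j, x) = 0) :
    ∫ ω, F ω ∂(spectralMeasure d ρ) =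
      ∑' j, ∫ x, F (j, x) * x ^ ((4 - d : ℝ) / 2) ∂(ρ j) := by
  rw [spectralMeasure] at hF ⊢
  rw [← (hasSum_integral_measure hF).tsum_eq]
  congr 1
  funext j
  rw [integral_map measurable_prodMk_left.aemeasurable
    (hF.mono_measure (Measure.le_sum _ j)).aestronglyMeasurable, spinMeasure,
    integral_withDensity_eq_integral_toReal_smul (measurable_density d)
    (Eventually.of_forall fun x => ENNReal.ofReal_lt_top)]
  rw [← setIntegral_eq_integral_of_forall_compl_eq_zero (s := Set.Ioi (0 : ℝ)) (μ := ρ j)]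
  · refine setIntegral_congr_fun measurableSet_Ioi fun x hx => ?_
    simp only [smul_eq_mul]
    rw [ENNReal.toReal_ofReal (Real.rpow_nonneg (le_of_lt hx) _), mul_comm]
  · intro x hx
    rw [h0 j x (not_lt.1 hx), zero_mul]

end SpectralMeasure

/-! ### The dispersion relation -/

lemma abs_dispersionKernel_le {d : ℕ} (hd : 3 ≤ d) (k : ℕ) {m u : ℝ} {ω : ℕ × ℝ} (hm : 0 < m)
    (hu : -(m / 2) ≤ u) (hu0 : u ≤ 0) (hω : m ≤ ω.2) :
    |dispersionKernel d k u ω| ≤ (1 + 2 ^ (k + 1)) * (ω.2 ^ (k + 1))⁻¹ := by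
  have hω0 := hm.trans_le hω
  have hv := neg_half_le_div hm (abs_le.2 ⟨hu, by linarith⟩) hω
  have hv' := (abs_le.1 hv).1
  rw [dispersionKernel_eq k hω0, gegenbauer_eq_eval hd, abs_mul, abs_mul,
    abs_of_pos (by positivity : 0 < (ω.2 ^ (k + 1))⁻¹), mul_comm]
  refine mul_le_mul_of_nonneg_right ?_ (by positivity)
  calc _ ≤ 1 * (1 + 2 ^ (k + 1) : ℝ) := by
        refine mul_le_mul (abs_eval_gegenbauerPoly_le_one hd _ hv'
          (div_nonpos_of_nonpos_of_nonneg hu0 hω0.le)) (abs_channelFactor_le k hv')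
          (abs_nonneg _) zero_le_one
    _ = _ := one_mul _

lemma measurable_dispersionKernel {d : ℕ} (hd : 3 ≤ d) (k : ℕ) (u : ℝ) :
    Measurable (dispersionKernel d k u) :=
  measurable_prod_nat (f := fun j x => gegenbauer d j (1 + 2 * u / x) *
      ((x ^ (k + 1))⁻¹ + (-1) ^ k * ((x + u) ^ (k + 1))⁻¹))
    fun j => by have := measurable_gegenbauer hd j; fun_prop

/-- In the forward limit the contributions of all spins to the sum rules for even `k` agree. -/
lemma tendsto_dispersionKernel {d : ℕ} (hd : 3 ≤ d) {k : ℕ} (hk : Even k) {ω : ℕ × ℝ}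
    (hω : 0 < ω.2) :
    Tendsto (fun u => dispersionKernel d k u ω) (𝓝 0) (𝓝 (2 * (ω.2 ^ (k + 1))⁻¹)) := by
  have h1 : Tendsto (fun u : ℝ => (ω.2 ^ (k + 1))⁻¹ *
      ((gegenbauerPoly d ω.1).eval (u / ω.2) * channelFactor k (u / ω.2))) (𝓝 0)
      (𝓝 ((ω.2 ^ (k + 1))⁻¹ * ((gegenbauerPoly d ω.1).eval (0 / ω.2) *
        channelFactor k (0 / ω.2)))) := by
    have hdiv : Tendsto (fun u : ℝ => u / ω.2) (𝓝 0) (𝓝 (0 / ω.2)) :=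
      tendsto_id.div_const _
    have hcf : ContinuousAt (channelFactor k) (0 / ω.2) := by
      have hc : ContinuousAt (fun v : ℝ => (1 + v) ^ (k + 1)) (0 / ω.2) := by fun_prop
      exact ((hc.inv₀ (by simp)).const_mul _).const_add _
    exact (((gegenbauerPoly d ω.1).continuous.tendsto _ |>.comp hdiv).mul
      (hcf.tendsto.comp hdiv)).const_mul _
  have h2 : (gegenbauerPoly d ω.1).eval 0 = 1 := by
    rw [← Polynomial.coeff_zero_eq_eval_zero, coeff_gegenbauerPoly, gegenbauerCoeff_zero]
  rw [zero_div, h2, channelFactor, hk.neg_one_pow] at h1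
  norm_num at h1
  rw [mul_comm]
  refine h1.congr fun u => ?_
  rw [dispersionKernel_eq k hω, gegenbauer_eq_eval hd]

/-- The cut-off of the dispersion relation. -/
noncomputable def cutoffFactor (L : ℕ) (u X x : ℝ) : ℝ := (max 0 (1 - (x + u / 2) ^ 2 / X ^ 2)) ^ L

lemma cutoffFactor_nonneg (L : ℕ) (u X x : ℝ) : 0 ≤ cutoffFactor L u X x :=
  pow_nonneg (le_max_left _ _) _

lemma cutoffFactor_le_one (L : ℕ) (u X x : ℝ) : cutoffFactor L u X x ≤ 1 := by
  refine pow_le_one₀ (le_max_left _ _) (max_le zero_le_one ?_)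
  have : 0 ≤ (x + u / 2) ^ 2 / X ^ 2 := by positivity
  linarith

lemma cutoffFactor_eq_zero {L : ℕ} (hL : L ≠ 0) {u X x : ℝ} (hX : 0 < X) (hx : X ≤ x + u / 2) :
    cutoffFactor L u X x = 0 := by
  have : 1 - (x + u / 2) ^ 2 / X ^ 2 ≤ 0 := by
    rw [sub_nonpos, one_le_div (by positivity)]
    exact pow_le_pow_left₀ hX.le hx 2
  rw [cutoffFactor, max_eq_left this, zero_pow hL]

lemma continuous_cutoffFactor (L : ℕ) (X x : ℝ) : Continuous fun u => cutoffFactor L u X x := by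
  unfold cutoffFactor; fun_prop

lemma measurable_cutoffFactor (L : ℕ) (u X : ℝ) : Measurable (cutoffFactor L u X) := by
  unfold cutoffFactor; fun_prop

lemma tendsto_cutoffFactor (L : ℕ) (u x : ℝ) :
    Tendsto (fun X => cutoffFactor L u X x) atTop (𝓝 1) := by
  have h1 : Tendsto (fun X : ℝ => (x + u / 2) ^ 2 / X ^ 2) atTop (𝓝 0) :=
    tendsto_const_nhds.div_atTop (tendsto_pow_atTop two_ne_zero)
  have h2 := ((tendsto_const_nhds (x := (0 : ℝ))).max (h1.const_sub 1)).pow L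
  simpa [cutoffFactor] using h2

/-- The dispersion kernel with a cut-off. -/
noncomputable def truncatedKernel (d k L : ℕ) (u X : ℝ) (ω : ℕ × ℝ) : ℝ :=
  dispersionKernel d k u ω * cutoffFactor L u X ω.2

lemma measurable_truncatedKernel {d : ℕ} (hd : 3 ≤ d) (k L : ℕ) (u X : ℝ) :
    Measurable (truncatedKernel d k L u X) :=
  (measurable_dispersionKernel hd k u).mul ((measurable_cutoffFactor L u X).comp measurable_snd)

lemma abs_truncatedKernel_le {d : ℕ} (hd : 3 ≤ d) (k L : ℕ) {m u X : ℝ} {ω : ℕ × ℝ} (hm : 0 < m)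
    (hu : -(m / 2) ≤ u) (hu0 : u ≤ 0) (hω : m ≤ ω.2) :
    |truncatedKernel d k L u X ω| ≤ (1 + 2 ^ (k + 1)) * (ω.2 ^ (k + 1))⁻¹ := by
  rw [truncatedKernel, abs_mul, abs_of_nonneg (cutoffFactor_nonneg _ _ _ _)]
  exact (mul_le_of_le_one_right (abs_nonneg _) (cutoffFactor_le_one _ _ _ _)).trans
    (abs_dispersionKernel_le hd k hm hu hu0 hω)

lemma inv_pow_le_inv_pow {m x : ℝ} (hm : 0 < m) (hx : m ≤ x) (n : ℕ) : (x ^ n)⁻¹ ≤ (m ^ n)⁻¹ :=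
  inv_anti₀ (pow_pos hm n) (pow_le_pow_left₀ hm.le hx n)

section

variable {d : ℕ} {A : ℂ → ℂ → ℂ} {S : Spectrum} {ρ : ℕ → Measure ℝ}

lemma smearedDisc_eq_integral (hd : 3 ≤ d) (hP : PartialWaves d A S ρ) {k L : ℕ} (hL : L ≠ 0)
    {m u r X : ℝ} (hm : ∀ᵐ ω ∂(spectralMeasure d ρ), m ≤ ω.2) (hrm : 2 * r ≤ m)
    (hr : 0 < r) (hu : -r < u) (hu0 : u < 0) (hX : 0 < X) :
    smearedDisc d ρ k L u r X = ∫ ω, truncatedKernel d k L u X ω ∂(spectralMeasure d ρ) := by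
  set F : ℕ × ℝ → ℝ := fun ω => testFunction k L u r X ω.2 * gegenbauer d ω.1 (1 + 2 * u / ω.2)
    with hF
  have hFt : F =ᵐ[spectralMeasure d ρ] truncatedKernel d k L u X := by
    filter_upwards [hm] with ω hω
    simp only [hF]
    rw [testFunction_of_ge hr (by linarith), truncatedKernel, dispersionKernel, cutoffFactor]
    ring
  have hzero : ∀ j x, x ∉ Set.Icc (3 * r / 4 - u / 2) (X - u / 2) → F (j, x) = 0 := by
    intro j x hx
    have : testFunction k L u r X x = 0 := by
      by_contra h
      exact hx (Set.Ioc_subset_Icc_self (support_testFunction_subset hL hr hX h))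
    simp only [hF, this, zero_mul]
  have hFm : Measurable F := measurable_prod_nat
    (f := fun j x => testFunction k L u r X x * gegenbauer d j (1 + 2 * u / x)) fun j => by
      have := measurable_gegenbauer hd j
      have := (continuous_testFunction (k := k) (L := L) (X := X) hu hu0).measurable
      fun_prop
  have hFi : Integrable F (spectralMeasure d ρ) := by
    refine hP.integrable_of_bound hFm (a := 3 * r / 4 - u / 2) (b := X - u / 2)
      (C := (1 + 2 ^ (k + 1)) * (m ^ (k + 1))⁻¹) (by linarith) ?_
      (Eventually.of_forall fun ω hω => hzero ω.1 ω.2 hω)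
    filter_upwards [hm, hFt] with ω hω hFω
    rw [hFω]
    refine (abs_truncatedKernel_le hd k L (by linarith) (by linarith) hu0.le hω).trans ?_
    exact mul_le_mul_of_nonneg_left (inv_pow_le_inv_pow (by linarith) hω _) (by positivity)
  rw [← integral_congr_ae hFt, integral_spectralMeasure hFi fun j x hx => hzero j x fun h => by
    linarith [h.1], smearedDisc]
  congr 1
  funext j
  congr 1
  funext x
  simp only [hF]
  ring

lemma PartialWaves.ae_le (hP : PartialWaves d A S ρ) (hS : S.IsAdmissible)
    (h1 : S.IsMassiveLevel 1) : ∀ᵐ ω ∂(spectralMeasure d ρ), S.mass 1 ^ 2 ≤ ω.2 := by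
  filter_upwards [hP.ae_spectralMeasure] with ω hω
  by_cases h : ENNReal.ofReal ω.2 < S.cutoff ^ 2
  · obtain ⟨n, hn, h2, -⟩ := hω.2.2 h
    rw [h2]
    exact pow_le_pow_left₀ (hS.mass_pos h1).le (hS.mass_le_mass hn.1 hn.2) 2
  · have := (hS.sq_mass_lt_cutoff h1).trans_le (not_lt.1 h)
    exact ((ENNReal.ofReal_lt_ofReal_iff hω.1).1 this).le

/-- At fixed `u` the massless poles grow in `s` at most with the power of their spin. -/
lemma exists_norm_masslessAmplitude_le (S : Spectrum) {u : ℂ} (hu : u ≠ 0) {k : ℕ}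
    (hk : ∀ j, S.masslessCoupling j ≠ 0 → j + 1 ≤ k) :
    ∃ D : ℝ, 0 ≤ D ∧ ∀ s : ℂ, 1 ≤ ‖s‖ → 2 * ‖u‖ ≤ ‖s‖ →
      ‖S.masslessAmplitude s u‖ * ‖s‖ ≤ D * ‖s‖ ^ k := by
  set D : ℕ → ℝ := fun j => |S.masslessCoupling j| ^ 2 * (1 / 2) *
    ((2 ^ j + 1) + (1 + 1) * 2 + (1 + 2 ^ j) / ‖u‖) with hD
  refine ⟨∑ j ∈ Finset.range ((S.maxSpin 0).toNat + 1), D j, Finset.sum_nonneg fun j _ => by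
    simp only [hD]; positivity, fun s hs hsu => ?_⟩
  have hu0 : 0 < ‖u‖ := norm_pos_iff.2 hu
  have ht1 : ‖-(s + u)‖ ≤ 2 * ‖s‖ := by
    rw [norm_neg]; have := norm_add_le s u; linarith
  have ht2 : 1 / 2 ≤ ‖-(s + u)‖ := by
    rw [norm_neg]
    have := norm_sub_norm_le s (-u)
    rw [norm_neg, sub_neg_eq_add] at this
    linarith
  have hus : ‖u‖ ≤ ‖s‖ := by linarith
  unfold Spectrum.masslessAmplitude
  rw [norm_neg, Finset.sum_mul]
  refine (mul_le_mul_of_nonneg_right (norm_sum_le _ _) (norm_nonneg s)).trans ?_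
  rw [Finset.sum_mul]
  refine Finset.sum_le_sum fun j _ => ?_
  by_cases hj : S.masslessCoupling j = 0
  · simp [hj, hD]
  have e1 : ‖((-(s + u)) ^ j + u ^ j) / s‖ ≤ (2 ^ j + 1) * ‖s‖ ^ j := by
    rw [norm_div]
    refine (div_le_self (norm_nonneg _) hs).trans ((norm_add_le _ _).trans ?_)
    rw [norm_pow, norm_pow, add_mul, one_mul, ← mul_pow]
    gcongr
  have e2 : ‖(u ^ j + s ^ j) / (-(s + u))‖ ≤ (1 + 1) * 2 * ‖s‖ ^ j := by
    rw [norm_div, div_le_iff₀ (by linarith)]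
    calc ‖u ^ j + s ^ j‖ ≤ ‖s‖ ^ j + ‖s‖ ^ j := by
          refine (norm_add_le _ _).trans ?_
          rw [norm_pow, norm_pow]
          gcongr
      _ = (1 + 1) * 2 * ‖s‖ ^ j * (1 / 2) := by ring
      _ ≤ _ := by gcongr
  have e3 : ‖(s ^ j + (-(s + u)) ^ j) / u‖ ≤ (1 + 2 ^ j) / ‖u‖ * ‖s‖ ^ j := by
    rw [norm_div, div_mul_eq_mul_div]
    refine div_le_div_of_nonneg_right ((norm_add_le _ _).trans ?_) hu0.le
    rw [norm_pow, norm_pow, add_mul, one_mul, ← mul_pow]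
    gcongr
  rw [norm_mul, norm_mul, norm_pow, Complex.norm_real, Real.norm_eq_abs]
  have hhalf : ‖(1 / 2 : ℂ)‖ = 1 / 2 := by norm_num
  rw [hhalf]
  calc _ ≤ |S.masslessCoupling j| ^ 2 * (1 / 2) *
        ((2 ^ j + 1) * ‖s‖ ^ j + (1 + 1) * 2 * ‖s‖ ^ j + (1 + 2 ^ j) / ‖u‖ * ‖s‖ ^ j) * ‖s‖ := by
        gcongr
        exact (norm_add_le _ _).trans (add_le_add ((norm_add_le _ _).trans (add_le_add e1 e2)) e3)
    _ = D j * ‖s‖ ^ (j + 1) := by simp only [hD]; ring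
    _ ≤ D j * ‖s‖ ^ k := by
        have : 0 ≤ D j := by simp only [hD]; positivity
        gcongr
        exacts [hk j hj]

lemma Spectrum.IsAdmissible.add_one_le {S : Spectrum} (hS : S.IsAdmissible) {k : ℕ}
    (hk : S.maxSpin 0 + 2 ≤ k) (j : ℕ) (hj : S.masslessCoupling j ≠ 0) : j + 1 ≤ k := by
  have : ¬ (S.maxSpin 0 < j) := fun h => hj (hS.masslessCoupling_eq_zero j (Or.inr h))
  omega

lemma abs_im_div_norm_le_one (s : ℂ) : |s.im| / ‖s‖ ≤ 1 :=
  div_le_one_of_le₀ (Complex.abs_im_le_norm s) (norm_nonneg s)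

/-- At fixed `u`, and off the real axis, the amplitude without its massless poles is `o(s ^ k)`. -/
lemma PolynomiallyBounded.exists_forall_norm_le {α : ℤ} (hS : S.IsAdmissible)
    (hB : PolynomiallyBounded α S A) {u : ℝ} (hu : u < 0) {k : ℕ} (hα : α ≤ k)
    (hk : S.maxSpin 0 + 2 ≤ k) : ∃ L : ℕ, L ≠ 0 ∧ ∀ E : ℝ, 0 < E → ∃ R : ℝ, ∀ s : ℂ, R ≤ ‖s‖ →
      s.im ≠ 0 → (|s.im| / ‖s‖) ^ L * ‖A s u - S.masslessAmplitude s u‖ ≤ E * ‖s‖ ^ k := by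
  obtain ⟨M, hM⟩ := hB.tendsto_zero u hu
  have huC : (u : ℂ) ≠ 0 := by exact_mod_cast hu.ne
  obtain ⟨D, hD0, hD⟩ := exists_norm_masslessAmplitude_le S huC (hS.add_one_le hk)
  refine ⟨M + 1, Nat.succ_ne_zero M, fun E hE => ?_⟩
  have hev := (tendsto_order.1 hM).2 (E / 2) (half_pos hE)
  rw [eventually_inf_principal, hasBasis_cobounded_norm.eventually_iff] at hev
  obtain ⟨R, -, hR⟩ := hev
  refine ⟨max R (max 1 (max (2 * ‖(u : ℂ)‖) (2 * D / E))), fun s hs him => ?_⟩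
  have s1 : R ≤ ‖s‖ := (le_max_left _ _).trans hs
  have s2 : 1 ≤ ‖s‖ := ((le_max_left _ _).trans (le_max_right _ _)).trans hs
  have s3 : 2 * ‖(u : ℂ)‖ ≤ ‖s‖ :=
    (((le_max_left _ _).trans (le_max_right _ _)).trans (le_max_right _ _)).trans hs
  have s4 : 2 * D / E ≤ ‖s‖ :=
    (((le_max_right _ _).trans (le_max_right _ _)).trans (le_max_right _ _)).trans hs
  have hs0 : 0 < ‖s‖ := by linarith
  set q : ℝ := |s.im| / ‖s‖ with hq
  have hq0 : 0 ≤ q := by positivity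
  have hq1 : q ≤ 1 := abs_im_div_norm_le_one s
  have b1 : q ^ (M + 1) * ‖A s u‖ ≤ E / 2 * ‖s‖ ^ k := by
    have h1 := (hR s1 him).le
    rw [mul_div_assoc', div_le_iff₀ (zpow_pos hs0 _)] at h1
    calc q ^ (M + 1) * ‖A s u‖ ≤ q ^ M * ‖A s u‖ := by
          refine mul_le_mul_of_nonneg_right ?_ (norm_nonneg _)
          exact pow_le_pow_of_le_one hq0 hq1 (Nat.le_succ M)
      _ ≤ E / 2 * ‖s‖ ^ α := h1
      _ ≤ E / 2 * ‖s‖ ^ (k : ℤ) := by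
          refine mul_le_mul_of_nonneg_left ?_ (half_pos hE).le
          exact zpow_le_zpow_right₀ s2 hα
      _ = _ := by rw [zpow_natCast]
  have b2 : q ^ (M + 1) * ‖S.masslessAmplitude s u‖ ≤ E / 2 * ‖s‖ ^ k := by
    calc q ^ (M + 1) * ‖S.masslessAmplitude s u‖ ≤ ‖S.masslessAmplitude s u‖ :=
          mul_le_of_le_one_left (norm_nonneg _) (pow_le_one₀ hq0 hq1)
      _ ≤ D * ‖s‖ ^ k / ‖s‖ := by
          rw [le_div_iff₀ hs0]; exact hD s s2 s3
      _ = D / ‖s‖ * ‖s‖ ^ k := by ring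
      _ ≤ E / 2 * ‖s‖ ^ k := by
          refine mul_le_mul_of_nonneg_right ?_ (by positivity)
          rw [div_le_iff₀ hs0]
          rw [div_le_iff₀ hE] at s4
          linarith
  calc q ^ (M + 1) * ‖A s u - S.masslessAmplitude s u‖
      ≤ q ^ (M + 1) * (‖A s u‖ + ‖S.masslessAmplitude s u‖) := by
        gcongr
        exact norm_sub_le _ _
    _ ≤ E * ‖s‖ ^ k := by rw [mul_add]; linarith

/-- The bound on the amplitude without its massless poles which is uniform in `u`. -/
lemma PolynomiallyBounded.exists_uniform {α : ℤ} (hB : PolynomiallyBounded α S A) {k : ℕ}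
    (hα : α ≤ k) (hk : S.maxSpin 0 + 2 ≤ k) : ∃ (L : ℕ) (δ E R : ℝ), L ≠ 0 ∧ 0 < δ ∧ 0 ≤ E ∧
      ∀ u : ℝ, -δ < u → u < 0 → ∀ s : ℂ, R ≤ ‖s‖ → s.im ≠ 0 →
        (|s.im| / ‖s‖) ^ L * ‖A s u - S.masslessAmplitude s u‖ ≤ E * ‖s‖ ^ k := by
  obtain ⟨M, δ, C, R, hδ, h⟩ := hB.bounded_near_zero
  refine ⟨M + 1, δ, max C 0, max R 1, Nat.succ_ne_zero M, hδ, le_max_right _ _,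
    fun u hu hu0 s hs him => ?_⟩
  have s1 : R ≤ ‖s‖ := (le_max_left _ _).trans hs
  have s2 : 1 ≤ ‖s‖ := (le_max_right _ _).trans hs
  have hq0 : 0 ≤ |s.im| / ‖s‖ := by positivity
  calc (|s.im| / ‖s‖) ^ (M + 1) * ‖A s u - S.masslessAmplitude s u‖
      ≤ (|s.im| / ‖s‖) ^ M * ‖A s u - S.masslessAmplitude s u‖ := by
        refine mul_le_mul_of_nonneg_right ?_ (norm_nonneg _)
        exact pow_le_pow_of_le_one hq0 (abs_im_div_norm_le_one s) (Nat.le_succ M)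
    _ ≤ C * ‖s‖ ^ max α (S.maxSpin 0 + 1) := h u hu hu0 s s1 him
    _ ≤ max C 0 * ‖s‖ ^ (k : ℤ) := by
        refine mul_le_mul (le_max_left _ _) (zpow_le_zpow_right₀ s2 (max_le hα (by omega)))
          (zpow_nonneg (norm_nonneg _) _) (le_max_right _ _)
    _ = _ := by rw [zpow_natCast]

end

section

variable {d : ℕ} {α : ℤ} {S : Spectrum} {ρ : ℕ → Measure ℝ} {A : ℂ → ℂ → ℂ} {c : ℕ → ℕ → ℂ}
  {η m r : ℝ} {K : ℕ}

/-- The uniform bound on the amplitude near the forward direction makes the moments of the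
spectral measure finite. -/
lemma IsStuAmplitude.integrable_inv_pow (hA : IsStuAmplitude d α S ρ A) (hd : 3 ≤ d)
    (H : IsLowEnergySeries A S c η) (hK : Even K) (hα : α ≤ K) (hJ : S.maxSpin 0 + 2 ≤ K)
    (hr : 0 < r) (hrη : 2 * r ≤ η) (hrm : 2 * r ≤ m)
    (hm : ∀ᵐ ω ∂(spectralMeasure d ρ), m ≤ ω.2) :
    Integrable (fun ω : ℕ × ℝ => (ω.2 ^ (K + 1))⁻¹) (spectralMeasure d ρ) := by
  have hP := hA.partialWaves
  have hm0 : 0 < m := by linarith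
  obtain ⟨L, δ, E, R, hL, hδ, hE, hB⟩ := hA.bounded.exists_uniform hα hJ
  set X₀ : ℝ := max (2 * r) (2 * R) with hX₀
  set C : ℝ := Real.pi * 4 ^ (K + L + 1) * E + Real.pi * r *
    ((∑' p : ℕ × ℕ, ‖c p.1 p.2‖ * η ^ p.1 * η ^ p.2) * (2 * (2 / r) ^ (K + 1) * 2 ^ L)) with hC
  have hpos : ∀ p : ℕ × ℕ, 0 ≤ ‖c p.1 p.2‖ * η ^ p.1 * η ^ p.2 := fun p => by
    have := H.pos
    positivity
  have hbound : ∀ X, X₀ ≤ X → ∀ u, -r < u → -δ < u → u < 0 →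
      ∫ ω, truncatedKernel d K L u X ω ∂(spectralMeasure d ρ) ≤ C := by
    intro X hX u hu hu' hu0
    have hX1 : 2 * r ≤ X := (le_max_left _ _).trans hX
    have hX2 : R ≤ X / 2 := by
      have : 2 * R ≤ X := (le_max_right _ _).trans hX
      linarith
    have hun : ‖(u : ℂ)‖ = -u := by rw [Complex.norm_real, Real.norm_of_nonpos hu0.le]
    rw [← smearedDisc_eq_integral hd hP hL hm hrm hr hu hu0 (by linarith)]
    set D := smearedDisc d ρ K L u r X with hD
    have h1 := norm_smearedDisc_sub_le H hA.crossing hA.analytic hP hL hr hrη hu hu0 hX1 hE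
      (fun s hs him => hB u hu' hu0 s (hX2.trans hs) him)
    have h2 : ‖archIntegral (fun w => lowEnergySum c (w - u / 2) u * cutoffKernel K L u X w) r‖ ≤
        Real.pi * r * ((∑' p : ℕ × ℕ, ‖c p.1 p.2‖ * η ^ p.1 * η ^ p.2) *
          (2 * (2 / r) ^ (K + 1) * 2 ^ L)) := by
      refine norm_archIntegral_le hr fun w hw _ => ?_
      rw [norm_mul]
      refine mul_le_mul (H.norm_lowEnergySum_le ?_ (by rw [hun]; linarith))
        (norm_cutoffKernel_le hr hu hu0 hw (by linarith)) (norm_nonneg _) (tsum_nonneg hpos)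
      refine (norm_sub_le _ _).trans ?_
      rw [norm_div, hun, Complex.norm_ofNat, hw]
      linarith
    have h3 : ‖2 * Real.pi * Complex.I * (D : ℂ)‖ = 2 * Real.pi * |D| := by
      rw [norm_mul, norm_mul, norm_mul, Complex.norm_I, Complex.norm_real, Complex.norm_real,
        Complex.norm_ofNat, Real.norm_of_nonneg Real.pi_pos.le, Real.norm_eq_abs, mul_one]
    have h4 : 2 * Real.pi * |D| ≤ C := by
      rw [← h3, hC]
      have := norm_le_norm_sub_add (2 * Real.pi * Complex.I * (D : ℂ))
        (archIntegral (fun w => lowEnergySum c (w - u / 2) u * cutoffKernel K L u X w) r)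
      linarith
    have h5 : |D| ≤ 2 * Real.pi * |D| :=
      le_mul_of_one_le_left (abs_nonneg _) (by linarith [Real.pi_gt_three])
    exact (le_abs_self _).trans (h5.trans h4)
  -- the forward limit, with a cut-off
  let G : ℝ → ℕ × ℝ → ℝ := fun X ω => 2 * (ω.2 ^ (K + 1))⁻¹ * cutoffFactor L 0 X ω.2
  have hG0 : ∀ X, ∀ ω : ℕ × ℝ, m ≤ ω.2 → 0 ≤ G X ω := fun X ω hω => by
    have : 0 < ω.2 := hm0.trans_le hω
    have := cutoffFactor_nonneg L 0 X ω.2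
    positivity
  have hGi : ∀ X, 0 < X → Integrable (G X) (spectralMeasure d ρ) := by
    intro X hX
    refine hP.integrable_of_bound (a := m) (b := X) (C := 2 * (m ^ (K + 1))⁻¹) ?_ hm0 ?_ ?_
    · have := (measurable_cutoffFactor L 0 X).comp (measurable_snd : Measurable (Prod.snd : ℕ × ℝ → ℝ))
      exact Measurable.mul (by fun_prop) this
    · filter_upwards [hm] with ω hω
      rw [abs_of_nonneg (hG0 X ω hω)]
      have h0 : 0 ≤ (ω.2 ^ (K + 1))⁻¹ := inv_nonneg.2 (pow_nonneg (by linarith) _)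
      refine (mul_le_of_le_one_right (by positivity) (cutoffFactor_le_one _ _ _ _)).trans ?_
      exact mul_le_mul_of_nonneg_left (inv_pow_le_inv_pow hm0 hω _) zero_le_two
    · filter_upwards [hm] with ω hω hω'
      have : X ≤ ω.2 + 0 / 2 := by
        rw [Set.mem_Icc, not_and] at hω'
        linarith [not_le.1 (hω' hω)]
      simp only [G]
      rw [cutoffFactor_eq_zero hL hX this, mul_zero]
  have hGle : ∀ X, X₀ ≤ X → ∫ ω, G X ω ∂(spectralMeasure d ρ) ≤ C := by
    intro X hX
    have hX0 : 0 < X := by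
      have : 2 * r ≤ X := (le_max_left _ _).trans hX
      linarith
    have hev : ∀ᶠ u : ℝ in 𝓝[<] 0, -r < u ∧ -δ < u ∧ u < 0 := by
      filter_upwards [Ioo_mem_nhdsLT (neg_lt_zero.2 hr), Ioo_mem_nhdsLT (neg_lt_zero.2 hδ)]
        with u h1 h2 using ⟨h1.1, h2.1, h1.2⟩
    have hlim : Tendsto (fun u => ∫ ω, truncatedKernel d K L u X ω ∂(spectralMeasure d ρ)) (𝓝[<] 0)
        (𝓝 (∫ ω, G X ω ∂(spectralMeasure d ρ))) := by
      refine tendsto_integral_filter_of_dominated_convergence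
        (Set.indicator (Prod.snd ⁻¹' Set.Icc m (X + r)) fun _ : ℕ × ℝ =>
          (1 + 2 ^ (K + 1)) * (m ^ (K + 1))⁻¹) ?_ ?_ ?_ ?_
      · exact Eventually.of_forall fun u => (measurable_truncatedKernel hd K L u X).aestronglyMeasurable
      · filter_upwards [hev] with u hu
        filter_upwards [hm] with ω hω
        by_cases h : ω.2 ∈ Set.Icc m (X + r)
        · rw [Set.indicator_of_mem (show ω ∈ Prod.snd ⁻¹' Set.Icc m (X + r) from h)]
          refine (abs_truncatedKernel_le hd K L hm0 (by linarith [hu.1]) hu.2.2.le hω).trans ?_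
          exact mul_le_mul_of_nonneg_left (inv_pow_le_inv_pow hm0 hω _) (by positivity)
        · rw [Set.indicator_of_notMem (show ω ∉ Prod.snd ⁻¹' Set.Icc m (X + r) from h)]
          have : X ≤ ω.2 + u / 2 := by
            rw [Set.mem_Icc, not_and] at h
            linarith [not_le.1 (h hω), hu.1]
          rw [truncatedKernel, cutoffFactor_eq_zero hL hX0 this, mul_zero, norm_zero]
      · rw [integrable_indicator_iff (measurable_snd measurableSet_Icc)]
        exact integrableOn_const (hP.spectralMeasure_lt_top hm0).ne
      · filter_upwards [hm] with ω hω
        exact ((tendsto_dispersionKernel hd hK (hm0.trans_le hω)).mul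
          ((continuous_cutoffFactor L X ω.2).tendsto 0)).mono_left nhdsWithin_le_nhds
    refine le_of_tendsto hlim ?_
    filter_upwards [hev] with u hu using hbound X hX u hu.1 hu.2.1 hu.2.2
  have hX₀' : 0 < X₀ := lt_of_lt_of_le (by linarith) (le_max_left _ _)
  have hI : Integrable (fun ω : ℕ × ℝ => 2 * (ω.2 ^ (K + 1))⁻¹ * 1) (spectralMeasure d ρ) := by
    refine integrable_of_tendsto_of_integral_le (G := fun n : ℕ => G (X₀ + n)) (C := C) ?_ ?_ ?_
    · refine Eventually.of_forall fun ω => ((tendsto_cutoffFactor L 0 ω.2).comp ?_).const_mul _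
      exact tendsto_atTop_add_const_left _ _ tendsto_natCast_atTop_atTop
    · exact fun n => hGi _ (by positivity)
    · intro n
      rw [integral_congr_ae (g := G (X₀ + n))]
      · exact hGle _ (by simp)
      · filter_upwards [hm] with ω hω
        exact Real.norm_of_nonneg (hG0 _ ω hω)
  refine (hI.const_mul (1 / 2)).congr (Eventually.of_forall fun ω => ?_)
  ring

/-- The dispersion relation: without the cut-off, the half-circle at infinity does not
contribute. -/
lemma IsStuAmplitude.hasSum_dispersion (hA : IsStuAmplitude d α S ρ A) (hd : 3 ≤ d)
    (H : IsLowEnergySeries A S c η) {k : ℕ} (hα : α ≤ k) (hJ : S.maxSpin 0 + 2 ≤ k)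
    (hr : 0 < r) (hrη : 2 * r ≤ η) (hrm : 2 * r ≤ m)
    (hm : ∀ᵐ ω ∂(spectralMeasure d ρ), m ≤ ω.2)
    (hI : Integrable (fun ω : ℕ × ℝ => (ω.2 ^ (k + 1))⁻¹) (spectralMeasure d ρ))
    {u : ℝ} (hu : -r < u) (hu0 : u < 0) :
    HasSum (fun q => (c k q).re * u ^ q) (∫ ω, dispersionKernel d k u ω ∂(spectralMeasure d ρ)) := by
  have hP := hA.partialWaves
  have hm0 : 0 < m := by linarith
  obtain ⟨L, hL, hB⟩ := hA.bounded.exists_forall_norm_le hA.admissible hu0 hα hJ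
  have hun : ‖(u : ℂ)‖ = -u := by rw [Complex.norm_real, Real.norm_of_nonpos hu0.le]
  set I := ∫ ω, dispersionKernel d k u ω ∂(spectralMeasure d ρ) with hIdef
  have hlim1 : Tendsto (fun X => ∫ ω, truncatedKernel d k L u X ω ∂(spectralMeasure d ρ)) atTop
      (𝓝 I) := by
    refine tendsto_integral_filter_of_dominated_convergence
      (fun ω => (1 + 2 ^ (k + 1)) * (ω.2 ^ (k + 1))⁻¹) ?_ ?_ (hI.const_mul _) ?_
    · exact Eventually.of_forall fun X => (measurable_truncatedKernel hd k L u X).aestronglyMeasurable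
    · refine Eventually.of_forall fun X => ?_
      filter_upwards [hm] with ω hω
      exact abs_truncatedKernel_le hd k L hm0 (by linarith) hu0.le hω
    · refine Eventually.of_forall fun ω => ?_
      simpa [truncatedKernel] using (tendsto_cutoffFactor L u ω.2).const_mul (dispersionKernel d k u ω)
  have hsη : ∀ w : ℂ, ‖w‖ = r → ‖w - u / 2‖ < η := fun w hw => by
    refine (norm_sub_le _ _).trans_lt ?_
    rw [norm_div, hun, Complex.norm_ofNat, hw]
    linarith
  have hlim2 : Tendsto (fun X => archIntegral
      (fun w => lowEnergySum c (w - u / 2) u * cutoffKernel k L u X w) r) atTop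
      (𝓝 (archIntegral (fun w => lowEnergySum c (w - u / 2) u * crossingKernel k u w) r)) := by
    refine tendsto_archIntegral hr (M := (∑' p : ℕ × ℕ, ‖c p.1 p.2‖ * η ^ p.1 * η ^ p.2) *
      (2 * (2 / r) ^ (k + 1) * 2 ^ L)) ?_ ?_ ?_
    · refine Eventually.of_forall fun X w hw _ => ?_
      refine ContinuousAt.mul ?_ (differentiableAt_cutoffKernel hr hu hu0 hw.ge).continuousAt
      exact ContinuousAt.comp (g := fun z => lowEnergySum c z u) (f := fun w : ℂ => w - u / 2)
        (H.continuousAt_lowEnergySum (hsη w hw) (by rw [hun]; linarith)) (by fun_prop)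
    · filter_upwards [eventually_ge_atTop r] with X hX w hw _
      rw [norm_mul]
      refine mul_le_mul (H.norm_lowEnergySum_le (hsη w hw).le (by rw [hun]; linarith))
        (norm_cutoffKernel_le hr hu hu0 hw hX) (norm_nonneg _) (tsum_nonneg fun p => ?_)
      have := H.pos
      positivity
    · intro w _ _
      have h1 : Tendsto (fun X : ℝ => w ^ 2 / (X : ℂ) ^ 2) atTop (𝓝 0) := by
        have h2 : Tendsto (fun X : ℝ => ((X ^ 2)⁻¹ : ℝ)) atTop (𝓝 0) :=
          tendsto_inv_atTop_zero.comp (tendsto_pow_atTop two_ne_zero)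
        have h3 := ((Complex.continuous_ofReal.tendsto 0).comp h2).const_mul (w ^ 2)
        simpa [Function.comp_def, div_eq_mul_inv] using h3
      have h4 := (((h1.const_sub 1).pow L).const_mul (crossingKernel k u w)).const_mul
        (lowEnergySum c (w - u / 2) u)
      simpa [cutoffKernel] using h4
  set W := archIntegral (fun w => lowEnergySum c (w - u / 2) u * crossingKernel k u w) r with hW
  have hzero : 2 * Real.pi * Complex.I * (I : ℂ) - W = 0 := by
    have hlim3 : Tendsto (fun X => 2 * Real.pi * Complex.I *
        ((∫ ω, truncatedKernel d k L u X ω ∂(spectralMeasure d ρ) : ℝ) : ℂ) -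
        archIntegral (fun w => lowEnergySum c (w - u / 2) u * cutoffKernel k L u X w) r) atTop
        (𝓝 (2 * Real.pi * Complex.I * (I : ℂ) - W)) :=
      (((Complex.continuous_ofReal.tendsto I).comp hlim1).const_mul _).sub hlim2
    have hle : ∀ E : ℝ, 0 < E → ‖2 * Real.pi * Complex.I * (I : ℂ) - W‖ ≤
        Real.pi * 4 ^ (k + L + 1) * E := by
      intro E hE
      obtain ⟨R, hR⟩ := hB E hE
      refine le_of_tendsto hlim3.norm ?_
      filter_upwards [eventually_ge_atTop (max (2 * r) (2 * R))] with X hX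
      have hX1 : 2 * r ≤ X := (le_max_left _ _).trans hX
      have hX2 : R ≤ X / 2 := by
        have : 2 * R ≤ X := (le_max_right _ _).trans hX
        linarith
      rw [← smearedDisc_eq_integral hd hP hL hm hrm hr hu hu0 (by linarith)]
      exact norm_smearedDisc_sub_le H hA.crossing hA.analytic hP hL hr hrη hu hu0 hX1 hE.le
        (fun s hs him => hR s (hX2.trans hs) him)
    refine norm_le_zero_iff.1 (le_of_forall_pos_le_add fun ε hε => ?_)
    have hc0 : 0 < Real.pi * 4 ^ (k + L + 1) := by positivity
    have := hle (ε / (Real.pi * 4 ^ (k + L + 1))) (by positivity)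
    rwa [mul_div_cancel₀ _ hc0.ne', ← zero_add ε] at this
  have hsum := H.hasSum_archIntegral hA.crossing k hr hrη hu hu0
  rw [← hW, ← sub_eq_zero.1 hzero] at hsum
  have h2pi : (2 * Real.pi * Complex.I : ℂ) ≠ 0 := Complex.two_pi_I_ne_zero
  have hsum' : HasSum (fun q => c k q * (u : ℂ) ^ q) (I : ℂ) := (hasSum_mul_left_iff h2pi).1 hsum
  have := Complex.hasSum_re hsum'
  simpa [← Complex.ofReal_pow] using this

end

/-- An amplitude obeys sum rules of any order which is even, at least `α`, and at least the
maximum spin of the massless states plus two. -/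
theorem IsStuAmplitude.exists_sumRules {d : ℕ} {α : ℤ} {S : Spectrum} {ρ : ℕ → Measure ℝ}
    {A : ℂ → ℂ → ℂ} (hA : IsStuAmplitude d α S ρ A) (hd : 3 ≤ d) (h1 : S.IsMassiveLevel 1) {K : ℕ}
    (hK : Even K) (hα : α ≤ K) (hJ : S.maxSpin 0 + 2 ≤ K) :
    ∃ (c : ℕ → ℕ → ℝ) (m δ : ℝ), (∀ k q, c k q = c q k) ∧
      SumRules d K m δ c (spectralMeasure d ρ) := by
  obtain ⟨c, η, H⟩ := exists_isLowEnergySeries hA.admissible h1 hA.crossing hA.lowEnergy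
  set m := S.mass 1 ^ 2 with hm
  have hm0 : 0 < m := pow_pos (hA.admissible.mass_pos h1) 2
  have hle := hA.partialWaves.ae_le hA.admissible h1
  have hη := H.pos
  set r : ℝ := min η m / 2 with hr
  have hr0 : 0 < r := half_pos (lt_min hη hm0)
  have hrη : 2 * r ≤ η := by linarith [min_le_left η m]
  have hrm : 2 * r ≤ m := by linarith [min_le_right η m]
  have hint := hA.integrable_inv_pow hd H hK hα hJ hr0 hrη hrm hle
  refine ⟨fun k q => (c k q).re, m, r, fun k q => congrArg Complex.re (H.symm k q), hd, hK, hm0, hr0, hle, ?_, hint,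
    fun k hk u hu hu0 => ?_⟩
  · filter_upwards [hA.partialWaves.ae_spectralMeasure] with ω hω using hω.2.1
  · have hkK : (K : ℤ) ≤ k := by exact_mod_cast hk
    refine hA.hasSum_dispersion hd H (hα.trans hkK) (hJ.trans hkK) hr0 hrη hrm hle ?_ hu hu0
    refine (hint.const_mul ((m ^ (k - K))⁻¹)).mono' (by fun_prop) ?_
    filter_upwards [hle] with ω hω
    have hω0 := hm0.trans_le hω
    rw [Real.norm_of_nonneg (by positivity), show k + 1 = (k - K) + (K + 1) by omega, pow_add,
      mul_inv]
    exact mul_le_mul_of_nonneg_right (inv_pow_le_inv_pow hm0 hω _) (by positivity)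

/-! ### Sequential spin constraints -/

/-- The spin at a massive level exceeds the preceding ones by at most two. -/
theorem IsStuAmplitude.maxSpin_le {d : ℕ} {α : ℤ} {S : Spectrum} {ρ : ℕ → Measure ℝ}
    {A : ℂ → ℂ → ℂ} (hA : IsStuAmplitude d α S ρ A) (hd : 3 ≤ d) {n : ℕ} (hn : S.IsMassiveLevel n)
    {T : ℤ} (hα : 2 * ⌊((α : ℚ) - 1) / 2⌋ ≤ T) (hT : ∀ l < n, S.maxSpin l ≤ T) :
    S.maxSpin n ≤ T + 2 := by
  have hS := hA.admissible
  by_contra! hlt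
  obtain ⟨hJ0, hJe⟩ := hS.maxSpin_massive n hn
  have h0 : S.maxSpin 0 ≤ T := hT 0 hn.1
  have h0e : -2 ≤ S.maxSpin 0 ∧ Even (S.maxSpin 0) := by
    rcases hS.maxSpin_massless with h | ⟨h, h', -⟩
    · rw [h]; exact ⟨le_rfl, by decide⟩
    · exact ⟨by linarith, h'⟩
  have hfl : α < 2 * ⌊((α : ℚ) - 1) / 2⌋ + 3 := by
    have := Int.lt_floor_add_one (((α : ℚ) - 1) / 2)
    have h2 : (α : ℚ) < 2 * ⌊((α : ℚ) - 1) / 2⌋ + 3 := by linarith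
    exact_mod_cast h2
  obtain ⟨a, ha⟩ := hJe
  obtain ⟨b, hb⟩ := h0e.2
  obtain ⟨K, hK⟩ : ∃ K : ℕ, S.maxSpin n = K + 2 := ⟨(S.maxSpin n - 2).toNat, by omega⟩
  have hKe : Even K := by
    rw [← Int.even_coe_nat]
    exact ⟨a - 1, by omega⟩
  have h1 : S.IsMassiveLevel 1 := ⟨le_rfl, Spectrum.isLevel_of_le hn.1 hn.2⟩
  obtain ⟨c, m, δ, hc, H⟩ := hA.exists_sumRules hd h1 hKe (by omega) (by omega)
  have hae := hA.partialWaves.ae_spectralMeasure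
  have hmn := hS.mass_pos hn
  set R : ℝ := S.mass n ^ 2 with hR
  have hR0 : 0 < R := pow_pos hmn 2
  have hRcut : ENNReal.ofReal R < S.cutoff ^ 2 := hS.sq_mass_lt_cutoff hn
  -- the next possible squared mass
  obtain ⟨R', hRR', hR'cut, hR'next⟩ : ∃ R', R < R' ∧ ENNReal.ofReal R' ≤ S.cutoff ^ 2 ∧
      (S.IsLevel (n + 1) → R' ≤ S.mass (n + 1) ^ 2) := by
    by_cases hl : S.IsLevel (n + 1)
    · refine ⟨S.mass (n + 1) ^ 2, ?_, (hS.sq_mass_lt_cutoff ⟨Nat.succ_pos n, hl⟩).le, fun _ => le_rfl⟩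
      exact pow_lt_pow_left₀ (hS.mass_lt_mass n (n + 1) n.lt_succ_self hl) hmn.le two_ne_zero
    · obtain ⟨y, hy0, hy1, hy2⟩ := ENNReal.lt_iff_exists_real_btwn.1 hRcut
      exact ⟨y, ((ENNReal.ofReal_lt_ofReal_iff_of_nonneg hR0.le).1 hy1), hy2.le, fun h => absurd h hl⟩
  -- the spins exchanged at a level
  have hspin : ∀ l j, S.IsMassiveLevel l → S.coupling l j ≠ 0 → (j : ℤ) ≤ S.maxSpin l := by
    intro l j hl hg
    by_contra! h
    exact hg (hS.coupling_eq_zero l hl j (Or.inr h))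
  refine H.gap_contradiction hc hR0 hRR' ?_ ?_ ?_ ?_
  · filter_upwards [hae] with ω ⟨hω0, _, hω⟩
    by_cases hcut : ENNReal.ofReal ω.2 < S.cutoff ^ 2
    · obtain ⟨l, hl, hωl, -⟩ := hω hcut
      rcases le_or_gt l n with h | h
      · left
        rw [hωl]
        exact pow_le_pow_left₀ (hS.mass_pos hl).le (hS.mass_le_mass h hn.2) 2
      · right
        have hl1 : S.IsLevel (n + 1) := Spectrum.isLevel_of_le h hl.2
        rw [hωl]
        exact (hR'next hl1).trans (pow_le_pow_left₀ (hS.mass_pos ⟨Nat.succ_pos n, hl1⟩).le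
          (hS.mass_le_mass h hl.2) 2)
    · right
      exact (ENNReal.ofReal_le_ofReal_iff hω0.le).1 (hR'cut.trans (not_lt.1 hcut))
  · filter_upwards [hae] with ω ⟨hω0, _, hω⟩ hωR
    obtain ⟨l, hl, hωl, hg⟩ := hω ((ENNReal.ofReal_le_ofReal hωR.le).trans_lt hRcut)
    have hln : l < n := by
      by_contra! h
      have := pow_le_pow_left₀ hmn.le (hS.mass_le_mass h hl.2) 2
      rw [← hωl] at this
      linarith
    have h2 := hspin l _ hl hg
    have h3 := hT l hln
    omega
  · filter_upwards [hae] with ω ⟨hω0, _, hω⟩ hωR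
    obtain ⟨l, hl, hωl, hg⟩ := hω (by rw [hωR]; exact hRcut)
    have hln : l = n := by
      rcases lt_trichotomy l n with h | h | h
      · have := pow_lt_pow_left₀ (hS.mass_lt_mass l n h hn.2) (hS.mass_pos hl).le two_ne_zero
        rw [← hωl, hωR] at this
        exact absurd this (lt_irrefl _)
      · exact h
      · have := pow_lt_pow_left₀ (hS.mass_lt_mass n l h hl.2) hmn.le two_ne_zero
        rw [← hωl, hωR] at this
        exact absurd this (lt_irrefl _)
    have h2 := hspin l _ hl hg
    rw [hln] at h2
    omega
  · refine hA.partialWaves.spectralMeasure_singleton_ne_zero hS hn ?_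
    have := hS.coupling_maxSpin n hn
    rwa [show (S.maxSpin n).toNat = K + 2 by omega] at this

end StuBootstrap

theorem theorem2 (d : ℕ) (hd : 3 ≤ d) (α : ℤ) (S : StuBootstrap.Spectrum) (ρ : ℕ → Measure ℝ)
    (A : ℂ → ℂ → ℂ) (hA : StuBootstrap.IsStuAmplitude d α S ρ A) :
    (∀ (n : ℕ) (hn : n ≠ 0), S.IsLevel n →
      S.maxSpin n ≤ max (2 * ⌊((α : ℚ) - 1) / 2⌋)
        ((Finset.range n).sup' (Finset.nonempty_range_iff.mpr hn) S.maxSpin) + 2) ∧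
    (∀ j : ℕ, Even j → max (2 * ⌈(α : ℚ) / 2⌉) (S.maxSpin 0 + 2) ≤ (j : ℤ) →
      ∀ n' : ℕ, S.IsLightest (j + 2) n' → ∃ n : ℕ, S.IsLightest j n ∧ S.mass n < S.mass n') := by
  have hS := hA.admissible
  refine ⟨fun n hn hl => hA.maxSpin_le hd ⟨Nat.one_le_iff_ne_zero.2 hn, hl⟩ (le_max_left _ _)
    fun l hln => le_max_of_le_right (Finset.le_sup' S.maxSpin (Finset.mem_range.2 hln)), ?_⟩
  intro j hj hjmax n' hn'
  have hjα : 2 * ⌈(α : ℚ) / 2⌉ ≤ (j : ℤ) := (le_max_left _ _).trans hjmax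
  have hj0 : S.maxSpin 0 + 2 ≤ (j : ℤ) := (le_max_right _ _).trans hjmax
  have hmassless : ∀ i : ℕ, j ≤ i → S.masslessCoupling i = 0 := fun i hi =>
    hS.masslessCoupling_eq_zero i (Or.inr (by omega))
  have hspin : ∀ l i, S.IsMassiveLevel l → S.coupling l i ≠ 0 → (i : ℤ) ≤ S.maxSpin l := by
    intro l i hl hg
    by_contra! h
    exact hg (hS.coupling_eq_zero l hl i (Or.inr h))
  have hex : S.IsMassiveLevel n' ∧ S.coupling n' (j + 2) ≠ 0 := by
    rcases hn'.1 with ⟨-, h⟩ | h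
    · exact absurd (hmassless (j + 2) (by omega)) h
    · exact h
  have hJn' : ((j + 2 : ℕ) : ℤ) ≤ S.maxSpin n' := hspin n' _ hex.1 hex.2
  have hP : ∃ l, S.IsMassiveLevel l ∧ (j : ℤ) ≤ S.maxSpin l :=
    ⟨n', hex.1, by push_cast at hJn'; omega⟩
  classical
  -- the lightest level at which the spin is at least `j`
  set l := Nat.find hP with hl
  obtain ⟨hlm, hlj⟩ : S.IsMassiveLevel l ∧ (j : ℤ) ≤ S.maxSpin l := Nat.find_spec hP
  have hjZ : Even (j : ℤ) := (Int.even_coe_nat j).2 hj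
  have hle := hA.maxSpin_le hd hlm (T := j - 2) (by
      have h1 := Int.floor_le (((α : ℚ) - 1) / 2)
      have h2 := Int.le_ceil ((α : ℚ) / 2)
      have h3 : (⌊((α : ℚ) - 1) / 2⌋ : ℚ) < (⌈(α : ℚ) / 2⌉ : ℚ) := by linarith
      have h4 : ⌊((α : ℚ) - 1) / 2⌋ < ⌈(α : ℚ) / 2⌉ := by exact_mod_cast h3
      omega)
    (fun p hp => by
      rcases Nat.eq_zero_or_pos p with rfl | hp0
      · omega
      · have hpm : S.IsMassiveLevel p := ⟨hp0, StuBootstrap.Spectrum.isLevel_of_le hp.le hlm.2⟩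
        have hpj : ¬ ((j : ℤ) ≤ S.maxSpin p) := fun h => Nat.find_min hP hp ⟨hpm, h⟩
        obtain ⟨a, ha⟩ := (hS.maxSpin_massive p hpm).2
        obtain ⟨b, hb⟩ := hjZ
        omega)
  have hlJ : S.maxSpin l = j := by omega
  have hln' : l < n' := by
    refine lt_of_le_of_ne (Nat.find_min' hP ⟨hex.1, by push_cast at hJn'; omega⟩) fun h => ?_
    rw [← h, hlJ] at hJn'
    push_cast at hJn'
    omega
  refine ⟨l, ⟨Or.inr ⟨hlm, ?_⟩, fun p hp => ?_⟩, hS.mass_lt_mass l n' hln' hex.1.2⟩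
  · have := hS.coupling_maxSpin l hlm
    rwa [hlJ, Int.toNat_natCast] at this
  · rcases hp with ⟨-, h⟩ | ⟨hpm, hg⟩
    · exact absurd (hmassless j le_rfl) h
    · exact Nat.find_min' hP ⟨hpm, hspin p j hpm hg⟩
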